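/- **Theorem (classical solutions of the fractional Hamilton–Jacobi–Bellman equation).** Let $d\in\mathbb N$, $T>0$, $\sigma\in(1,2)$. For a Borel measure $\mu\ge 0$ on $\mathbb R^d$ put $$\mathcal L\phi(x)=\int_{\mathbb R^d}\big[\phi(x+z)-\phi(x)-D\phi(x)\cdot z\,1_{|z|<1}\big]\,d\mu(z),\qquad \hat{\mathcal L}(\xi)=\int_{\mathbb R^d}\big(e^{i z\cdot\xi}-1-i\,\xi\cdot z\,1_{|z|<1}\big)\,d\mu(z),$$ let $K(t,\cdot)=\mathcal F^{-1}\big(e^{t\hat{\mathcal L}}\big)$ be the heat kernel of $\mathcal L$, and let $K^*$ be the heat kernel of the adjoint $\mathcal L^*$, i.e. of the operator of the same form with the measure $\mu^*(B)=\mu(-B)$. Consider $$\partial_t u-\mathcal L u+H(x,u,Du)=f(t,x)\ \text{ in }(0,T)\times\mathbb R^d,\qquad u(0,x)=u_0(x)\ \text{ in }\mathbb R^d. \tag{1}$$ Assume: * (L1) $\int_{\mathbb R^d}1\wedge|z|^2\,d\mu(z)\le\Lambda<\infty$. * (L2) (i) $r^\sigma\int_{|z|<1}\big(\tfrac{|z|^2}{r^2}\wedge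 1\big)\,d\mu(z)\le c_\mu$ for all $r\in(0,1)$. (ii) For $t\in(0,T)$ both $\kappa=K$ and $\kappa=K^*$ satisfy: $\kappa(t,\cdot)$ is smooth, $\kappa\ge0$, $\|\kappa(t,\cdot)\|_{L^1(\mathbb R^d)}=1$, and for every integer $k\ge0$ and every $p\in[1,\infty)$ $$\|D^k\kappa(t,\cdot)\|_{L^p(\mathbb R^d)}\le \mathcal K_{k,p}\;t^{-\frac1\sigma\left(k+(1-\frac1p)d\right)}.$$ * (A3) $H\in C^3(\mathbb R^d\times\mathbb R\times\mathbb R^d)$, and for every $R>0$: $|D^kH(x,u,p)|\le C_R$ for $k\le3$, $x\in\mathbb R^d$, $|u|\le R$, $|p|<R$. * (A4) For every $R>0$: $|H(x,u,p)-H(y,u,p)|\le A_R(|p|+1)|x-y|$ for $x,y,p\in\mathbb R^d$, $|u|\le R$. * (A5) $H(x,v,p)-H(x,u,p)\ge\gamma(v-u)$ for all $x,p\in\mathbb R^d$ and $u\le v$, with some $\gamma\in\mathbb R$. * (B1) $u_0\in C_b(\mathbb R^d)$ and $f\in C_b([0,T]\times\mathbb R^d)$, with $\|u_0\|_\infty,\|f\|_\infty\le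 M$. * (B2) $|f(t,x)-f(t,y)|+|u_0(x)-u_0(y)|\le L|x-y|$ for $t\in[0,T]$, $x,y\in\mathbb R^d$. * (B3) $f(t,\cdot)\in C^2_b(\mathbb R^d)$ with $|D^kf(t,x)|\le M_2$ for $k\le 2$, $t\in[0,T]$, $x\in\mathbb R^d$. * (B4) $u_0\in C_b^3(\mathbb R^d)$ with $|D^ku_0|\le M_3$ for $k\le3$. A bounded classical solution of (1) is a bounded function $u\in C([0,T]\times\mathbb R^d)$ such that $\partial_tu,\,Du,\,D^2u,\,\mathcal Lu$ exist and are continuous on $(0,T)\times\mathbb R^d$ and (1) holds at every point. Then (1) has exactly one bounded classical solution $u$. Moreover $\partial_tu,u,Du,D^2u,D^3u\in C_b((0,T)\times\mathbb R^d)$ and $$\|\partial_tu\|_{L^\infty}+\|u\|_{L^\infty}+\|Du\|_{L^\infty}+\|D^2u\|_{L^\infty}+\|D^3u\|_{L^\infty}\le c,$$ where $c$ depends only on $d$, $\sigma$, $T$ and on the constants $\Lambda$, $c_\mu$, $(\mathcal K_{k,p})_{k,p}$, $(C_R)_R$, $(A_R)_R$, $\gamma$, $M$, $L$, $M_2$,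 $M_3$. -/

import Mathlib

open MeasureTheory Set
open scoped ENNReal ContDiff FourierTransform RealInnerProductSpace

/-- The Euclidean space `ℝ^d`. -/
abbrev Rd (d : ℕ) : Type := EuclideanSpace ℝ (Fin d)

/-- The open space-time cylinder `(0,T) × ℝ^d`. -/
def spaceTime (d : ℕ) (T : ℝ) : Set (ℝ × Rd d) := Ioo 0 T ×ˢ univ

/-- The supremum norm of `g` over `Q`, with value `∞` if `g` is unbounded on `Q`. -/
noncomputable def supNorm {α F : Type*} [NormedAddCommGroup F] (Q : Set α) (g : α → F) : ℝ≥0∞ :=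
  ⨆ q ∈ Q, ‖g q‖ₑ

/-- The Lévy operator
`L φ (x) = ∫ (φ (x + z) - φ x - Dφ(x) ⬝ z 1_{|z| < 1}) dμ(z)`. -/
noncomputable def levyOp {d : ℕ} (μ : Measure (Rd d)) (φ : Rd d → ℝ) (x : Rd d) : ℝ :=
  ∫ z, (φ (x + z) - φ x - (Metric.ball (0 : Rd d) 1).indicator (fun z => fderiv ℝ φ x z) z) ∂μ

/-- The Fourier symbol of the Lévy operator,
`∫ (exp (i ξ⬝z) - 1 - i ξ⬝z 1_{|z| < 1}) dμ(z)`. -/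
noncomputable def levySymbol {d : ℕ} (μ : Measure (Rd d)) (ξ : Rd d) : ℂ :=
  ∫ z, (Complex.exp (Complex.I * (⟪ξ, z⟫ : ℝ)) - 1
    - (Metric.ball (0 : Rd d) 1).indicator (fun z => Complex.I * ((⟪ξ, z⟫ : ℝ) : ℂ)) z) ∂μ

/-- The heat kernel of the Lévy operator, the inverse Fourier transform of `exp (t * symbol)`:
`K(t,x) = (2π)^{-d} ∫ exp (i x⬝ξ) exp (t * symbol ξ) dξ`. Mathlib's inverse transform integrates
against `exp (2π i x⬝η)`, whence the substitution `ξ = 2π η`. The value is real, because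
the symbol at `-ξ` is the complex conjugate of the symbol at `ξ`. -/
noncomputable def heatKernel {d : ℕ} (μ : Measure (Rd d)) (t : ℝ) (x : Rd d) : ℝ :=
  (𝓕⁻ (fun η : Rd d => Complex.exp ((t : ℂ) * levySymbol μ ((2 * Real.pi) • η))) x).re

/-- The antipodal measure `B ↦ μ (-B)`, the Lévy measure of the adjoint operator. -/
noncomputable def antipodal {d : ℕ} (μ : Measure (Rd d)) : Measure (Rd d) :=
  μ.map (fun z => -z)

/-- The Lévy condition `∫ 1 ∧ |z|² dμ ≤ Λ` with a finite `Λ`. It makes `μ` finite on the sets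
`{|z| ≥ r}`, `r > 0`, so that `μ` is a Radon measure away from the origin. -/
def LevyCondition {d : ℕ} (μ : Measure (Rd d)) (Λ : ℝ) : Prop :=
  ∫⁻ z, ENNReal.ofReal (min 1 (‖z‖ ^ 2)) ∂μ ≤ ENNReal.ofReal Λ

/-- The upper bound of order `σ` on `μ` near the origin:
`r^σ ∫_{|z|<1} (|z|²/r² ∧ 1) dμ ≤ c` for `0 < r < 1`. -/
def UpperBound {d : ℕ} (μ : Measure (Rd d)) (σ c : ℝ) : Prop :=
  ∀ r ∈ Ioo (0 : ℝ) 1,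
    ENNReal.ofReal (r ^ σ) *
      ∫⁻ z in Metric.ball (0 : Rd d) 1, ENNReal.ofReal (min (‖z‖ ^ 2 / r ^ 2) 1) ∂μ
        ≤ ENNReal.ofReal c

/-- On `(0,T)` the heat kernel is smooth, a probability density, and its derivatives of order
`k` satisfy the `L^p` bounds of order `σ` with the constants `𝒦 k p`, `1 ≤ p < ∞`. -/
structure HeatKernelBounds {d : ℕ} (μ : Measure (Rd d)) (σ T : ℝ) (𝒦 : ℕ → ℝ → ℝ) : Prop where
  smooth : ∀ t ∈ Ioo 0 T, ContDiff ℝ ∞ (heatKernel μ t)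
  nonneg : ∀ t ∈ Ioo 0 T, ∀ x, 0 ≤ heatKernel μ t x
  mass : ∀ t ∈ Ioo 0 T, eLpNorm (heatKernel μ t) 1 volume = 1
  bound : ∀ (k : ℕ) (p : ℝ), 1 ≤ p → ∀ t ∈ Ioo 0 T,
    eLpNorm (iteratedFDeriv ℝ k (heatKernel μ t)) (ENNReal.ofReal p) volume
      ≤ ENNReal.ofReal (𝒦 k p * t ^ (-(1 / σ) * (k + (1 - 1 / p) * d)))

/-- Ellipticity of order `σ`: the upper bound on `μ`, and the heat kernel bounds for the
operator and for its adjoint. -/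
structure Elliptic {d : ℕ} (μ : Measure (Rd d)) (σ T c : ℝ) (𝒦 : ℕ → ℝ → ℝ) : Prop where
  upper : UpperBound μ σ c
  kernel : HeatKernelBounds μ σ T 𝒦
  kernel_adjoint : HeatKernelBounds (antipodal μ) σ T 𝒦

/-- The assumptions on the Hamiltonian `H (x, u, p)`: local bounds on the derivatives up to
order three, Lipschitz continuity in `x` with linear growth in `p`, and one-sided monotonicity
in `u`. -/
structure Hamiltonian {d : ℕ} (H : Rd d × ℝ × Rd d → ℝ) (C A : ℝ → ℝ) (γ : ℝ) : Prop where
  contDiff : ContDiff ℝ 3 H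
  bound : ∀ R > 0, ∀ x : Rd d, ∀ u ∈ Icc (-R) R, ∀ p ∈ Metric.ball (0 : Rd d) R, ∀ k ≤ 3,
    ‖iteratedFDeriv ℝ k H (x, u, p)‖ ≤ C R
  lipschitz : ∀ R > 0, ∀ x y : Rd d, ∀ u ∈ Icc (-R) R, ∀ p : Rd d,
    |H (x, u, p) - H (y, u, p)| ≤ A R * (‖p‖ + 1) * ‖x - y‖
  monotone : ∀ (x : Rd d) (u v : ℝ) (p : Rd d), u ≤ v →
    γ * (v - u) ≤ H (x, v, p) - H (x, u, p)

/-- The assumptions on the source `f` on `[0,T] × ℝ^d` and the initial value `u₀`. -/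
structure SourceAndInitial {d : ℕ} (T : ℝ) (f : ℝ → Rd d → ℝ) (u₀ : Rd d → ℝ)
    (M L M₂ M₃ : ℝ) : Prop where
  u₀_continuous : Continuous u₀
  u₀_bound : ∀ x, |u₀ x| ≤ M
  f_continuous : ContinuousOn (fun q : ℝ × Rd d => f q.1 q.2) (Icc 0 T ×ˢ univ)
  f_bound : ∀ t ∈ Icc 0 T, ∀ x, |f t x| ≤ M
  lipschitz : ∀ t ∈ Icc 0 T, ∀ x y, |f t x - f t y| + |u₀ x - u₀ y| ≤ L * ‖x - y‖
  f_contDiff : ∀ t ∈ Icc 0 T, ContDiff ℝ 2 (f t)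
  f_deriv_bound : ∀ t ∈ Icc 0 T, ∀ x, ∀ k ≤ 2, ‖iteratedFDeriv ℝ k (f t) x‖ ≤ M₂
  u₀_contDiff : ContDiff ℝ 3 u₀
  u₀_deriv_bound : ∀ x, ∀ k ≤ 3, ‖iteratedFDeriv ℝ k u₀ x‖ ≤ M₃

/-- `∂_t u` as a function on space-time. -/
noncomputable def timeDeriv {d : ℕ} (u : ℝ → Rd d → ℝ) (q : ℝ × Rd d) : ℝ :=
  deriv (fun s => u s q.2) q.1

/-- The `k`-th space derivative `D^k u` as a function on space-time. -/
noncomputable def spaceDeriv {d : ℕ} (k : ℕ) (u : ℝ → Rd d → ℝ) (q : ℝ × Rd d) :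
    ContinuousMultilinearMap ℝ (fun _ : Fin k => Rd d) ℝ :=
  iteratedFDeriv ℝ k (u q.1) q.2

/-- `u` is a bounded classical solution of
`∂_t u - L u + H(x, u, Du) = f` in `(0,T) × ℝ^d`, `u(0,·) = u₀`:
it is bounded and continuous on `[0,T] × ℝ^d`, the derivatives `∂_t u`, `Du`, `D²u` exist and,
with `L u`, are continuous on `(0,T) × ℝ^d`, and the equation holds at every point. Since
`u` is bounded and twice continuously differentiable in `x`, the integral `L u` converges. -/
structure IsClassicalSolution {d : ℕ} (T : ℝ) (μ : Measure (Rd d)) (H : Rd d × ℝ × Rd d → ℝ)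
    (f : ℝ → Rd d → ℝ) (u₀ : Rd d → ℝ) (u : ℝ → Rd d → ℝ) : Prop where
  bounded : ∃ B : ℝ, ∀ t ∈ Icc 0 T, ∀ x, |u t x| ≤ B
  continuousOn : ContinuousOn (fun q : ℝ × Rd d => u q.1 q.2) (Icc 0 T ×ˢ univ)
  differentiable_time : ∀ t ∈ Ioo 0 T, ∀ x, DifferentiableAt ℝ (fun s => u s x) t
  contDiff_space : ∀ t ∈ Ioo 0 T, ContDiff ℝ 2 (u t)
  continuousOn_timeDeriv : ContinuousOn (timeDeriv u) (spaceTime d T)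
  continuousOn_spaceDeriv : ∀ k ≤ 2, ContinuousOn (spaceDeriv k u) (spaceTime d T)
  continuousOn_levyOp : ContinuousOn (fun q : ℝ × Rd d => levyOp μ (u q.1) q.2) (spaceTime d T)
  equation : ∀ t ∈ Ioo 0 T, ∀ x,
    timeDeriv u (t, x) - levyOp μ (u t) x + H (x, u t x, gradient (u t) x) = f t x
  initial : ∀ x, u 0 x = u₀ x

/-!
The equation is solved in its mild form, after making the nonlinearity bounded; a priori bounds
from the maximum principle then show that the modification is not felt.

*Heat semigroup.* Since the heat kernel `K(t, ·)` has mass one, `exp (t * symbol)` is integrable,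
and it is the Fourier transform of `K(t, ·)`. Hence `K` is jointly continuous, and the convolutions
`P_t φ = K(t, ·) * φ` form a family with `‖P_t φ‖ ≤ ‖φ‖` and `‖D P_t φ‖ ≤ C t^(-1/σ) ‖φ‖`
(`HeatKernelBounds.isHeatKernel`). As `1 / σ < 1`, the Duhamel integral `∫₀ᵗ P_(t-s) g(s) ds` gains
a bounded and continuous space derivative over `g` (`IsHeatKernel.continuousOn_gradDuhamel`).
The Lévy operator generates `P`: it acts on plane waves as multiplication by its symbol, so
`P_t φ - φ = ∫₀ᵗ P_r L φ dr` for test functions, and by approximation for bounded functions with a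
bounded Lipschitz derivative (`HasLipschitzDeriv.solvesHeat`). So a mild solution whose source has
a bounded Lipschitz space derivative is differentiable in time and solves the equation pointwise
(`mild_eq_integral`, `levyOp_mild`).

*Bounded nonlinearities.* Let `h(x, u, p)` be bounded, with two bounded derivatives and a Lipschitz
second derivative. The Picard iteration for `∂ₜu - L u + h(x, u, Du) = f` is run for the jet
`(u, Du, D²u, D³u)` at once. Since `h` is bounded, `u` and `Du` are bounded; the equations for the
two higher derivatives are linear in the highest derivative, which the gain of one derivative
absorbs. The source `f` has only two derivatives, so the third derivative falls on the kernel.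
The norms carry the weight `exp (-l t)` with `l` large, for which the Duhamel operator is as small
as desired (`exists_weightMass_le`); thus the iteration converges on all of `(0,T)` and the bounds
are explicit (`exists_mild_solution`, `exists_isRegularSolution`).

*A priori bounds.* Let `h` be the Hamiltonian with its arguments `u` and `Du` truncated smoothly.
The maximum principle (`LevyCondition.max_principle`) bounds `|u|` independently of the truncation
(`IsRegularSolution.abs_le`). Applied to the differences `u(t, x + e) - u(t, x)`, it bounds `|Du|`
by a constant that depends on the truncation in `u` only (`IsRegularSolution.norm_fderiv_le`).
The levels are therefore chosen one after the other, first for `u`, then for `Du`, so that neither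
truncation is active along the solution. All constants depend on the data of the theorem only.

*Uniqueness.* Any two classical solutions are compared by the maximum principle. Where their
difference is nearly maximal, their gradients are close, and one of them, that of the solution
constructed, is bounded; so the local Lipschitz bound on the Hamiltonian suffices
(`IsClassicalSolution.le`).
-/

open Filter Topology Metric
set_option linter.unusedSectionVars false

/-! ### The Lévy operator -/

section LevyOperator

variable {d : ℕ} {μ : Measure (Rd d)} {Λ : ℝ}

theorem LevyCondition.integrable (h : LevyCondition μ Λ) :
    Integrable (fun z : Rd d => min 1 (‖z‖ ^ 2)) μ := by
  refine ⟨(by fun_prop : Measurable fun z : Rd d => min 1 (‖z‖ ^ 2)).aestronglyMeasurable, ?_⟩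
  rw [hasFiniteIntegral_iff_ofReal (ae_of_all _ fun z => by positivity)]
  exact h.trans_lt ENNReal.ofReal_lt_top

/-- The atom at the origin, which may have infinite mass, is the only obstacle to
`σ`-finiteness of a Lévy measure. -/
theorem LevyCondition.sFinite (h : LevyCondition μ Λ) : SFinite μ := by
  have h1 : SigmaFinite (μ.restrict {0}ᶜ) := by
    refine ⟨⟨⟨fun n => {0} ∪ {z | 1 / ((n : ℝ) + 1) ≤ min 1 (‖z‖ ^ 2)}, fun _ => trivial,
      fun n => ?_, ?_⟩⟩⟩
    · refine lt_of_le_of_lt ?_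
        (h.integrable.measure_ge_lt_top (ε := 1 / ((n : ℝ) + 1)) (by positivity))
      rw [Measure.restrict_apply' (measurableSet_singleton 0).compl]
      refine measure_mono fun z hz => ?_
      rcases hz with ⟨hz | hz, h0⟩
      · exact absurd hz h0
      · exact hz
    · refine eq_univ_of_forall fun z => ?_
      by_cases hz : z = 0
      · exact mem_iUnion.2 ⟨0, Or.inl hz⟩
      · have : 0 < min 1 (‖z‖ ^ 2) := by have := norm_pos_iff.2 hz; positivity
        obtain ⟨n, hn⟩ := exists_nat_one_div_lt this
        exact mem_iUnion.2 ⟨n, Or.inr hn.le⟩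
  have h2 : μ = μ.restrict {0} + μ.restrict {0}ᶜ :=
    (Measure.restrict_add_restrict_compl (measurableSet_singleton 0)).symm
  rw [h2, Measure.restrict_singleton]
  infer_instance

/-- The integrand of the Lévy operator, with a linear form `ℓ` in place of the derivative. -/
noncomputable def levyIntegrand (φ : Rd d → ℝ) (ℓ : Rd d →L[ℝ] ℝ) (x z : Rd d) : ℝ :=
  φ (x + z) - φ x - (ball (0 : Rd d) 1).indicator (fun z => ℓ z) z

theorem levyOp_eq (φ : Rd d → ℝ) (x : Rd d) :
    levyOp μ φ x = ∫ z, levyIntegrand φ (fderiv ℝ φ x) x z ∂μ := rfl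

theorem abs_levyIntegrand_le {φ : Rd d → ℝ} {φ' : Rd d → Rd d →L[ℝ] ℝ} {x : Rd d} {b₀ b₂ : ℝ}
    (hb : ∀ y, |φ y| ≤ b₀) (hφ : ∀ y ∈ closedBall x 1, HasFDerivAt φ (φ' y) y) (hb₂ : 0 ≤ b₂)
    (hL : ∀ y ∈ closedBall x 1, ‖φ' y - φ' x‖ ≤ b₂ * ‖y - x‖) (z : Rd d) :
    ‖levyIntegrand φ (φ' x) x z‖ ≤ (2 * b₀ + b₂) * min 1 (‖z‖ ^ 2) := by
  have hb₀ : 0 ≤ b₀ := (abs_nonneg _).trans (hb x)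
  by_cases hz : z ∈ ball (0 : Rd d) 1
  · have hz1 : ‖z‖ < 1 := by simpa using hz
    have hmin : min 1 (‖z‖ ^ 2) = ‖z‖ ^ 2 := min_eq_right (by nlinarith [norm_nonneg z])
    have hsub : closedBall x ‖z‖ ⊆ closedBall x 1 := closedBall_subset_closedBall hz1.le
    have key := (convex_closedBall x ‖z‖).norm_image_sub_le_of_norm_hasFDerivWithin_le'
      (f := φ) (f' := φ') (φ := φ' x) (C := b₂ * ‖z‖) (x := x) (y := x + z)
      (fun y hy => (hφ y (hsub hy)).hasFDerivWithinAt)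
      (fun y hy => (hL y (hsub hy)).trans (by
        gcongr; simpa [dist_eq_norm] using hy)) (by simp) (by simp)
    simp only [add_sub_cancel_left] at key
    rw [levyIntegrand, indicator_of_mem hz, hmin]
    nlinarith [sq_nonneg ‖z‖]
  · have hz1 : 1 ≤ ‖z‖ := by simpa using hz
    have hmin : min 1 (‖z‖ ^ 2) = 1 := min_eq_left (by nlinarith)
    rw [levyIntegrand, indicator_of_notMem hz, hmin, sub_zero, Real.norm_eq_abs]
    have := abs_sub (φ (x + z)) (φ x)
    linarith [hb (x + z), hb x]

theorem measurable_levyIntegrand {φ : Rd d → ℝ} (hφ : Measurable φ) (ℓ : Rd d →L[ℝ] ℝ)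
    (x : Rd d) : Measurable (levyIntegrand φ ℓ x) := by
  unfold levyIntegrand
  exact ((hφ.comp (measurable_const_add x)).sub_const _).sub
    ((ℓ.continuous.measurable).indicator measurableSet_ball)

theorem LevyCondition.integrable_levyIntegrand (h : LevyCondition μ Λ) {φ : Rd d → ℝ}
    {φ' : Rd d → Rd d →L[ℝ] ℝ} {x : Rd d} {b₀ b₂ : ℝ} (hm : Measurable φ)
    (hb : ∀ y, |φ y| ≤ b₀) (hφ : ∀ y ∈ closedBall x 1, HasFDerivAt φ (φ' y) y) (hb₂ : 0 ≤ b₂)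
    (hL : ∀ y ∈ closedBall x 1, ‖φ' y - φ' x‖ ≤ b₂ * ‖y - x‖) :
    Integrable (levyIntegrand φ (φ' x) x) μ :=
  (h.integrable.const_mul (2 * b₀ + b₂)).mono'
    (measurable_levyIntegrand hm _ _).aestronglyMeasurable
    (ae_of_all _ (abs_levyIntegrand_le hb hφ hb₂ hL))

theorem LevyCondition.integral_min_le (h : LevyCondition μ Λ) :
    ∫ z : Rd d, min 1 (‖z‖ ^ 2) ∂μ ≤ max Λ 0 := by
  rw [integral_eq_lintegral_of_nonneg_ae (ae_of_all _ fun z => by positivity)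
    h.integrable.aestronglyMeasurable]
  refine ENNReal.toReal_le_of_le_ofReal (le_max_right _ _) (h.trans ?_)
  exact ENNReal.ofReal_le_ofReal (le_max_left _ _)

theorem LevyCondition.abs_levyOp_le (h : LevyCondition μ Λ) {φ : Rd d → ℝ}
    {φ' : Rd d → Rd d →L[ℝ] ℝ} {b₀ b₂ : ℝ}
    (hb : ∀ y, |φ y| ≤ b₀) (hφ : ∀ y, HasFDerivAt φ (φ' y) y) (hb₂ : 0 ≤ b₂)
    (hL : ∀ x y, ‖φ' y - φ' x‖ ≤ b₂ * ‖y - x‖) (x : Rd d) :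
    |levyOp μ φ x| ≤ (2 * b₀ + b₂) * max Λ 0 := by
  have hb₀ : 0 ≤ b₀ := (abs_nonneg _).trans (hb x)
  rw [levyOp_eq, (hφ x).fderiv, ← Real.norm_eq_abs]
  refine (norm_integral_le_of_norm_le (h.integrable.const_mul (2 * b₀ + b₂))
    (ae_of_all _ (abs_levyIntegrand_le hb (fun y _ => hφ y) hb₂ (fun y _ => hL x y)))).trans ?_
  rw [integral_const_mul]
  gcongr
  exact h.integral_min_le

/-- Pointwise convergence of the functions and of their derivatives, with uniform bounds on
the functions and on the Lipschitz constants of the derivatives, passes to the Lévy operator. -/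
theorem LevyCondition.tendsto_levyOp (h : LevyCondition μ Λ) {φ : ℕ → Rd d → ℝ}
    {φ' : ℕ → Rd d → Rd d →L[ℝ] ℝ} {ψ : Rd d → ℝ} {ψ' : Rd d → Rd d →L[ℝ] ℝ} {b₀ b₂ : ℝ}
    (hb : ∀ n y, |φ n y| ≤ b₀) (hφ : ∀ n y, HasFDerivAt (φ n) (φ' n y) y) (hb₂ : 0 ≤ b₂)
    (hL : ∀ n x y, ‖φ' n y - φ' n x‖ ≤ b₂ * ‖y - x‖) {x : Rd d}
    (hψ : HasFDerivAt ψ (ψ' x) x) (h0 : ∀ y, Tendsto (fun n => φ n y) atTop (𝓝 (ψ y)))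
    (h1 : Tendsto (fun n => φ' n x) atTop (𝓝 (ψ' x))) :
    Tendsto (fun n => levyOp μ (φ n) x) atTop (𝓝 (levyOp μ ψ x)) := by
  simp only [levyOp_eq, (hφ _ x).fderiv, hψ.fderiv]
  have hmeas : ∀ n, Measurable (φ n) := fun n =>
    (continuous_iff_continuousAt.2 fun y => (hφ n y).continuousAt).measurable
  refine tendsto_integral_of_dominated_convergence (fun z => (2 * b₀ + b₂) * min 1 (‖z‖ ^ 2))
    (fun n => (measurable_levyIntegrand (hmeas n) _ _).aestronglyMeasurable)
    (h.integrable.const_mul _)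
    (fun n => ae_of_all _
      (abs_levyIntegrand_le (hb n) (fun y _ => hφ n y) hb₂ (fun y _ => hL n x y)))
    (ae_of_all _ fun z => ?_)
  unfold levyIntegrand
  refine ((h0 _).sub (h0 _)).sub ?_
  by_cases hz : z ∈ ball (0 : Rd d) 1
  · simp only [indicator_of_mem hz]
    exact ((ContinuousLinearMap.apply ℝ ℝ z).continuous.tendsto _).comp h1
  · simp only [indicator_of_notMem hz]
    exact tendsto_const_nhds

/-- The Lévy operator commutes with integration over a parameter. -/
theorem LevyCondition.levyOp_integral (h : LevyCondition μ Λ) {Ω : Type*} [MeasurableSpace Ω]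
    {m : Measure Ω} [SFinite m] {F : Ω → Rd d → ℝ} {F' : Ω → Rd d → Rd d →L[ℝ] ℝ} {b : Ω → ℝ}
    (hb : Integrable b m) (hF : StronglyMeasurable (Function.uncurry F)) {x : Rd d}
    (hF' : StronglyMeasurable fun w => F' w x) (h0 : ∀ w y, |F w y| ≤ b w)
    (h1 : Integrable (fun w => F' w x) m)
    (hd : ∀ w y, HasFDerivAt (F w) (F' w y) y)
    (hL : ∀ w y z, ‖F' w y - F' w z‖ ≤ b w * ‖y - z‖)
    (hD : HasFDerivAt (fun y => ∫ w, F w y ∂m) (∫ w, F' w x ∂m) x) :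
    levyOp μ (fun y => ∫ w, F w y ∂m) x = ∫ w, levyOp μ (F w) x ∂m ∧
      Integrable (fun w => levyOp μ (F w) x) m := by
  have := h.sFinite
  have hb0 : ∀ w, 0 ≤ b w := fun w => (abs_nonneg _).trans (h0 w 0)
  have hFi : ∀ y, Integrable (fun w => F w y) m := fun y =>
    hb.mono' (hF.comp_measurable measurable_prodMk_right).aestronglyMeasurable
      (ae_of_all _ fun w => h0 w y)
  have hmeas : StronglyMeasurable
      (Function.uncurry fun (w : Ω) (z : Rd d) => levyIntegrand (F w) (F' w x) x z) := by
    unfold levyIntegrand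
    refine ((hF.comp_measurable (g := fun p : Ω × Rd d => (p.1, x + p.2)) (by fun_prop)).sub
      (hF.comp_measurable (g := fun p : Ω × Rd d => (p.1, x)) (by fun_prop))).sub ?_
    have : (fun p : Ω × Rd d => (ball (0 : Rd d) 1).indicator (fun z => F' p.1 x z) p.2)
        = (univ ×ˢ ball (0 : Rd d) 1).indicator (fun p : Ω × Rd d => F' p.1 x p.2) := by
      ext p; by_cases hp : p.2 ∈ ball (0 : Rd d) 1 <;> simp [indicator, hp]
    have h2 : StronglyMeasurable (fun p : Ω × Rd d => F' p.1 x p.2) :=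
      (isBoundedBilinearMap_apply (𝕜 := ℝ) (E := Rd d) (F := ℝ)).continuous.comp_stronglyMeasurable
        ((hF'.comp_measurable measurable_fst).prodMk measurable_snd.stronglyMeasurable)
    change StronglyMeasurable
      (fun p : Ω × Rd d => (ball (0 : Rd d) 1).indicator (fun z => F' p.1 x z) p.2)
    rw [this]
    exact h2.indicator (MeasurableSet.univ.prod measurableSet_ball)
  have hint : Integrable
      (Function.uncurry fun (w : Ω) (z : Rd d) => levyIntegrand (F w) (F' w x) x z)
      (m.prod μ) := by
    refine ((hb.const_mul 3).mul_prod h.integrable).mono' hmeas.aestronglyMeasurable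
      (ae_of_all _ fun p => ?_)
    refine (abs_levyIntegrand_le (h0 p.1) (fun y _ => hd p.1 y) (hb0 _)
      (fun y _ => hL p.1 y x) p.2).trans (le_of_eq ?_)
    ring
  have e : ∀ w, levyOp μ (F w) x = ∫ z, levyIntegrand (F w) (F' w x) x z ∂μ := fun w => by
    rw [levyOp_eq, (hd w x).fderiv]
  simp only [e]
  refine ⟨?_, hint.integral_prod_left⟩
  rw [integral_integral_swap hint, levyOp_eq, hD.fderiv]
  refine integral_congr_ae (ae_of_all _ fun z => ?_)
  simp only [levyIntegrand]
  have hi : Integrable (fun w => (ball (0 : Rd d) 1).indicator (fun z => F' w x z) z) m := by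
    by_cases hz : z ∈ ball (0 : Rd d) 1
    · simp only [indicator_of_mem hz]; exact h1.apply_continuousLinearMap z
    · simp only [indicator_of_notMem hz]; exact integrable_zero _ _ _
  have hs : Integrable (fun w => F w (x + z) - F w x) m := (hFi _).sub (hFi _)
  rw [integral_sub hs hi, integral_sub (hFi _) (hFi _)]
  congr 1
  by_cases hz : z ∈ ball (0 : Rd d) 1
  · simp only [indicator_of_mem hz]; exact ContinuousLinearMap.integral_apply h1 z
  · simp only [indicator_of_notMem hz, integral_zero]

theorem ContDiff.exists_lipschitz_fderiv_closedBall {φ : Rd d → ℝ} (hφ : ContDiff ℝ 2 φ)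
    (x : Rd d) :
    ∃ b, 0 ≤ b ∧ ∀ y ∈ closedBall x 1, ‖fderiv ℝ φ y - fderiv ℝ φ x‖ ≤ b * ‖y - x‖ := by
  have h1 : ContDiff ℝ 1 (fderiv ℝ φ) := hφ.fderiv_right (by norm_num)
  obtain ⟨b, hb⟩ := (isCompact_closedBall x 1).exists_bound_of_continuousOn
    (h1.continuous_fderiv one_ne_zero).continuousOn
  refine ⟨b, (norm_nonneg _).trans (hb x (by simp)), fun y hy => ?_⟩
  exact (convex_closedBall x 1).norm_image_sub_le_of_norm_fderiv_le
    (fun z _ => (h1.differentiable one_ne_zero) z) hb (by simp) hy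

theorem levyOp_nonpos_of_isMax {φ : Rd d → ℝ} {x : Rd d} (hx : ∀ y, φ y ≤ φ x) :
    levyOp μ φ x ≤ 0 := by
  have h0 : fderiv ℝ φ x = 0 := IsLocalMax.fderiv_eq_zero (Eventually.of_forall hx)
  rw [levyOp_eq, h0]
  -- if the integral diverges, it is zero by convention and the bound holds as well
  refine integral_nonpos fun z => ?_
  simp [levyIntegrand, hx (x + z)]

theorem LevyCondition.levyOp_add_smul (h : LevyCondition μ Λ) {φ χ : Rd d → ℝ}
    (hφ : ContDiff ℝ 2 φ) (hχ : ContDiff ℝ 2 χ) {b b' : ℝ} (hb : ∀ y, |φ y| ≤ b)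
    (hb' : ∀ y, |χ y| ≤ b') (a : ℝ) (x : Rd d) :
    levyOp μ (fun y => φ y + a * χ y) x = levyOp μ φ x + a * levyOp μ χ x := by
  obtain ⟨c, hc0, hc⟩ := hφ.exists_lipschitz_fderiv_closedBall x
  obtain ⟨c', hc0', hc'⟩ := hχ.exists_lipschitz_fderiv_closedBall x
  have hd := fun y => ((hφ.differentiable two_ne_zero) y).hasFDerivAt
  have hd' := fun y => ((hχ.differentiable two_ne_zero) y).hasFDerivAt
  have i1 := h.integrable_levyIntegrand hφ.continuous.measurable hb (fun y _ => hd y) hc0 hc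
  have i2 := h.integrable_levyIntegrand hχ.continuous.measurable hb' (fun y _ => hd' y) hc0' hc'
  rw [levyOp_eq, levyOp_eq, levyOp_eq, ((hd x).fun_add ((hd' x).const_mul a)).fderiv,
    ← integral_const_mul, ← integral_add i1 (i2.const_mul a)]
  refine integral_congr_ae (ae_of_all _ fun z => ?_)
  simp only [levyIntegrand]
  by_cases hz : z ∈ ball (0 : Rd d) 1
  · simp only [indicator_of_mem hz]
    simp
    ring
  · simp only [indicator_of_notMem hz]
    ring

end LevyOperator

/-! ### The maximum principle -/

section MaximumPrinciple

variable {d : ℕ} {μ : Measure (Rd d)} {Λ : ℝ}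

theorem HasDerivAt.nonneg_of_forall_le {f : ℝ → ℝ} {f' t : ℝ} (hf : HasDerivAt f f' t)
    (ht : 0 < t) (h : ∀ s ∈ Icc 0 t, f s ≤ f t) : 0 ≤ f' := by
  have h1 := (hasDerivWithinAt_iff_tendsto_slope' (s := Iio t) (by simp)).1
    (hf.hasDerivWithinAt (s := Iio t))
  refine ge_of_tendsto h1 ?_
  filter_upwards [Ioo_mem_nhdsLT ht] with s hs
  rw [slope_def_field]
  exact div_nonneg_of_nonpos (by linarith [h s ⟨hs.1.le, hs.2.le⟩]) (by linarith [hs.2])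

theorem norm_sub_le_of_hasFDerivAt {E F : Type*} [NormedAddCommGroup E] [NormedSpace ℝ E]
    [NormedAddCommGroup F] [NormedSpace ℝ F] {f : E → F} {f' : E → E →L[ℝ] F} {C : ℝ}
    (hf : ∀ x, HasFDerivAt f (f' x) x) (hC : ∀ x, ‖f' x‖ ≤ C) (x y : E) :
    ‖f x - f y‖ ≤ C * ‖x - y‖ :=
  convex_univ.norm_image_sub_le_of_norm_hasFDerivWithin_le
    (fun z _ => (hf z).hasFDerivWithinAt) (fun z _ => hC z) (mem_univ y) (mem_univ x)

theorem exists_bound_fderiv_fderiv {E : Type*} [NormedAddCommGroup E] [NormedSpace ℝ E]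
    {f : E → ℝ} (hf : ContDiff ℝ 2 f) (hs : HasCompactSupport f) :
    ∃ C, 0 ≤ C ∧ (∀ x, ‖fderiv ℝ f x‖ ≤ C) ∧ ∀ x, ‖fderiv ℝ (fderiv ℝ f) x‖ ≤ C := by
  have h1 : ContDiff ℝ 1 (fderiv ℝ f) := hf.fderiv_right (by norm_num)
  obtain ⟨C1, hC1⟩ := (hs.fderiv ℝ).exists_bound_of_continuous h1.continuous
  have h2 : Continuous fun x => ‖fderiv ℝ (fderiv ℝ f) x‖ :=
    continuous_norm.comp (h1.continuous_fderiv one_ne_zero)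
  have h3 : HasCompactSupport fun x => ‖fderiv ℝ (fderiv ℝ f) x‖ :=
    ((hs.fderiv ℝ).fderiv ℝ).mono fun x hx h0 => hx (by
      simp only [h0]; exact ContinuousLinearMap.opNorm_zero)
  obtain ⟨C2, hC2⟩ := h3.exists_bound_of_continuous h2
  exact ⟨max C1 C2, ((norm_nonneg _).trans (hC1 0)).trans (le_max_left _ _),
    fun x => (hC1 x).trans (le_max_left _ _),
    fun x => ((le_abs_self _).trans (hC2 x)).trans (le_max_right _ _)⟩

theorem exists_bump (d : ℕ) : ∃ (χ : Rd d → ℝ) (C : ℝ), 0 ≤ C ∧ ContDiff ℝ 2 χ ∧ χ 0 = 1 ∧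
    (∀ y, 0 ≤ χ y ∧ χ y ≤ 1) ∧ (∀ y, 2 ≤ ‖y‖ → χ y = 0) ∧ (∀ y, ‖fderiv ℝ χ y‖ ≤ C) ∧
    ∀ y z, ‖fderiv ℝ χ y - fderiv ℝ χ z‖ ≤ C * ‖y - z‖ := by
  obtain ⟨χ, hrIn, hrOut⟩ : ∃ χ : ContDiffBump (0 : Rd d), χ.rIn = 1 ∧ χ.rOut = 2 :=
    ⟨⟨1, 2, one_pos, one_lt_two⟩, rfl, rfl⟩
  have hχ : ContDiff ℝ 2 χ := χ.contDiff
  have h1 : ContDiff ℝ 1 (fderiv ℝ χ) := hχ.fderiv_right (by norm_num)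
  obtain ⟨C, hC0, hC1, hC2⟩ := exists_bound_fderiv_fderiv hχ χ.hasCompactSupport
  exact ⟨χ, C, hC0, hχ, χ.one_of_mem_closedBall (by simp [hrIn]),
    fun y => ⟨χ.nonneg, χ.le_one⟩, fun y hy => χ.zero_of_le_dist (by simpa [hrOut] using hy),
    hC1, norm_sub_le_of_hasFDerivAt
      (fun w => ((h1.differentiable one_ne_zero) w).hasFDerivAt) hC2⟩

/-- A maximum principle on the whole space, without decay at infinity: if `exp (-λ t) w` rises
above its initial bound `m`, there are points with `exp (-λ t) w` near its supremum where
`Dw` and `L w` are as small as desired and `∂_t w - λ w` is nonnegative. They are maximum points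
after adding a small multiple of a bump function centred near the supremum; a compactly supported
perturbation is needed since `μ` may have no moments at infinity. -/
theorem LevyCondition.max_principle (h : LevyCondition μ Λ) {T l m B : ℝ}
    {w : ℝ → Rd d → ℝ}
    (hc : ContinuousOn (fun q : ℝ × Rd d => w q.1 q.2) (Icc 0 T ×ˢ univ))
    (hB : ∀ t ∈ Icc 0 T, ∀ x, |w t x| ≤ B)
    (hd : ∀ t ∈ Ioc 0 T, ∀ x, DifferentiableAt ℝ (fun s => w s x) t)
    (h2 : ∀ t ∈ Ioc 0 T, ContDiff ℝ 2 (w t)) (h0 : ∀ x, w 0 x ≤ m)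
    (key : ∀ ε > 0, ∃ δ > 0, ∀ t ∈ Ioc 0 T, ∀ x, m + ε ≤ Real.exp (-(l * t)) * w t x →
      ‖fderiv ℝ (w t) x‖ ≤ δ → levyOp μ (w t) x ≤ δ →
      deriv (fun s => w s x) t - l * w t x ≤ -δ) :
    ∀ t ∈ Icc 0 T, ∀ x, Real.exp (-(l * t)) * w t x ≤ m := by
  by_contra! hcon
  obtain ⟨t₀, ht₀, x₀, hx₀⟩ := hcon
  obtain ⟨χ, C, hC, hχ, hχ0, hχ1, hχ2, hχ3, hχ4⟩ := exists_bump d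
  set W : ℝ → Rd d → ℝ := fun t x => Real.exp (-(l * t)) * w t x with hW
  set K : ℝ := Real.exp (|l| * T) with hK
  have hT0 : 0 ≤ T := ht₀.1.trans ht₀.2
  have hexp : ∀ t ∈ Icc 0 T, Real.exp (-(l * t)) ≤ K ∧ Real.exp (l * t) ≤ K := by
    intro t ht
    have : |l * t| ≤ |l| * T := by
      rw [abs_mul, abs_of_nonneg ht.1]; gcongr; exact ht.2
    exact ⟨Real.exp_le_exp.2 ((neg_le_abs _).trans this),
      Real.exp_le_exp.2 ((le_abs_self _).trans this)⟩
  have hB0 : 0 ≤ B := (abs_nonneg _).trans (hB t₀ ht₀ x₀)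
  set A : Set ℝ := (fun q : ℝ × Rd d => W q.1 q.2) '' (Icc 0 T ×ˢ univ) with hA
  have hAb : BddAbove A := by
    refine ⟨K * B, ?_⟩
    rintro _ ⟨q, hq, rfl⟩
    calc Real.exp (-(l * q.1)) * w q.1 q.2 ≤ Real.exp (-(l * q.1)) * B := by
          gcongr; exact (le_abs_self _).trans (hB _ hq.1 _)
      _ ≤ K * B := by gcongr; exact (hexp _ hq.1).1
  have hAle : ∀ t ∈ Icc 0 T, ∀ x, W t x ≤ sSup A := fun t ht x =>
    le_csSup hAb ⟨(t, x), ⟨ht, mem_univ _⟩, rfl⟩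
  set S := sSup A with hS
  have hSm : m < S := hx₀.trans_le (hAle t₀ ht₀ x₀)
  obtain ⟨δ, hδ, hkey⟩ := key ((S - m) / 2) (by linarith)
  set Λ' := max Λ 0
  have hΛ' : 0 ≤ Λ' := le_max_right _ _
  -- `η` keeps the maximum point above the level `(m + S) / 2`, and makes the gradient and the Lévy
  -- operator of the bump, of height `2 η` up to exponential weights, at most `δ`
  obtain ⟨η, hη, hη1, hη2⟩ : ∃ η > 0, η ≤ (S - m) / 2 ∧ 2 * η * K * (C + (2 + C) * Λ') ≤ δ := by
    have hD : 0 < 2 * K * (C + (2 + C) * Λ') + 1 := by positivity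
    refine ⟨min ((S - m) / 2) (δ / (2 * K * (C + (2 + C) * Λ') + 1)),
      lt_min (by linarith) (by positivity), min_le_left _ _, ?_⟩
    calc 2 * min ((S - m) / 2) (δ / (2 * K * (C + (2 + C) * Λ') + 1)) * K * (C + (2 + C) * Λ')
        = min ((S - m) / 2) (δ / (2 * K * (C + (2 + C) * Λ') + 1))
          * (2 * K * (C + (2 + C) * Λ')) := by ring
      _ ≤ δ / (2 * K * (C + (2 + C) * Λ') + 1) * (2 * K * (C + (2 + C) * Λ') + 1) := by
          gcongr
          · exact min_le_right _ _
          · linarith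
      _ = δ := by field_simp
  -- at `(t₁, x₁)` the supremum is missed by less than `η`; a bump of height `2 η` centred at `x₁`
  -- lifts this point above everything outside the ball of radius `2`, so a maximum is attained
  obtain ⟨_, ⟨⟨t₁, x₁⟩, ⟨ht₁, -⟩, rfl⟩, hlt⟩ := exists_lt_of_lt_csSup
    (⟨_, (t₀, x₀), ⟨ht₀, mem_univ _⟩, rfl⟩ : A.Nonempty) (show S - η < S by linarith)
  simp only at hlt ht₁
  set Ψ : ℝ × Rd d → ℝ := fun q => W q.1 q.2 + 2 * η * χ (q.2 - x₁) with hΨ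
  have hcomp : IsCompact (Icc 0 T ×ˢ closedBall x₁ 2 : Set (ℝ × Rd d)) :=
    isCompact_Icc.prod (isCompact_closedBall x₁ 2)
  have hΨc : ContinuousOn Ψ (Icc 0 T ×ˢ closedBall x₁ 2) := by
    have h1 : ContinuousOn (fun q : ℝ × Rd d => w q.1 q.2) (Icc 0 T ×ˢ closedBall x₁ 2) :=
      hc.mono (prod_mono_right (subset_univ _))
    have h3 := hχ.continuous
    refine ContinuousOn.add (ContinuousOn.mul (by fun_prop) h1) (by fun_prop)
  obtain ⟨⟨t, x⟩, ⟨ht, hx⟩, hmax⟩ := hcomp.exists_isMaxOn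
    ⟨(t₁, x₁), ht₁, mem_closedBall_self zero_le_two⟩ hΨc
  simp only at ht hx
  have hval : S + η < Ψ (t, x) := by
    have : Ψ (t₁, x₁) ≤ Ψ (t, x) := hmax ⟨ht₁, mem_closedBall_self zero_le_two⟩
    simp only [hΨ, sub_self, hχ0] at this ⊢
    linarith
  have hglob : ∀ s ∈ Icc 0 T, ∀ y, Ψ (s, y) ≤ Ψ (t, x) := by
    intro s hs y
    by_cases hy : y ∈ closedBall x₁ 2
    · exact hmax ⟨hs, hy⟩
    · have : χ (y - x₁) = 0 := hχ2 _ (by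
        rw [mem_closedBall, dist_eq_norm, not_le] at hy; exact hy.le)
      have h3 := hAle s hs y
      simp only [hΨ, this, mul_zero, add_zero] at hval ⊢
      linarith
  have hWt : S - η ≤ W t x := by
    have := (hχ1 (x - x₁)).2
    simp only [hΨ] at hval
    nlinarith
  have ht0 : 0 < t := by
    rcases ht.1.lt_or_eq with h3 | h3
    · exact h3
    · exfalso
      have h4 : W t x ≤ m := by simp [hW, ← h3, h0]
      have := (hχ1 (x - x₁)).2
      simp only [hΨ] at hval
      nlinarith
  have ht' : t ∈ Ioc 0 T := ⟨ht0, ht.2⟩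
  -- the function of `x` that attains its maximum at the point found
  set a : ℝ := Real.exp (l * t) * (2 * η) with ha
  have ha0 : 0 ≤ a := by positivity
  have haK : a ≤ K * (2 * η) := by rw [ha]; gcongr; exact (hexp t ht).2
  have hee : Real.exp (l * t) * Real.exp (-(l * t)) = 1 := by
    rw [← Real.exp_add, add_neg_cancel, Real.exp_zero]
  have hχx : ContDiff ℝ 2 (fun y => χ (y - x₁)) := hχ.comp (contDiff_id.sub contDiff_const)
  have hχd : ∀ y, HasFDerivAt (fun y => χ (y - x₁)) (fderiv ℝ χ (y - x₁)) y := fun y =>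
    (hasFDerivAt_comp_sub (f := χ) x₁).2 ((hχ.differentiable two_ne_zero) (y - x₁)).hasFDerivAt
  have hspace : ∀ y, w t y + a * χ (y - x₁) ≤ w t x + a * χ (x - x₁) := by
    intro y
    have h3 := mul_le_mul_of_nonneg_left (hglob t ht y) (Real.exp_pos (l * t)).le
    simp only [hΨ, hW, mul_add, ← mul_assoc, hee, one_mul] at h3
    simp only [ha]
    linarith
  have hwd := fun y => ((h2 t ht').differentiable two_ne_zero y).hasFDerivAt
  have hgrad : fderiv ℝ (w t) x = -(a • fderiv ℝ χ (x - x₁)) := by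
    have h3 : IsLocalMax (fun y => w t y + a * χ (y - x₁)) x := Eventually.of_forall hspace
    exact eq_neg_of_add_eq_zero_left
      (h3.hasFDerivAt_eq_zero ((hwd x).fun_add ((hχd x).const_mul a)))
  have hlevy : levyOp μ (w t) x ≤ a * ((2 + C) * Λ') := by
    have h3 := levyOp_nonpos_of_isMax (μ := μ) hspace
    rw [h.levyOp_add_smul (h2 t ht') hχx (hB t ht) (b' := 1) (fun y => by
      rw [abs_of_nonneg (hχ1 _).1]; exact (hχ1 _).2)] at h3
    have h4 := h.abs_levyOp_le (φ := fun y => χ (y - x₁)) (b₀ := 1) (b₂ := C) (fun y => by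
      rw [abs_of_nonneg (hχ1 _).1]; exact (hχ1 _).2) hχd hC
      (fun y z => by simpa using hχ4 (z - x₁) (y - x₁)) x
    have h5 := (abs_le.1 h4).1
    nlinarith
  have h3 := hkey t ht' x (by simp only [hW] at hWt; linarith) (by
      rw [hgrad, norm_neg, norm_smul, Real.norm_eq_abs, abs_of_nonneg ha0]
      calc a * ‖fderiv ℝ χ (x - x₁)‖ ≤ K * (2 * η) * C := by
            gcongr; exact hχ3 _
        _ ≤ 2 * η * K * (C + (2 + C) * Λ') := by
            have : 0 ≤ 2 * η * K * ((2 + C) * Λ') := by positivity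
            nlinarith
        _ ≤ δ := hη2) (by
      calc levyOp μ (w t) x ≤ a * ((2 + C) * Λ') := hlevy
        _ ≤ K * (2 * η) * ((2 + C) * Λ') := by gcongr
        _ ≤ 2 * η * K * (C + (2 + C) * Λ') := by
            have : 0 ≤ 2 * η * K * C := by positivity
            nlinarith
        _ ≤ δ := hη2)
  have hdt : HasDerivAt (fun s => Real.exp (-(l * s)) * w s x)
      (Real.exp (-(l * t)) * (deriv (fun s => w s x) t - l * w t x)) t := by
    have h4 : HasDerivAt (fun s => Real.exp (-(l * s))) (Real.exp (-(l * t)) * (-(l * 1))) t :=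
      (((hasDerivAt_id t).const_mul l).neg).exp
    exact (h4.fun_mul (hd t ht' x).hasDerivAt).congr_deriv (by ring)
  have h5 := hdt.nonneg_of_forall_le ht0 (fun s hs => by
    have := hglob s ⟨hs.1, hs.2.trans ht.2⟩ x
    simp only [hΨ, hW] at this
    linarith)
  have h6 : 0 ≤ deriv (fun s => w s x) t - l * w t x :=
    nonneg_of_mul_nonneg_right h5 (Real.exp_pos _)
  linarith

end MaximumPrinciple

/-! ### Convolution with a heat kernel -/

section HeatOperator

variable {E : Type*} [NormedAddCommGroup E] [NormedSpace ℝ E] [FiniteDimensional ℝ E]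
  [MeasureSpace E] [BorelSpace E] [(volume : Measure E).IsAddHaarMeasure]
variable {F : Type*} [NormedAddCommGroup F] [NormedSpace ℝ F] [CompleteSpace F]

theorem ContinuousOn.stronglyMeasurable_indicator' {X : Type*} [TopologicalSpace X]
    [SecondCountableTopology X] [MeasurableSpace X] [OpensMeasurableSpace X] {f : X → F}
    {s : Set X} (hf : ContinuousOn f s) (hs : MeasurableSet s) :
    StronglyMeasurable (s.indicator f) := by
  have h1 : StronglyMeasurable (s.domRestrict f) :=
    (continuousOn_iff_continuous_domRestrict.1 hf).stronglyMeasurable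
  have h2 := (MeasurableEmbedding.subtype_coe hs).stronglyMeasurable_extend h1
    (stronglyMeasurable_zero (α := X) (β := F))
  convert h2 using 1
  ext x
  by_cases hx : x ∈ s
  · rw [indicator_of_mem hx, show x = ((⟨x, hx⟩ : s) : X) from rfl,
      Subtype.val_injective.extend_apply]; rfl
  · rw [indicator_of_notMem hx, Function.extend_apply' _ _ _ (by simpa using hx)]; rfl

/-- The strip `(0,T) × E`. -/
def strip (E : Type*) (T : ℝ) : Set (ℝ × E) := Ioo 0 T ×ˢ univ

theorem measurableSet_strip (T : ℝ) : MeasurableSet (strip E T) :=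
  measurableSet_Ioo.prod MeasurableSet.univ

theorem isOpen_strip (T : ℝ) : IsOpen (strip E T) := isOpen_Ioo.prod isOpen_univ

theorem stronglyMeasurable_fderiv_strip [SecondCountableTopology F] {T : ℝ} {w : ℝ → E → F}
    (hw : ContinuousOn (fun q : ℝ × E => w q.1 q.2) (strip E T)) :
    StronglyMeasurable ((strip E T).indicator fun q : ℝ × E => fderiv ℝ (w q.1) q.2) := by
  have h0 : Continuous (Function.uncurry fun (t : Ioo (0 : ℝ) T) (x : E) => w t x) := by
    rw [continuousOn_iff_continuous_domRestrict] at hw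
    exact hw.comp (g := (strip E T).domRestrict fun q : ℝ × E => w q.1 q.2)
      (f := fun p : Ioo (0 : ℝ) T × E => ⟨((p.1 : ℝ), p.2), p.1.2, mem_univ _⟩) (by fun_prop)
  borelize (E →L[ℝ] F)
  have h1 := measurable_fderiv_with_param ℝ h0
  have h2 : Measurable fun q : strip E T => fderiv ℝ (w q.1.1) q.1.2 :=
    h1.comp (g := fun p : Ioo (0 : ℝ) T × E => fderiv ℝ (w p.1) p.2)
      (f := fun q : strip E T => (⟨q.1.1, q.2.1⟩, q.1.2))
      ((Measurable.subtype_mk (by fun_prop)).prodMk (by fun_prop))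
  have h3 := (MeasurableEmbedding.subtype_coe (measurableSet_strip (E := E) T)).measurable_extend h2
    (measurable_const (a := (0 : E →L[ℝ] F)))
  refine Measurable.stronglyMeasurable ?_
  convert h3 using 1
  ext1 q
  by_cases hx : q ∈ strip E T
  · rw [indicator_of_mem hx]
    exact (Subtype.val_injective.extend_apply
      (fun q : strip E T => fderiv ℝ (w q.1.1) q.1.2) _ ⟨q, hx⟩).symm
  · rw [indicator_of_notMem hx, Function.extend_apply' _ _ _ (by simpa using hx)]

/-- The properties of the heat kernel of an operator of order `1 / a` that the analysis of the
mild formulation rests on. For convenience the kernel vanishes for times outside `(0,T)`. -/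
structure IsHeatKernel (T a C : ℝ) (k : ℝ → E → ℝ) : Prop where
  continuousOn : ContinuousOn (fun q : ℝ × E => k q.1 q.2) (strip E T)
  zero : ∀ t ∉ Ioo 0 T, k t = 0
  nonneg : ∀ t x, 0 ≤ k t x
  integrable : ∀ t, Integrable (k t)
  integral_eq_one : ∀ t ∈ Ioo 0 T, ∫ x, k t x = 1
  contDiff : ∀ t, ContDiff ℝ 2 (k t)
  const_nonneg : 0 ≤ C
  lintegral_fderiv : ∀ t ∈ Ioo 0 T,
    ∫⁻ x, ‖fderiv ℝ (k t) x‖ₑ ≤ ENNReal.ofReal (C * t ^ (-a))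
  lintegral_fderiv_fderiv : ∀ t ∈ Ioo 0 T,
    ∫⁻ x, ‖fderiv ℝ (fderiv ℝ (k t)) x‖ₑ ≤ ENNReal.ofReal (C * t ^ (-(2 * a)))

/-- The heat semigroup `φ ↦ k(t) * φ`. -/
noncomputable def heatOp (k : ℝ → E → ℝ) (t : ℝ) (φ : E → F) (x : E) : F :=
  ∫ y, k t y • φ (x - y)

/-- The gradient of the heat semigroup, with the derivative falling on the kernel. -/
noncomputable def gradOp (k : ℝ → E → ℝ) (t : ℝ) (φ : E → F) (x : E) : E →L[ℝ] F :=
  ∫ y, (fderiv ℝ (k t) (x - y)).smulRight (φ y)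

theorem heatOp_eq (k : ℝ → E → ℝ) (t : ℝ) (φ : E → F) (x : E) :
    heatOp k t φ x = ∫ y, k t (x - y) • φ y := by
  rw [heatOp, ← integral_sub_left_eq_self _ volume x]
  simp

namespace IsHeatKernel

variable {T a C : ℝ} {k : ℝ → E → ℝ} (hk : IsHeatKernel T a C k)
include hk

theorem integral_le_one (t : ℝ) : ∫ x, k t x ≤ 1 := by
  by_cases ht : t ∈ Ioo 0 T
  · exact (hk.integral_eq_one t ht).le
  · simp [hk.zero t ht]

theorem stronglyMeasurable : StronglyMeasurable fun q : ℝ × E => k q.1 q.2 := by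
  have h := hk.continuousOn.stronglyMeasurable_indicator' (measurableSet_strip T)
  convert h using 1
  ext q
  by_cases hq : q ∈ strip E T
  · rw [indicator_of_mem hq]
  · rw [indicator_of_notMem hq, hk.zero q.1 fun h1 => hq ⟨h1, mem_univ _⟩]; rfl

theorem stronglyMeasurable_fderiv :
    StronglyMeasurable fun q : ℝ × E => fderiv ℝ (k q.1) q.2 := by
  have h := stronglyMeasurable_fderiv_strip hk.continuousOn
  convert h using 1
  ext1 q
  by_cases hq : q ∈ strip E T
  · rw [indicator_of_mem hq]
  · rw [indicator_of_notMem hq, hk.zero q.1 fun h1 => hq ⟨h1, mem_univ _⟩]; simp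

theorem integrable_smul (t x) {φ : E → F} (hφ : StronglyMeasurable φ) {b : ℝ}
    (hb : ∀ y, ‖φ y‖ ≤ b) : Integrable fun y => k t y • φ (x - y) := by
  refine ((hk.integrable t).mul_const b).mono' ((hk.integrable t).aestronglyMeasurable.smul
    (hφ.comp_measurable (by fun_prop)).aestronglyMeasurable) (ae_of_all _ fun y => ?_)
  rw [norm_smul, Real.norm_of_nonneg (hk.nonneg t y)]
  exact mul_le_mul_of_nonneg_left (hb _) (hk.nonneg t y)

theorem integrable_smul' (t x) {φ : E → F} (hφ : StronglyMeasurable φ) {b : ℝ}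
    (hb : ∀ y, ‖φ y‖ ≤ b) : Integrable fun y => k t (x - y) • φ y := by
  simpa using (hk.integrable_smul t x hφ hb).comp_sub_left x

theorem norm_heatOp_le (t x) {φ : E → F} {b : ℝ} (hb : ∀ y, ‖φ y‖ ≤ b) :
    ‖heatOp k t φ x‖ ≤ b := by
  have hb0 : 0 ≤ b := (norm_nonneg _).trans (hb 0)
  refine (norm_integral_le_of_norm_le ((hk.integrable t).mul_const b)
    (ae_of_all _ fun y => ?_)).trans ?_
  · rw [norm_smul, Real.norm_of_nonneg (hk.nonneg t y)]
    exact mul_le_mul_of_nonneg_left (hb _) (hk.nonneg t y)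
  · rw [integral_mul_const]
    exact mul_le_of_le_one_left hb0 (hk.integral_le_one t)

theorem heatOp_eq_zero {t : ℝ} (ht : t ∉ Ioo 0 T) (φ : E → F) (x : E) : heatOp k t φ x = 0 := by
  simp [heatOp, hk.zero t ht]

theorem hasFDerivAt_heatOp (t x) {φ : E → F} {φ' : E → E →L[ℝ] F} (hφ : StronglyMeasurable φ)
    (hφ' : StronglyMeasurable φ') {b b' : ℝ} (hb : ∀ y, ‖φ y‖ ≤ b) (hb' : ∀ y, ‖φ' y‖ ≤ b')
    (h : ∀ y, HasFDerivAt φ (φ' y) y) :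
    HasFDerivAt (heatOp k t φ) (heatOp k t φ' x) x := by
  refine hasFDerivAt_integral_of_dominated_of_fderiv_le (F := fun x y => k t y • φ (x - y))
    (F' := fun x y => k t y • φ' (x - y)) (bound := fun y => k t y * b') univ_mem
    (Eventually.of_forall fun x => (hk.integrable_smul t x hφ hb).aestronglyMeasurable)
    (hk.integrable_smul t x hφ hb) (hk.integrable_smul t x hφ' hb').aestronglyMeasurable
    (ae_of_all _ fun y z _ => ?_) ((hk.integrable t).mul_const b')
    (ae_of_all _ fun y z _ => ?_)
  · rw [norm_smul, Real.norm_of_nonneg (hk.nonneg t y)]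
    exact mul_le_mul_of_nonneg_left (hb' _) (hk.nonneg t y)
  · exact ((hasFDerivAt_comp_sub (f := φ) y).2 (h (z - y))).const_smul (k t y)

/-- Scheffé's lemma: the translated kernel is continuous into `L¹` on `(0,T) × E`. -/
theorem tendsto_integral_abs_sub {q₀ : ℝ × E} (h₀ : q₀ ∈ strip E T) :
    Tendsto (fun q : ℝ × E => ∫ y, |k q.1 (q.2 - y) - k q₀.1 (q₀.2 - y)|) (𝓝 q₀) (𝓝 0) := by
  have hi : ∀ q : ℝ × E, Integrable fun y => k q.1 (q.2 - y) := fun q =>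
    (hk.integrable q.1).comp_sub_left q.2
  -- only the part where the new kernel is smaller is dominated; the other part has the same
  -- integral, as the masses agree
  have h1 : Tendsto (fun q : ℝ × E => ∫ y, max (k q₀.1 (q₀.2 - y) - k q.1 (q.2 - y)) 0) (𝓝 q₀)
      (𝓝 (∫ _ : E, (0 : ℝ))) := by
    refine tendsto_integral_filter_of_dominated_convergence (fun y => k q₀.1 (q₀.2 - y))
      (Eventually.of_forall fun q => ((hi q₀).sub (hi q)).pos_part.aestronglyMeasurable)
      (Eventually.of_forall fun q => ae_of_all _ fun y => ?_) (hi q₀) (ae_of_all _ fun y => ?_)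
    · rw [Real.norm_of_nonneg (le_max_right _ _)]
      exact max_le (by linarith [hk.nonneg q.1 (q.2 - y)]) (hk.nonneg _ _)
    · have h2 : ContinuousAt (fun q : ℝ × E => k q.1 (q.2 - y)) q₀ :=
        ContinuousAt.comp (g := fun q : ℝ × E => k q.1 q.2) (f := fun q : ℝ × E => (q.1, q.2 - y))
          (hk.continuousOn.continuousAt ((isOpen_strip T).mem_nhds ⟨h₀.1, mem_univ _⟩))
          (by fun_prop)
      have h3 : ContinuousAt
          (fun q : ℝ × E => max (k q₀.1 (q₀.2 - y) - k q.1 (q.2 - y)) 0) q₀ :=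
        (continuousAt_const.sub h2).max continuousAt_const
      simpa [ContinuousAt] using h3
  rw [integral_zero] at h1
  have h2 := h1.const_mul 2
  rw [mul_zero] at h2
  refine h2.congr' ?_
  filter_upwards [(isOpen_strip T).mem_nhds h₀] with q hq
  have h3 : ∫ y, (k q.1 (q.2 - y) - k q₀.1 (q₀.2 - y)) = 0 := by
    rw [integral_sub (hi q) (hi q₀), integral_sub_left_eq_self, integral_sub_left_eq_self,
      hk.integral_eq_one _ hq.1, hk.integral_eq_one _ h₀.1, sub_self]
  have h4 : ∀ y, |k q.1 (q.2 - y) - k q₀.1 (q₀.2 - y)|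
      = 2 * max (k q₀.1 (q₀.2 - y) - k q.1 (q.2 - y)) 0
        + (k q.1 (q.2 - y) - k q₀.1 (q₀.2 - y)) := fun y => by
    rcases le_total (k q.1 (q.2 - y)) (k q₀.1 (q₀.2 - y)) with h | h
    · rw [abs_of_nonpos (by linarith), max_eq_left (by linarith)]; ring
    · rw [abs_of_nonneg (by linarith), max_eq_right (by linarith)]; ring
  simp only [h4]
  have hm : Integrable fun y => 2 * max (k q₀.1 (q₀.2 - y) - k q.1 (q.2 - y)) 0 :=
    ((hi q₀).sub (hi q)).pos_part.const_mul 2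
  have hs : Integrable fun y => k q.1 (q.2 - y) - k q₀.1 (q₀.2 - y) := (hi q).sub (hi q₀)
  rw [integral_add hm hs, h3, add_zero, integral_const_mul]

theorem continuousOn_heatOp {φ : E → F} (hφ : StronglyMeasurable φ) {b : ℝ}
    (hb : ∀ y, ‖φ y‖ ≤ b) :
    ContinuousOn (fun q : ℝ × E => heatOp k q.1 φ q.2) (strip E T) := by
  refine fun q₀ h₀ => ContinuousAt.continuousWithinAt ?_
  have h1 := (hk.tendsto_integral_abs_sub h₀).mul_const b
  rw [zero_mul] at h1
  refine tendsto_iff_norm_sub_tendsto_zero.2 (squeeze_zero (fun _ => norm_nonneg _)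
    (fun q => ?_) h1)
  have hi : ∀ q : ℝ × E, Integrable fun y => k q.1 (q.2 - y) := fun q =>
    (hk.integrable q.1).comp_sub_left q.2
  simp only [heatOp_eq]
  rw [← integral_sub (hk.integrable_smul' _ _ hφ hb)
    (hk.integrable_smul' _ _ hφ hb), ← integral_mul_const]
  refine norm_integral_le_of_norm_le (((hi q).sub (hi q₀)).abs.mul_const b)
    (ae_of_all _ fun y => ?_)
  rw [← sub_smul, norm_smul]
  exact mul_le_mul_of_nonneg_left (hb y) (abs_nonneg _)

end IsHeatKernel

/-- The `L¹` modulus of continuity of a function with integrable derivative. -/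
theorem lintegral_translate_sub_le {G : E → F} (hG : ContDiff ℝ 1 G) (h : E) :
    ∫⁻ y, ‖G (y + h) - G y‖ₑ ≤ ‖h‖ₑ * ∫⁻ y, ‖fderiv ℝ G y‖ₑ := by
  have hc : Continuous (fderiv ℝ G) := hG.continuous_fderiv one_ne_zero
  have h1 : ∀ y, ‖G (y + h) - G y‖ₑ
      ≤ ∫⁻ θ in Ioc (0 : ℝ) 1, ‖fderiv ℝ G (y + θ • h)‖ₑ * ‖h‖ₑ := fun y => by
    have h2 : ∫ θ in (0 : ℝ)..1, fderiv ℝ G (y + θ • h) h = G (y + h) - G y := by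
      have h3 : ∀ θ : ℝ, HasDerivAt (fun θ : ℝ => G (y + θ • h)) (fderiv ℝ G (y + θ • h) h) θ :=
        fun θ => ((hG.differentiable one_ne_zero) _).hasFDerivAt.comp_hasDerivAt θ
          (by simpa using ((hasDerivAt_id θ).smul_const h).const_add y)
      rw [intervalIntegral.integral_eq_sub_of_hasDerivAt (fun θ _ => h3 θ)
        (Continuous.intervalIntegrable (by fun_prop) _ _)]
      simp
    rw [← h2, intervalIntegral.integral_of_le zero_le_one]
    refine (enorm_integral_le_lintegral_enorm _).trans (lintegral_mono fun θ => ?_)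
    exact ContinuousLinearMap.le_opENorm _ _
  calc ∫⁻ y, ‖G (y + h) - G y‖ₑ
      ≤ ∫⁻ y, ∫⁻ θ in Ioc (0 : ℝ) 1, ‖fderiv ℝ G (y + θ • h)‖ₑ * ‖h‖ₑ := lintegral_mono h1
    _ = ∫⁻ θ in Ioc (0 : ℝ) 1, ∫⁻ y, ‖fderiv ℝ G (y + θ • h)‖ₑ * ‖h‖ₑ := by
        rw [lintegral_lintegral_swap]
        refine Measurable.aemeasurable (Continuous.measurable ?_)
        refine (ENNReal.continuous_mul_const enorm_ne_top).comp (continuous_enorm.comp ?_)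
        exact hc.comp (by fun_prop)
    _ = ∫⁻ θ in Ioc (0 : ℝ) 1, ‖h‖ₑ * ∫⁻ y, ‖fderiv ℝ G y‖ₑ := by
        refine lintegral_congr fun θ => ?_
        rw [lintegral_mul_const' _ _ enorm_ne_top, mul_comm,
          lintegral_add_right_eq_self (fun y => ‖fderiv ℝ G y‖ₑ)]
    _ = ‖h‖ₑ * ∫⁻ y, ‖fderiv ℝ G y‖ₑ := by simp

/-- The remainder of the first-order Taylor expansion in `L¹`; as the bound is of second order in
`h`, convolution with a bounded function gives a differentiable function. -/
theorem lintegral_taylor_le {G : E → F} (hG : ContDiff ℝ 2 G) (h : E) :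
    ∫⁻ y, ‖G (y + h) - G y - fderiv ℝ G y h‖ₑ
      ≤ ‖h‖ₑ * ‖h‖ₑ * ∫⁻ y, ‖fderiv ℝ (fderiv ℝ G) y‖ₑ := by
  have hG1 : ContDiff ℝ 1 (fderiv ℝ G) := hG.fderiv_right (by norm_num)
  have hc : Continuous (fderiv ℝ G) := hG1.continuous
  have h1 : ∀ y, ‖G (y + h) - G y - fderiv ℝ G y h‖ₑ
      ≤ ∫⁻ θ in Ioc (0 : ℝ) 1, ‖fderiv ℝ G (y + θ • h) - fderiv ℝ G y‖ₑ * ‖h‖ₑ := fun y => by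
    have h2 : ∫ θ in (0 : ℝ)..1, (fderiv ℝ G (y + θ • h) - fderiv ℝ G y) h
        = G (y + h) - G y - fderiv ℝ G y h := by
      have h3 : ∀ θ : ℝ, HasDerivAt (fun θ : ℝ => G (y + θ • h) - θ • fderiv ℝ G y h)
          ((fderiv ℝ G (y + θ • h) - fderiv ℝ G y) h) θ := fun θ => by
        have h4 := ((hG.differentiable two_ne_zero) _).hasFDerivAt.comp_hasDerivAt θ
          (by simpa using ((hasDerivAt_id θ).smul_const h).const_add y :
            HasDerivAt (fun θ : ℝ => y + θ • h) h θ)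
        have h5 := (hasDerivAt_id θ).smul_const (fderiv ℝ G y h)
        simpa [Function.comp_def] using h4.fun_sub h5
      rw [intervalIntegral.integral_eq_sub_of_hasDerivAt (fun θ _ => h3 θ)
        (Continuous.intervalIntegrable (by fun_prop) _ _)]
      simp
      abel
    rw [← h2, intervalIntegral.integral_of_le zero_le_one]
    refine (enorm_integral_le_lintegral_enorm _).trans (lintegral_mono fun θ => ?_)
    exact ContinuousLinearMap.le_opENorm _ _
  calc ∫⁻ y, ‖G (y + h) - G y - fderiv ℝ G y h‖ₑ
      ≤ ∫⁻ y, ∫⁻ θ in Ioc (0 : ℝ) 1, ‖fderiv ℝ G (y + θ • h) - fderiv ℝ G y‖ₑ * ‖h‖ₑ :=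
        lintegral_mono h1
    _ = ∫⁻ θ in Ioc (0 : ℝ) 1, ∫⁻ y, ‖fderiv ℝ G (y + θ • h) - fderiv ℝ G y‖ₑ * ‖h‖ₑ := by
        rw [lintegral_lintegral_swap]
        refine Measurable.aemeasurable (Continuous.measurable ?_)
        refine (ENNReal.continuous_mul_const enorm_ne_top).comp (continuous_enorm.comp ?_)
        exact (hc.comp (by fun_prop)).sub (hc.comp (by fun_prop))
    _ ≤ ∫⁻ _ in Ioc (0 : ℝ) 1, ‖h‖ₑ * (∫⁻ y, ‖fderiv ℝ (fderiv ℝ G) y‖ₑ) * ‖h‖ₑ := by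
        refine setLIntegral_mono' measurableSet_Ioc fun θ hθ => ?_
        rw [lintegral_mul_const' _ _ enorm_ne_top]
        gcongr
        refine (lintegral_translate_sub_le hG1 (θ • h)).trans ?_
        gcongr
        rw [enorm_smul]
        refine mul_le_of_le_one_left zero_le ?_
        rw [Real.enorm_of_nonneg hθ.1.le]
        exact ENNReal.ofReal_le_one.2 hθ.2
    _ = ‖h‖ₑ * ‖h‖ₑ * ∫⁻ y, ‖fderiv ℝ (fderiv ℝ G) y‖ₑ := by simp; ring

end HeatOperator

/-! ### The gradient of the heat operator -/

section HeatGradient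

variable {E : Type*} [NormedAddCommGroup E] [NormedSpace ℝ E] [FiniteDimensional ℝ E]
  [MeasureSpace E] [BorelSpace E] [(volume : Measure E).IsAddHaarMeasure]
variable {F : Type*} [NormedAddCommGroup F] [NormedSpace ℝ F] [CompleteSpace F]

theorem norm_integral_le_of_lintegral_le {X : Type*} [MeasurableSpace X] {m : Measure X}
    {f : X → F} {c : ℝ} (hc : 0 ≤ c) (h : ∫⁻ x, ‖f x‖ₑ ∂m ≤ ENNReal.ofReal c) :
    ‖∫ x, f x ∂m‖ ≤ c := by
  have h1 := (enorm_integral_le_lintegral_enorm f).trans h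
  rw [← ofReal_norm] at h1
  exact (ENNReal.ofReal_le_ofReal_iff hc).1 h1

namespace IsHeatKernel

variable {T a C : ℝ} {k : ℝ → E → ℝ} (hk : IsHeatKernel T a C k)
include hk

theorem aestronglyMeasurable_smulRight (t x) {φ : E → F} (hφ : StronglyMeasurable φ) :
    AEStronglyMeasurable fun y => (fderiv ℝ (k t) (x - y)).smulRight (φ y) := by
  have h1 : Continuous (fderiv ℝ (k t)) := (hk.contDiff t).continuous_fderiv two_ne_zero
  have h2 : StronglyMeasurable fun y => fderiv ℝ (k t) (x - y) :=
    (h1.comp (continuous_const.sub continuous_id)).stronglyMeasurable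
  have h3 : Continuous fun p : (E →L[ℝ] ℝ) × F => p.1.smulRight p.2 :=
    (ContinuousLinearMap.smulRightL ℝ E F).continuous₂
  exact (h3.comp_stronglyMeasurable (h2.prodMk hφ)).aestronglyMeasurable

theorem lintegral_smulRight_le {t : ℝ} (ht : t ∈ Ioo 0 T) (x) {φ : E → F} {b : ℝ}
    (hb : ∀ y, ‖φ y‖ ≤ b) :
    ∫⁻ y, ‖(fderiv ℝ (k t) (x - y)).smulRight (φ y)‖ₑ
      ≤ ENNReal.ofReal (C * t ^ (-a) * b) := by
  have hb0 : 0 ≤ b := (norm_nonneg _).trans (hb 0)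
  have hC := hk.const_nonneg
  have ht0 := ht.1.le
  calc ∫⁻ y, ‖(fderiv ℝ (k t) (x - y)).smulRight (φ y)‖ₑ
      ≤ ∫⁻ y, ‖fderiv ℝ (k t) (x - y)‖ₑ * ENNReal.ofReal b := by
        refine lintegral_mono fun y => ?_
        rw [← ofReal_norm, ← ofReal_norm,
          ContinuousLinearMap.norm_smulRight_apply, ENNReal.ofReal_mul (norm_nonneg _)]
        gcongr
        exact hb y
    _ = (∫⁻ y, ‖fderiv ℝ (k t) y‖ₑ) * ENNReal.ofReal b := by
        rw [lintegral_mul_const' _ _ ENNReal.ofReal_ne_top,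
          lintegral_sub_left_eq_self (fun y => ‖fderiv ℝ (k t) y‖ₑ)]
    _ ≤ _ := by
        rw [ENNReal.ofReal_mul (by positivity)]
        gcongr
        exact hk.lintegral_fderiv t ht

theorem integrable_smulRight (t x) {φ : E → F} (hφ : StronglyMeasurable φ) {b : ℝ}
    (hb : ∀ y, ‖φ y‖ ≤ b) :
    Integrable fun y => (fderiv ℝ (k t) (x - y)).smulRight (φ y) := by
  by_cases ht : t ∈ Ioo 0 T
  · exact ⟨hk.aestronglyMeasurable_smulRight t x hφ,
      (hk.lintegral_smulRight_le ht x hb).trans_lt ENNReal.ofReal_lt_top⟩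
  · have : (fun y => (fderiv ℝ (k t) (x - y)).smulRight (φ y)) = fun _ => 0 := by
      ext y v; simp [hk.zero t ht]
    rw [this]
    exact integrable_zero E (E →L[ℝ] F) volume

theorem gradOp_eq_zero {t : ℝ} (ht : t ∉ Ioo 0 T) (φ : E → F) (x : E) : gradOp k t φ x = 0 := by
  have : (fun y => (fderiv ℝ (k t) (x - y)).smulRight (φ y)) = fun _ => 0 := by
    ext y v; simp [hk.zero t ht]
  rw [gradOp, this, integral_zero]

theorem norm_gradOp_le {t : ℝ} (ht : t ∈ Ioo 0 T) (x) {φ : E → F} {b : ℝ}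
    (hb : ∀ y, ‖φ y‖ ≤ b) : ‖gradOp k t φ x‖ ≤ C * t ^ (-a) * b := by
  have hb0 : 0 ≤ b := (norm_nonneg _).trans (hb 0)
  have hC := hk.const_nonneg
  have ht0 := ht.1.le
  exact norm_integral_le_of_lintegral_le (by positivity) (hk.lintegral_smulRight_le ht x hb)

/-- The gradient of `P_t φ` is Lipschitz, with the constant given by the `L¹` norm of the second
derivative of the kernel. The factor `t ^ (-(2 * a))` need not be integrable in time. -/
theorem norm_gradOp_sub_le {t : ℝ} (ht : t ∈ Ioo 0 T) (x x' : E) {φ : E → F}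
    (hφ : StronglyMeasurable φ) {b : ℝ} (hb : ∀ y, ‖φ y‖ ≤ b) :
    ‖gradOp k t φ x - gradOp k t φ x'‖ ≤ C * t ^ (-(2 * a)) * ‖x - x'‖ * b := by
  have hb0 : 0 ≤ b := (norm_nonneg _).trans (hb 0)
  have hC := hk.const_nonneg
  have ht0 := ht.1.le
  rw [gradOp, gradOp, ← integral_sub (hk.integrable_smulRight t x hφ hb)
    (hk.integrable_smulRight t x' hφ hb)]
  refine norm_integral_le_of_lintegral_le (by positivity) ?_
  calc ∫⁻ y, ‖(fderiv ℝ (k t) (x - y)).smulRight (φ y)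
          - (fderiv ℝ (k t) (x' - y)).smulRight (φ y)‖ₑ
      ≤ ∫⁻ y, ‖fderiv ℝ (k t) (x - y) - fderiv ℝ (k t) (x' - y)‖ₑ * ENNReal.ofReal b := by
        refine lintegral_mono fun y => ?_
        have : (fderiv ℝ (k t) (x - y)).smulRight (φ y)
          - (fderiv ℝ (k t) (x' - y)).smulRight (φ y)
            = (fderiv ℝ (k t) (x - y) - fderiv ℝ (k t) (x' - y)).smulRight (φ y) := by
          ext v; simp [sub_smul]
        rw [this, ← ofReal_norm, ← ofReal_norm,
          ContinuousLinearMap.norm_smulRight_apply, ENNReal.ofReal_mul (norm_nonneg _)]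
        gcongr
        exact hb y
    _ = (∫⁻ y, ‖fderiv ℝ (k t) (y + (x - x')) - fderiv ℝ (k t) y‖ₑ) * ENNReal.ofReal b := by
        rw [lintegral_mul_const' _ _ ENNReal.ofReal_ne_top,
          ← lintegral_sub_left_eq_self
            (fun y => ‖fderiv ℝ (k t) (y + (x - x')) - fderiv ℝ (k t) y‖ₑ) x']
        congr 2
        ext y
        rw [show x' - y + (x - x') = x - y by abel]
    _ ≤ _ := by
        rw [ENNReal.ofReal_mul (by positivity), ENNReal.ofReal_mul (by positivity)]
        gcongr
        refine (lintegral_translate_sub_le ((hk.contDiff t).fderiv_right (by norm_num)) _).trans ?_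
        rw [mul_comm, ofReal_norm]
        gcongr
        exact hk.lintegral_fderiv_fderiv t ht

/-- The heat operator regularizes bounded measurable functions: the derivative can be put on
the kernel. -/
theorem hasFDerivAt_heatOp_gradOp (t x) {φ : E → F} (hφ : StronglyMeasurable φ) {b : ℝ}
    (hb : ∀ y, ‖φ y‖ ≤ b) : HasFDerivAt (heatOp k t φ) (gradOp k t φ x) x := by
  by_cases ht : t ∈ Ioo 0 T
  swap
  · rw [hk.gradOp_eq_zero ht]
    have : heatOp k t φ = fun _ => 0 := by ext y; exact hk.heatOp_eq_zero ht φ y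
    rw [this]; exact hasFDerivAt_const _ _
  have hb0 : 0 ≤ b := (norm_nonneg _).trans (hb 0)
  have hC := hk.const_nonneg
  have ht0 := ht.1.le
  have key : ∀ h : E, ‖heatOp k t φ (x + h) - heatOp k t φ x - gradOp k t φ x h‖
      ≤ C * t ^ (-(2 * a)) * b * ‖h‖ ^ 2 := fun h => by
    have i1 := hk.integrable_smul' t (x + h) hφ hb
    have i2 := hk.integrable_smul' t x hφ hb
    have i3 := (hk.integrable_smulRight t x hφ hb)
    have i4 : Integrable fun y => k t (x + h - y) • φ y - k t (x - y) • φ y := i1.sub i2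
    rw [heatOp_eq, heatOp_eq, gradOp, ContinuousLinearMap.integral_apply i3,
      ← integral_sub i1 i2, ← integral_sub i4 (i3.apply_continuousLinearMap h)]
    refine norm_integral_le_of_lintegral_le (by positivity) ?_
    calc ∫⁻ y, ‖k t (x + h - y) • φ y - k t (x - y) • φ y
            - (fderiv ℝ (k t) (x - y)).smulRight (φ y) h‖ₑ
        ≤ ∫⁻ y, ‖k t (x - y + h) - k t (x - y) - fderiv ℝ (k t) (x - y) h‖ₑ
            * ENNReal.ofReal b := by
          refine lintegral_mono fun y => ?_
          rw [ContinuousLinearMap.smulRight_apply, ← sub_smul, ← sub_smul, enorm_smul,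
            show x + h - y = x - y + h by abel]
          gcongr
          rw [← ofReal_norm]
          exact ENNReal.ofReal_le_ofReal (hb y)
      _ = (∫⁻ y, ‖k t (y + h) - k t y - fderiv ℝ (k t) y h‖ₑ) * ENNReal.ofReal b := by
          rw [lintegral_mul_const' _ _ ENNReal.ofReal_ne_top,
            lintegral_sub_left_eq_self (fun y => ‖k t (y + h) - k t y - fderiv ℝ (k t) y h‖ₑ)]
      _ ≤ (‖h‖ₑ * ‖h‖ₑ * ENNReal.ofReal (C * t ^ (-(2 * a)))) * ENNReal.ofReal b := by
          gcongr
          refine (lintegral_taylor_le (hk.contDiff t) h).trans ?_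
          gcongr
          exact hk.lintegral_fderiv_fderiv t ht
      _ = _ := by
          rw [← ofReal_norm, ← ENNReal.ofReal_mul (norm_nonneg _),
            ← ENNReal.ofReal_mul (by positivity), ← ENNReal.ofReal_mul (by positivity)]
          congr 1
          ring
  rw [hasFDerivAt_iff_isLittleO_nhds_zero]
  refine Asymptotics.IsBigO.trans_isLittleO (g := fun h : E => ‖h‖ ^ 2) ?_ ?_
  · refine Asymptotics.IsBigO.of_bound (C * t ^ (-(2 * a)) * b) (Eventually.of_forall fun h => ?_)
    rw [Real.norm_of_nonneg (by positivity : 0 ≤ ‖h‖ ^ 2)]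
    exact key h
  · simpa using (Asymptotics.isLittleO_norm_pow_id (E' := E) one_lt_two)

/-- Interpolation between the two bounds on the gradient: it is Hölder continuous, with a
time singularity that is still integrable for a small exponent. -/
theorem norm_gradOp_sub_le_rpow {t : ℝ} (ht : t ∈ Ioo 0 T) (x x' : E) {φ : E → F}
    (hφ : StronglyMeasurable φ) {b : ℝ} (hb : ∀ y, ‖φ y‖ ≤ b) {α : ℝ} (hα : α ∈ Icc (0 : ℝ) 1) :
    ‖gradOp k t φ x - gradOp k t φ x'‖ ≤ 2 * C * b * t ^ (-(a * (1 + α))) * ‖x - x'‖ ^ α := by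
  have hb0 : 0 ≤ b := (norm_nonneg _).trans (hb 0)
  have hC := hk.const_nonneg
  have ht0 := ht.1.le
  set N := ‖gradOp k t φ x - gradOp k t φ x'‖ with hN
  have h1 : N ≤ 2 * C * b * t ^ (-a) := by
    refine (norm_sub_le _ _).trans ?_
    linarith [hk.norm_gradOp_le ht x hb, hk.norm_gradOp_le ht x' hb]
  have h2 : N ≤ 2 * C * b * (t ^ (-(2 * a)) * ‖x - x'‖) := by
    refine (hk.norm_gradOp_sub_le ht x x' hφ hb).trans ?_
    have : 0 ≤ C * b * (t ^ (-(2 * a)) * ‖x - x'‖) := by positivity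
    linarith
  have hD : 0 ≤ 2 * C * b := by positivity
  rcases hD.eq_or_lt with hD0 | hD0
  · rw [← hD0] at h1 ⊢; simpa using h1
  · have h3 : N / (2 * C * b) ≤ t ^ (-a) := by rw [div_le_iff₀ hD0]; linarith
    have h4 : N / (2 * C * b) ≤ t ^ (-(2 * a)) * ‖x - x'‖ := by rw [div_le_iff₀ hD0]; linarith
    have hn : 0 ≤ N / (2 * C * b) := by positivity
    have h5 : N / (2 * C * b) ≤ t ^ (-(a * (1 + α))) * ‖x - x'‖ ^ α := by
      calc N / (2 * C * b) = (N / (2 * C * b)) ^ (1 - α) * (N / (2 * C * b)) ^ α := by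
            rw [← Real.rpow_add' hn (by norm_num)]; norm_num
        _ ≤ (t ^ (-a)) ^ (1 - α) * (t ^ (-(2 * a)) * ‖x - x'‖) ^ α := by
            have := hα.1
            have := hα.2
            gcongr
        _ = t ^ (-(a * (1 + α))) * ‖x - x'‖ ^ α := by
            rw [Real.mul_rpow (by positivity) (norm_nonneg _), ← Real.rpow_mul ht0,
              ← Real.rpow_mul ht0, ← mul_assoc, ← Real.rpow_add ht.1]
            ring_nf
    rw [div_le_iff₀ hD0] at h5
    linarith

end IsHeatKernel

/-- If `w` is jointly continuous and its space derivative is Hölder continuous in space,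
uniformly in time, then the space derivative is jointly continuous. -/
theorem continuousOn_strip_of_holder {T K α : ℝ} (hα : 0 < α) {w : ℝ → E → F}
    {w' : ℝ → E → E →L[ℝ] F} (hw : ContinuousOn (fun q : ℝ × E => w q.1 q.2) (strip E T))
    (hd : ∀ t ∈ Ioo 0 T, ∀ x, HasFDerivAt (w t) (w' t x) x)
    (hK : ∀ t ∈ Ioo 0 T, ∀ x y, ‖w' t x - w' t y‖ ≤ K * ‖x - y‖ ^ α) :
    ContinuousOn (fun q : ℝ × E => w' q.1 q.2) (strip E T) := by
  by_cases hE : Nontrivial E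
  swap
  · rw [not_nontrivial_iff_subsingleton] at hE
    exact (continuous_const (y := (0 : E →L[ℝ] F))).continuousOn.congr fun q _ => by
      ext v; rw [Subsingleton.elim v 0]; simp
  rw [continuousOn_clm_apply]
  intro v
  have hK0 : ∀ t ∈ Ioo 0 T, 0 ≤ K := fun t ht => by
    obtain ⟨x, hx⟩ := exists_ne (0 : E)
    have h1 := (norm_nonneg _).trans (hK t ht x 0)
    rw [sub_zero] at h1
    exact nonneg_of_mul_nonneg_left h1 (by have := norm_pos_iff.2 hx; positivity)
  have hlim : Tendsto (fun n : ℕ => K * ‖(1 / ((n : ℝ) + 1)) • v‖ ^ α * ‖v‖) atTop (𝓝 0) := by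
    have h1 : Tendsto (fun n : ℕ => ‖(1 / ((n : ℝ) + 1)) • v‖) atTop (𝓝 0) := by
      have := (tendsto_one_div_add_atTop_nhds_zero_nat (𝕜 := ℝ)).smul_const v
      simpa using this.norm
    have h2 := h1.rpow_const (p := α) (Or.inr hα.le)
    rw [Real.zero_rpow hα.ne'] at h2
    simpa using (h2.const_mul K).mul_const ‖v‖
  have hunif : TendstoUniformlyOn
      (fun (n : ℕ) (q : ℝ × E) =>
        ((n : ℝ) + 1) • (w q.1 (q.2 + (1 / ((n : ℝ) + 1)) • v) - w q.1 q.2))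
      (fun q => w' q.1 q.2 v) atTop (strip E T) := by
    rw [Metric.tendstoUniformlyOn_iff]
    intro ε hε
    filter_upwards [hlim.eventually_lt_const hε] with n hn q hq
    refine lt_of_le_of_lt ?_ hn
    set h : E := (1 / ((n : ℝ) + 1)) • v with hh
    have hn0 : (0 : ℝ) < (n : ℝ) + 1 := by positivity
    have h1 := (convex_closedBall q.2 ‖h‖).norm_image_sub_le_of_norm_hasFDerivWithin_le'
      (f := w q.1) (f' := w' q.1) (φ := w' q.1 q.2) (C := K * ‖h‖ ^ α) (x := q.2) (y := q.2 + h)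
      (fun y _ => (hd q.1 hq.1 y).hasFDerivWithinAt)
      (fun y hy => (hK q.1 hq.1 y q.2).trans (by
        have := hK0 q.1 hq.1
        rw [mem_closedBall, dist_eq_norm] at hy
        gcongr)) (by simp) (by simp)
    rw [add_sub_cancel_left] at h1
    have hv : v = ((n : ℝ) + 1) • h := by rw [hh, smul_smul]; field_simp; simp
    have h2 : ‖v‖ = ((n : ℝ) + 1) * ‖h‖ := by
      conv_lhs => rw [hv]
      rw [norm_smul, Real.norm_of_nonneg hn0.le]
    rw [dist_comm, dist_eq_norm]
    conv_lhs => rw [hv]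
    rw [map_smul, ← smul_sub, norm_smul, Real.norm_of_nonneg hn0.le, h2]
    calc ((n : ℝ) + 1) * ‖w q.1 (q.2 + h) - w q.1 q.2 - w' q.1 q.2 h‖
        ≤ ((n : ℝ) + 1) * (K * ‖h‖ ^ α * ‖h‖) := by gcongr
      _ = _ := by ring
  refine hunif.continuousOn (Frequently.of_forall fun n => ?_)
  refine ContinuousOn.const_smul (ContinuousOn.sub ?_ hw) _
  exact hw.comp (f := fun q : ℝ × E => (q.1, q.2 + (1 / ((n : ℝ) + 1)) • v))
    (by fun_prop) (fun q hq => ⟨hq.1, mem_univ _⟩)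

end HeatGradient

/-! ### The Duhamel operator -/

section Duhamel

variable {E : Type*} [NormedAddCommGroup E] [NormedSpace ℝ E] [FiniteDimensional ℝ E]
  [MeasureSpace E] [BorelSpace E] [(volume : Measure E).IsAddHaarMeasure]
variable {F : Type*} [NormedAddCommGroup F] [NormedSpace ℝ F] [CompleteSpace F]

/-- A bounded measurable source, extended by zero to times outside `(0,T)`. -/
structure IsSource (T b : ℝ) (g : ℝ → E → F) : Prop where
  stronglyMeasurable : StronglyMeasurable fun q : ℝ × E => g q.1 q.2
  zero : ∀ s ∉ Ioo 0 T, g s = 0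
  bound : ∀ s x, ‖g s x‖ ≤ b

/-- The Duhamel integral `∫₀ᵗ k(t - s) * g(s) ds`. The range of `s` is all of `ℝ`: the kernel
vanishes for `t ≤ s` and the source for `s ≤ 0`. -/
noncomputable def duhamel (k : ℝ → E → ℝ) (g : ℝ → E → F) (t : ℝ) (x : E) : F :=
  ∫ s, heatOp k (t - s) (g s) x

/-- The gradient of the Duhamel integral, with the derivative falling on the kernel. -/
noncomputable def gradDuhamel (k : ℝ → E → ℝ) (g : ℝ → E → F) (t : ℝ) (x : E) : E →L[ℝ] F :=
  ∫ s, gradOp k (t - s) (g s) x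

/-- The mass of `(1 + C r ^ (-a)) exp (-λ r)` on `(0,T)`, which controls the Duhamel integral and
its gradient in the norms weighted by `exp (-λ t)`. -/
noncomputable def weightMass (T a C l : ℝ) : ℝ :=
  ∫ r, (Ioo 0 T).indicator (fun r => (1 + C * r ^ (-a)) * Real.exp (-(l * r))) r

theorem integrableOn_Ioo_rpow {T a : ℝ} (ha : a < 1) :
    IntegrableOn (fun r : ℝ => r ^ (-a)) (Ioo 0 T) := by
  rcases le_total T 0 with hT | hT
  · rw [Ioo_eq_empty (not_lt.2 hT)]; exact integrableOn_empty
  · exact (intervalIntegrable_iff_integrableOn_Ioo_of_le hT).1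
      (intervalIntegral.intervalIntegrable_rpow' (by linarith))

theorem integrable_weight {T a C l : ℝ} (ha : a < 1) (hl : 0 ≤ l) :
    Integrable ((Ioo 0 T).indicator fun r => (1 + C * r ^ (-a)) * Real.exp (-(l * r))) := by
  refine (integrable_indicator_iff measurableSet_Ioo).2 ?_
  have h1 : IntegrableOn (fun r : ℝ => 1 + C * r ^ (-a)) (Ioo 0 T) :=
    (integrableOn_const (by simp)).add ((integrableOn_Ioo_rpow ha).const_mul C)
  refine Integrable.mono h1 (Measurable.aestronglyMeasurable (by fun_prop))
    ((ae_restrict_iff' measurableSet_Ioo).2 (ae_of_all _ fun r hr => ?_))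
  rw [norm_mul, Real.norm_of_nonneg (Real.exp_pos _).le]
  refine mul_le_of_le_one_right (norm_nonneg _) (Real.exp_le_one_iff.2 ?_)
  have := mul_nonneg hl hr.1.le
  linarith

/-- A large weight `l` makes the Duhamel operator and its gradient small, whatever the length of
the time interval. This replaces a subdivision into short intervals. -/
theorem exists_weightMass_le {T a C : ℝ} (ha : a < 1) {δ : ℝ} (hδ : 0 < δ) :
    ∃ l, 0 ≤ l ∧ weightMass T a C l ≤ δ := by
  have h : Tendsto (weightMass T a C) atTop (𝓝 (∫ _ : ℝ, (0 : ℝ))) := by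
    refine tendsto_integral_filter_of_dominated_convergence
      (fun r => ‖(Ioo 0 T).indicator (fun r => (1 + C * r ^ (-a)) * Real.exp (-(0 * r))) r‖)
      ?_ ?_ (integrable_weight ha le_rfl).norm (ae_of_all _ fun r => ?_)
    · filter_upwards [eventually_ge_atTop 0] with l hl
      exact (integrable_weight ha hl).aestronglyMeasurable
    · filter_upwards [eventually_ge_atTop 0] with l hl
      refine ae_of_all _ fun r => ?_
      by_cases hr : r ∈ Ioo 0 T
      · simp only [indicator_of_mem hr, norm_mul]
        gcongr
        rw [Real.norm_of_nonneg (Real.exp_pos _).le, Real.norm_of_nonneg (Real.exp_pos _).le]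
        have := hr.1.le
        gcongr
      · simp [indicator_of_notMem hr]
    · by_cases hr : r ∈ Ioo 0 T
      · simp only [indicator_of_mem hr]
        rw [show (0 : ℝ) = (1 + C * r ^ (-a)) * 0 by ring]
        refine Tendsto.const_mul _ (Real.tendsto_exp_atBot.comp ?_)
        exact tendsto_neg_atTop_atBot.comp (tendsto_id.atTop_mul_const hr.1)
      · simp only [indicator_of_notMem hr]
        exact tendsto_const_nhds
  rw [integral_zero] at h
  obtain ⟨l, hl, hl0⟩ := ((h.eventually_lt_const hδ).and (eventually_ge_atTop 0)).exists
  exact ⟨l, hl0, hl.le⟩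

namespace IsHeatKernel

variable {T a C : ℝ} {k : ℝ → E → ℝ} (hk : IsHeatKernel T a C k)
include hk

theorem stronglyMeasurable_heatOp {g : ℝ → E → F}
    (hg : StronglyMeasurable fun q : ℝ × E => g q.1 q.2) :
    StronglyMeasurable fun p : (ℝ × ℝ) × E => heatOp k (p.1.1 - p.1.2) (g p.1.2) p.2 := by
  refine StronglyMeasurable.integral_prod_right'
    (f := fun p : ((ℝ × ℝ) × E) × E => k (p.1.1.1 - p.1.1.2) p.2 • g p.1.1.2 (p.1.2 - p.2)) ?_
  exact (hk.stronglyMeasurable.comp_measurable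
    (g := fun p : ((ℝ × ℝ) × E) × E => (p.1.1.1 - p.1.1.2, p.2)) (by fun_prop)).smul
    (hg.comp_measurable
      (g := fun p : ((ℝ × ℝ) × E) × E => (p.1.1.2, p.1.2 - p.2)) (by fun_prop))

theorem stronglyMeasurable_heatOp_left {g : ℝ → E → F}
    (hg : StronglyMeasurable fun q : ℝ × E => g q.1 q.2) (t : ℝ) (x : E) :
    StronglyMeasurable fun s => heatOp k (t - s) (g s) x :=
  (hk.stronglyMeasurable_heatOp hg).comp_measurable (g := fun s : ℝ => ((t, s), x)) (by fun_prop)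

theorem stronglyMeasurable_gradOp {g : ℝ → E → F}
    (hg : StronglyMeasurable fun q : ℝ × E => g q.1 q.2) (t : ℝ) (x : E) :
    StronglyMeasurable fun s => gradOp k (t - s) (g s) x := by
  refine StronglyMeasurable.integral_prod_right'
    (f := fun p : ℝ × E => (fderiv ℝ (k (t - p.1)) (x - p.2)).smulRight (g p.1 p.2)) ?_
  have h3 : Continuous fun p : (E →L[ℝ] ℝ) × F => p.1.smulRight p.2 :=
    (ContinuousLinearMap.smulRightL ℝ E F).continuous₂
  exact h3.comp_stronglyMeasurable ((hk.stronglyMeasurable_fderiv.comp_measurable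
    (g := fun p : ℝ × E => (t - p.1, x - p.2)) (by fun_prop)).prodMk hg)

variable {b : ℝ} {g : ℝ → E → F} (hg : IsSource T b g)
include hg

theorem heatOp_source_eq_zero {t s : ℝ} (hs : s ∉ Ioo 0 T) (x : E) :
    heatOp k (t - s) (g s) x = 0 := by simp [heatOp, hg.zero s hs]

theorem gradOp_source_eq_zero {t s : ℝ} (hs : s ∉ Ioo 0 T) (x : E) :
    gradOp k (t - s) (g s) x = 0 := by
  have : (fun y => (fderiv ℝ (k (t - s)) (x - y)).smulRight (g s y)) = fun _ => 0 := by
    ext y v; simp [hg.zero s hs]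
  rw [gradOp, this, integral_zero]

theorem norm_heatOp_source_le (t s : ℝ) (x : E) :
    ‖heatOp k (t - s) (g s) x‖ ≤ (Ioo 0 T).indicator (fun _ => b) s := by
  by_cases hs : s ∈ Ioo 0 T
  · rw [indicator_of_mem hs]; exact hk.norm_heatOp_le _ _ (hg.bound s)
  · rw [indicator_of_notMem hs, hk.heatOp_source_eq_zero hg hs, norm_zero]

theorem integrable_heatOp (t : ℝ) (x : E) : Integrable fun s => heatOp k (t - s) (g s) x := by
  refine Integrable.mono' (g := (Ioo 0 T).indicator fun _ => b)
    ((integrable_indicator_iff measurableSet_Ioo).2 (integrableOn_const (by simp)))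
    (hk.stronglyMeasurable_heatOp_left hg.stronglyMeasurable t x).aestronglyMeasurable
    (ae_of_all _ fun s => hk.norm_heatOp_source_le hg t s x)

theorem stronglyMeasurable_duhamel :
    StronglyMeasurable fun q : ℝ × E => duhamel k g q.1 q.2 :=
  StronglyMeasurable.integral_prod_right'
    (f := fun p : (ℝ × E) × ℝ => heatOp k (p.1.1 - p.2) (g p.2) p.1.2)
    ((hk.stronglyMeasurable_heatOp hg.stronglyMeasurable).comp_measurable
      (g := fun p : (ℝ × E) × ℝ => ((p.1.1, p.2), p.1.2)) (by fun_prop))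

theorem continuousOn_duhamel :
    ContinuousOn (fun q : ℝ × E => duhamel k g q.1 q.2) (strip E T) := by
  refine fun q₀ h₀ => ContinuousAt.continuousWithinAt ?_
  refine continuousAt_of_dominated (bound := (Ioo 0 T).indicator fun _ => b)
    (Eventually.of_forall fun q => (hk.stronglyMeasurable_heatOp_left hg.stronglyMeasurable
      q.1 q.2).aestronglyMeasurable)
    (Eventually.of_forall fun q => ae_of_all _ fun s => hk.norm_heatOp_source_le hg q.1 s q.2)
    ((integrable_indicator_iff measurableSet_Ioo).2 (integrableOn_const (by simp))) ?_
  have hne : ∀ᵐ s : ℝ, s ≠ q₀.1 := by simp [ae_iff, measure_singleton]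
  filter_upwards [hne] with s hs
  by_cases hsT : s ∈ Ioo 0 T
  swap
  · simp only [hk.heatOp_source_eq_zero hg hsT]; exact continuousAt_const
  rcases lt_or_gt_of_ne hs with h1 | h1
  · have h2 : (q₀.1 - s, q₀.2) ∈ strip E T :=
      ⟨⟨sub_pos.2 h1, by have := h₀.1.2; have := hsT.1; simp only; linarith⟩, mem_univ _⟩
    have hm : StronglyMeasurable (g s) :=
      hg.stronglyMeasurable.comp_measurable (g := fun y : E => (s, y)) (by fun_prop)
    exact ContinuousAt.comp (g := fun q : ℝ × E => heatOp k q.1 (g s) q.2)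
      (f := fun q : ℝ × E => (q.1 - s, q.2))
      ((hk.continuousOn_heatOp hm (hg.bound s)).continuousAt ((isOpen_strip T).mem_nhds h2))
      (by fun_prop)
  · refine (continuousAt_const (y := (0 : F))).congr ?_
    have : ∀ᶠ q : ℝ × E in 𝓝 q₀, q.1 < s := continuousAt_fst.eventually_lt_const h1
    filter_upwards [this] with q hq
    exact (hk.heatOp_eq_zero (fun h => by linarith [h.1]) _ _).symm

theorem hasFDerivAt_duhamel {b' : ℝ} {g' : ℝ → E → E →L[ℝ] F} (hg' : IsSource T b' g')
    (h : ∀ s y, HasFDerivAt (g s) (g' s y) y) (t : ℝ) (x : E) :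
    HasFDerivAt (duhamel k g t) (duhamel k g' t x) x := by
  have hm : ∀ s, StronglyMeasurable (g s) := fun s =>
    hg.stronglyMeasurable.comp_measurable (g := fun y : E => (s, y)) (by fun_prop)
  have hm' : ∀ s, StronglyMeasurable (g' s) := fun s =>
    hg'.stronglyMeasurable.comp_measurable (g := fun y : E => (s, y)) (by fun_prop)
  exact hasFDerivAt_integral_of_dominated_of_fderiv_le
    (F := fun x s => heatOp k (t - s) (g s) x)
    (F' := fun x s => heatOp k (t - s) (g' s) x) (bound := (Ioo 0 T).indicator fun _ => b')
    univ_mem (Eventually.of_forall fun x => (hk.integrable_heatOp hg t x).aestronglyMeasurable)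
    (hk.integrable_heatOp hg t x) (hk.integrable_heatOp hg' t x).aestronglyMeasurable
    (ae_of_all _ fun s y _ => hk.norm_heatOp_source_le hg' t s y)
    ((integrable_indicator_iff measurableSet_Ioo).2 (integrableOn_const (by simp)))
    (ae_of_all _ fun s y _ => hk.hasFDerivAt_heatOp (t - s) y (hm s) (hm' s) (hg.bound s)
      (hg'.bound s) (h s))

theorem norm_gradOp_source_le {t : ℝ} (s : ℝ) (x : E) :
    ‖gradOp k (t - s) (g s) x‖
      ≤ (Ioo 0 T).indicator (fun r => C * r ^ (-a) * b) (t - s) := by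
  by_cases hs : s ∈ Ioo 0 T
  · by_cases hts : t - s ∈ Ioo 0 T
    · rw [indicator_of_mem hts]; exact hk.norm_gradOp_le hts _ (hg.bound s)
    · rw [indicator_of_notMem hts, hk.gradOp_eq_zero hts, norm_zero]
  · rw [hk.gradOp_source_eq_zero hg hs, norm_zero]
    have hb : 0 ≤ b := (norm_nonneg _).trans (hg.bound 0 0)
    have hC := hk.const_nonneg
    exact indicator_nonneg (fun r hr => by have := hr.1.le; positivity) _

theorem integrable_gradOp (ha : a < 1) {t : ℝ} (x : E) :
    Integrable fun s => gradOp k (t - s) (g s) x := by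
  refine Integrable.mono' (g := fun s => (Ioo 0 T).indicator (fun r => C * r ^ (-a) * b) (t - s))
    (Integrable.comp_sub_left ((integrable_indicator_iff measurableSet_Ioo).2
      (((integrableOn_Ioo_rpow ha).const_mul C).mul_const b)) t)
    (hk.stronglyMeasurable_gradOp hg.stronglyMeasurable t x).aestronglyMeasurable
    (ae_of_all _ fun s => hk.norm_gradOp_source_le hg s x)

theorem hasFDerivAt_duhamel_gradDuhamel (ha : a < 1) {t : ℝ} (x : E) :
    HasFDerivAt (duhamel k g t) (gradDuhamel k g t x) x := by
  have hm : ∀ s, StronglyMeasurable (g s) := fun s =>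
    hg.stronglyMeasurable.comp_measurable (g := fun y : E => (s, y)) (by fun_prop)
  exact hasFDerivAt_integral_of_dominated_of_fderiv_le
    (F := fun x s => heatOp k (t - s) (g s) x)
    (F' := fun x s => gradOp k (t - s) (g s) x)
    (bound := fun s => (Ioo 0 T).indicator (fun r => C * r ^ (-a) * b) (t - s))
    univ_mem (Eventually.of_forall fun x => (hk.integrable_heatOp hg t x).aestronglyMeasurable)
    (hk.integrable_heatOp hg t x) (hk.integrable_gradOp hg ha x).aestronglyMeasurable
    (ae_of_all _ fun s y _ => hk.norm_gradOp_source_le hg s y)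
    (Integrable.comp_sub_left ((integrable_indicator_iff measurableSet_Ioo).2
      (((integrableOn_Ioo_rpow ha).const_mul C).mul_const b)) t)
    (ae_of_all _ fun s y _ => hk.hasFDerivAt_heatOp_gradOp (t - s) y (hm s) (hg.bound s))

theorem continuousOn_gradDuhamel (ha0 : 0 < a) (ha : a < 1) :
    ContinuousOn (fun q : ℝ × E => gradDuhamel k g q.1 q.2) (strip E T) := by
  -- this exponent keeps `a * (1 + α) < 1`, so that the Hölder bound is integrable in time
  set α : ℝ := (1 - a) / 2 with hα
  have hα0 : 0 < α := by rw [hα]; linarith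
  have hα1 : α ≤ 1 := by rw [hα]; linarith
  have haα : a * (1 + α) < 1 := by rw [hα]; nlinarith
  have hb : 0 ≤ b := (norm_nonneg _).trans (hg.bound 0 0)
  have hC := hk.const_nonneg
  have hi : Integrable ((Ioo 0 T).indicator fun r : ℝ => r ^ (-(a * (1 + α)))) :=
    (integrable_indicator_iff measurableSet_Ioo).2 (integrableOn_Ioo_rpow haα)
  refine continuousOn_strip_of_holder (α := α) hα0
    (K := 2 * C * b * ∫ r, (Ioo 0 T).indicator (fun r : ℝ => r ^ (-(a * (1 + α)))) r)
    (hk.continuousOn_duhamel hg)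
    (fun t _ x => hk.hasFDerivAt_duhamel_gradDuhamel hg ha x) (fun t _ x y => ?_)
  have hm : ∀ s, StronglyMeasurable (g s) := fun s =>
    hg.stronglyMeasurable.comp_measurable (g := fun y : E => (s, y)) (by fun_prop)
  rw [gradDuhamel, gradDuhamel, ← integral_sub (hk.integrable_gradOp hg ha x)
    (hk.integrable_gradOp hg ha y)]
  refine (norm_integral_le_of_norm_le (((hi.comp_sub_left t).const_mul
    (2 * C * b)).mul_const (‖x - y‖ ^ α)) (ae_of_all _ fun s => ?_)).trans (le_of_eq ?_)
  · by_cases hts : t - s ∈ Ioo 0 T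
    · rw [indicator_of_mem hts]
      exact hk.norm_gradOp_sub_le_rpow hts x y (hm s) (hg.bound s) ⟨hα0.le, hα1⟩
    · rw [indicator_of_notMem hts, hk.gradOp_eq_zero hts, hk.gradOp_eq_zero hts]
      simp
  · rw [integral_mul_const, integral_const_mul, integral_sub_left_eq_self]

omit hg in
/-- The Duhamel integral and its gradient in weighted norms. -/
theorem weighted_duhamel_le (ha : a < 1) {l : ℝ} (hl : 0 ≤ l) {t : ℝ} {c : ℝ}
    (hc : ∀ s ∈ Ioo 0 T, ∀ x, ‖g s x‖ ≤ c * Real.exp (l * s)) (hc0 : 0 ≤ c)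
    (hz : ∀ s ∉ Ioo 0 T, g s = 0) (x : E) :
    ‖duhamel k g t x‖ ≤ weightMass T a C l * c * Real.exp (l * t) ∧
      ‖gradDuhamel k g t x‖ ≤ weightMass T a C l * c * Real.exp (l * t) := by
  have hC := hk.const_nonneg
  set W : ℝ → ℝ := (Ioo 0 T).indicator fun r => (1 + C * r ^ (-a)) * Real.exp (-(l * r)) with hW
  have hW0 : ∀ r, 0 ≤ W r := fun r =>
    indicator_nonneg (fun r hr => by have := hr.1.le; positivity) _
  have hint : ∫ s, W (t - s) * (c * Real.exp (l * t))
      = weightMass T a C l * c * Real.exp (l * t) := by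
    rw [integral_mul_const, integral_sub_left_eq_self, weightMass, mul_assoc]
  have hi : Integrable fun s => W (t - s) * (c * Real.exp (l * t)) :=
    ((integrable_weight ha hl).comp_sub_left t).mul_const _
  have hexp : ∀ s, Real.exp (-(l * (t - s))) * Real.exp (l * t) = Real.exp (l * s) := fun s => by
    rw [← Real.exp_add]; ring_nf
  have hnn : ∀ s, 0 ≤ W (t - s) * (c * Real.exp (l * t)) := fun s =>
    mul_nonneg (hW0 _) (by positivity)
  constructor
  · refine (norm_integral_le_of_norm_le hi (ae_of_all _ fun s => ?_)).trans hint.le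
    by_cases hs : s ∈ Ioo 0 T
    · by_cases hts : t - s ∈ Ioo 0 T
      · have := hts.1.le
        refine (hk.norm_heatOp_le _ _ (hc s hs)).trans ?_
        rw [hW, indicator_of_mem hts, ← hexp s]
        have h1 : (1 : ℝ) ≤ 1 + C * (t - s) ^ (-a) := le_add_of_nonneg_right (by positivity)
        calc c * (Real.exp (-(l * (t - s))) * Real.exp (l * t))
            = 1 * (c * (Real.exp (-(l * (t - s))) * Real.exp (l * t))) := by ring
          _ ≤ (1 + C * (t - s) ^ (-a)) * (c * (Real.exp (-(l * (t - s))) * Real.exp (l * t))) := by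
              gcongr
          _ = _ := by ring
      · rw [hk.heatOp_eq_zero hts, norm_zero]; exact hnn s
    · have h0 : heatOp k (t - s) (g s) x = 0 := by simp [heatOp, hz s hs]
      rw [h0, norm_zero]; exact hnn s
  · refine (norm_integral_le_of_norm_le hi (ae_of_all _ fun s => ?_)).trans hint.le
    by_cases hs : s ∈ Ioo 0 T
    · by_cases hts : t - s ∈ Ioo 0 T
      · have := hts.1.le
        refine (hk.norm_gradOp_le hts _ (hc s hs)).trans ?_
        rw [hW, indicator_of_mem hts, ← hexp s]
        calc C * (t - s) ^ (-a) * (c * (Real.exp (-(l * (t - s))) * Real.exp (l * t)))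
            ≤ (1 + C * (t - s) ^ (-a)) * (c * (Real.exp (-(l * (t - s))) * Real.exp (l * t))) := by
              gcongr; linarith
          _ = _ := by ring
      · rw [hk.gradOp_eq_zero hts, norm_zero]; exact hnn s
    · have h0 : gradOp k (t - s) (g s) x = 0 := by
        have : (fun y => (fderiv ℝ (k (t - s)) (x - y)).smulRight (g s y)) = fun _ => 0 := by
          ext y v; simp [hz s hs]
        rw [gradOp, this, integral_zero]
      rw [h0, norm_zero]; exact hnn s

end IsHeatKernel

end Duhamel

/-! ### The Lévy symbol and the heat kernel -/

section Symbol

variable {d : ℕ} {μ : Measure (Rd d)} {Λ : ℝ}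

/-- The integrand of the Lévy symbol. -/
noncomputable def symbolIntegrand (ξ z : Rd d) : ℂ :=
  Complex.exp (Complex.I * (⟪ξ, z⟫ : ℝ)) - 1
    - (ball (0 : Rd d) 1).indicator (fun z => Complex.I * ((⟪ξ, z⟫ : ℝ) : ℂ)) z

theorem norm_exp_I_sub_le (r : ℝ) :
    ‖Complex.exp (Complex.I * r) - 1 - Complex.I * r‖ ≤ 3 * r ^ 2 := by
  have hn : ‖Complex.I * (r : ℂ)‖ = |r| := by simp
  rcases le_total |r| 1 with h | h
  · refine (Complex.norm_exp_sub_one_sub_id_le (by rw [hn]; exact h)).trans ?_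
    rw [hn, sq_abs]; nlinarith [sq_nonneg r]
  · have h1 : ‖Complex.exp (Complex.I * r)‖ = 1 := by
      rw [mul_comm]; exact Complex.norm_exp_ofReal_mul_I r
    refine (norm_sub_le _ _).trans ?_
    have h2 := norm_sub_le (Complex.exp (Complex.I * r)) 1
    rw [h1, norm_one] at h2
    rw [hn, ← sq_abs]
    nlinarith

theorem norm_symbolIntegrand_le (ξ z : Rd d) :
    ‖symbolIntegrand ξ z‖ ≤ (2 + 3 * ‖ξ‖ ^ 2) * min 1 (‖z‖ ^ 2) := by
  by_cases hz : z ∈ ball (0 : Rd d) 1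
  · have hz1 : ‖z‖ < 1 := by simpa using hz
    rw [symbolIntegrand, indicator_of_mem hz, min_eq_right (by nlinarith [norm_nonneg z])]
    refine (norm_exp_I_sub_le _).trans ?_
    have h1 : ⟪ξ, z⟫ ^ 2 ≤ ‖ξ‖ ^ 2 * ‖z‖ ^ 2 := by
      rw [← sq_abs, ← mul_pow]; gcongr; exact abs_real_inner_le_norm ξ z
    nlinarith [sq_nonneg ‖z‖]
  · have hz1 : 1 ≤ ‖z‖ := by simpa using hz
    rw [symbolIntegrand, indicator_of_notMem hz, min_eq_left (by nlinarith), sub_zero]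
    have h1 : ‖Complex.exp (Complex.I * (⟪ξ, z⟫ : ℝ))‖ = 1 := by
      rw [mul_comm]; exact Complex.norm_exp_ofReal_mul_I _
    have h2 := norm_sub_le (Complex.exp (Complex.I * (⟪ξ, z⟫ : ℝ))) 1
    rw [h1, norm_one] at h2
    nlinarith [sq_nonneg ‖ξ‖]

theorem measurable_symbolIntegrand (ξ : Rd d) : Measurable (symbolIntegrand ξ) := by
  unfold symbolIntegrand
  refine Measurable.sub (Continuous.measurable (by fun_prop)) ?_
  exact (Continuous.measurable (by fun_prop)).indicator measurableSet_ball

theorem LevyCondition.integrable_symbolIntegrand (h : LevyCondition μ Λ) (ξ : Rd d) :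
    Integrable (symbolIntegrand ξ) μ :=
  (h.integrable.const_mul _).mono' (measurable_symbolIntegrand ξ).aestronglyMeasurable
    (ae_of_all _ (norm_symbolIntegrand_le ξ))

theorem LevyCondition.norm_levySymbol_le (h : LevyCondition μ Λ) (ξ : Rd d) :
    ‖levySymbol μ ξ‖ ≤ (2 + 3 * ‖ξ‖ ^ 2) * max Λ 0 := by
  refine (norm_integral_le_of_norm_le (h.integrable.const_mul (2 + 3 * ‖ξ‖ ^ 2))
    (ae_of_all _ (norm_symbolIntegrand_le ξ))).trans ?_
  rw [integral_const_mul]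
  gcongr
  exact h.integral_min_le

theorem LevyCondition.continuous_levySymbol (h : LevyCondition μ Λ) :
    Continuous (levySymbol μ) := by
  refine continuous_iff_continuousAt.2 fun ξ₀ => ?_
  refine continuousAt_of_dominated (F := fun ξ z => symbolIntegrand ξ z)
    (bound := fun z => (2 + 3 * (‖ξ₀‖ + 1) ^ 2) * min 1 (‖z‖ ^ 2))
    (Eventually.of_forall fun ξ => (measurable_symbolIntegrand ξ).aestronglyMeasurable) ?_
    (h.integrable.const_mul _) (ae_of_all _ fun z => ?_)
  · filter_upwards [ball_mem_nhds ξ₀ one_pos] with ξ hξ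
    refine ae_of_all _ fun z => (norm_symbolIntegrand_le ξ z).trans ?_
    have : ‖ξ‖ ≤ ‖ξ₀‖ + 1 := by
      have h1 := norm_sub_norm_le ξ ξ₀
      rw [mem_ball, dist_eq_norm] at hξ
      linarith
    gcongr
  · unfold symbolIntegrand
    refine ContinuousAt.sub (Continuous.continuousAt (by fun_prop)) ?_
    by_cases hz : z ∈ ball (0 : Rd d) 1
    · simp only [indicator_of_mem hz]; exact Continuous.continuousAt (by fun_prop)
    · simp only [indicator_of_notMem hz]; exact continuousAt_const

theorem LevyCondition.re_levySymbol_nonpos (h : LevyCondition μ Λ) (ξ : Rd d) :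
    (levySymbol μ ξ).re ≤ 0 := by
  have h1 : (levySymbol μ ξ).re = ∫ z, (symbolIntegrand ξ z).re ∂μ :=
    (integral_re (h.integrable_symbolIntegrand ξ)).symm
  rw [h1]
  refine integral_nonpos fun z => ?_
  have h2 : (Complex.exp (Complex.I * (⟪ξ, z⟫ : ℝ))).re = Real.cos ⟪ξ, z⟫ := by
    rw [mul_comm]; exact Complex.exp_ofReal_mul_I_re _
  by_cases hz : z ∈ ball (0 : Rd d) 1
  · simp only [symbolIntegrand, indicator_of_mem hz, Complex.sub_re, h2]
    simp [Real.cos_le_one]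
  · simp only [symbolIntegrand, indicator_of_notMem hz, Complex.sub_re, h2]
    simp [Real.cos_le_one]

theorem levySymbol_neg (ξ : Rd d) :
    levySymbol μ (-ξ) = (starRingEnd ℂ) (levySymbol μ ξ) := by
  change ∫ z, symbolIntegrand (-ξ) z ∂μ = (starRingEnd ℂ) (∫ z, symbolIntegrand ξ z ∂μ)
  rw [← integral_conj]
  refine integral_congr_ae (ae_of_all _ fun z => ?_)
  by_cases hz : z ∈ ball (0 : Rd d) 1
  · simp [symbolIntegrand, indicator_of_mem hz, ← Complex.exp_conj]
  · simp [symbolIntegrand, indicator_of_notMem hz, ← Complex.exp_conj]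

/-- The Fourier transform of the heat kernel, in Mathlib's normalization. -/
noncomputable def heatSymbol (μ : Measure (Rd d)) (t : ℝ) (η : Rd d) : ℂ :=
  Complex.exp ((t : ℂ) * levySymbol μ ((2 * Real.pi) • η))

theorem LevyCondition.continuous_heatSymbol (h : LevyCondition μ Λ) :
    Continuous fun q : ℝ × Rd d => heatSymbol μ q.1 q.2 := by
  have := h.continuous_levySymbol
  unfold heatSymbol
  fun_prop

theorem norm_heatSymbol (t : ℝ) (η : Rd d) :
    ‖heatSymbol μ t η‖ = Real.exp (t * (levySymbol μ ((2 * Real.pi) • η)).re) := by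
  rw [heatSymbol, Complex.norm_exp, Complex.re_ofReal_mul]

theorem LevyCondition.norm_heatSymbol_anti (h : LevyCondition μ Λ) {s t : ℝ} (hst : s ≤ t)
    (η : Rd d) : ‖heatSymbol μ t η‖ ≤ ‖heatSymbol μ s η‖ := by
  rw [norm_heatSymbol, norm_heatSymbol]
  exact Real.exp_le_exp.2 (mul_le_mul_of_nonpos_right hst (h.re_levySymbol_nonpos _))

theorem LevyCondition.norm_heatSymbol_le_one (h : LevyCondition μ Λ) {t : ℝ} (ht : 0 ≤ t)
    (η : Rd d) : ‖heatSymbol μ t η‖ ≤ 1 := by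
  refine (h.norm_heatSymbol_anti ht η).trans (le_of_eq ?_)
  rw [norm_heatSymbol]; simp

/-- The real part of the inverse Fourier integral. -/
noncomputable def fourierRe (g : Rd d → ℂ) (x : Rd d) : ℝ :=
  (∫ v, Complex.exp ((2 * Real.pi * ⟪v, x⟫ : ℝ) * Complex.I) * g v).re

theorem heatKernel_eq (t : ℝ) : heatKernel μ t = fourierRe (heatSymbol μ t) := by
  ext x
  rw [heatKernel, Real.fourierInv_eq']
  rfl

theorem norm_exp_mul (r : ℝ) (w : ℂ) : ‖Complex.exp ((r : ℂ) * Complex.I) * w‖ = ‖w‖ := by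
  rw [norm_mul, Complex.norm_exp_ofReal_mul_I, one_mul]

theorem integrable_exp_mul {g : Rd d → ℂ} (hg : Integrable g) (x : Rd d) :
    Integrable fun v => Complex.exp ((2 * Real.pi * ⟪v, x⟫ : ℝ) * Complex.I) * g v := by
  refine hg.mono (AEStronglyMeasurable.mul (Continuous.aestronglyMeasurable (by fun_prop))
    hg.aestronglyMeasurable) (ae_of_all _ fun v => (norm_exp_mul _ _).le)

variable {σ T : ℝ} {𝒦 : ℕ → ℝ → ℝ}

/-- If the symbol were not integrable, the heat kernel would be the zero function by
convention, contrary to its having mass one. -/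
theorem HeatKernelBounds.integrable_heatSymbol (hK : HeatKernelBounds μ σ T 𝒦)
    (h : LevyCondition μ Λ) {t : ℝ} (ht : t ∈ Ioo 0 T) : Integrable (heatSymbol μ t) := by
  by_contra hn
  have hc : Continuous (heatSymbol μ t) := h.continuous_heatSymbol.comp (by fun_prop :
    Continuous fun η : Rd d => (t, η))
  have h0 : heatKernel μ t = 0 := by
    ext x
    rw [heatKernel_eq, fourierRe, integral_undef]
    · simp
    · intro hi
      refine hn (hi.mono hc.aestronglyMeasurable (ae_of_all _ fun v => (norm_exp_mul _ _).ge))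
  have := hK.mass t ht
  rw [h0, eLpNorm_zero] at this
  exact zero_ne_one this

theorem HeatKernelBounds.integrable (hK : HeatKernelBounds μ σ T 𝒦) {t : ℝ} (ht : t ∈ Ioo 0 T) :
    Integrable (heatKernel μ t) := by
  refine memLp_one_iff_integrable.1 ⟨(hK.smooth t ht).continuous.aestronglyMeasurable, ?_⟩
  rw [hK.mass t ht]; exact ENNReal.one_lt_top

theorem heatKernel_ofReal (t : ℝ) (x : Rd d) :
    (heatKernel μ t x : ℂ)
      = ∫ v, Complex.exp ((2 * Real.pi * ⟪v, x⟫ : ℝ) * Complex.I) * heatSymbol μ t v := by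
  rw [heatKernel_eq, fourierRe]
  refine (Complex.conj_eq_iff_re.1 ?_)
  rw [← integral_conj, ← integral_neg_eq_self]
  refine integral_congr_ae (ae_of_all _ fun v => ?_)
  simp only [map_mul, heatSymbol, ← Complex.exp_conj, Complex.conj_ofReal, smul_neg,
    levySymbol_neg, Complex.conj_conj, Complex.conj_I, inner_neg_left]
  push_cast
  ring_nf

/-- Fourier inversion: the Fourier transform of the heat kernel is `exp (t * symbol)`. -/
theorem HeatKernelBounds.fourier_heatKernel (hK : HeatKernelBounds μ σ T 𝒦)
    (h : LevyCondition μ Λ) {t : ℝ} (ht : t ∈ Ioo 0 T) (η : Rd d) :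
    ∫ y, Complex.exp ((2 * Real.pi * ⟪η, -y⟫ : ℝ) * Complex.I) * (heatKernel μ t y : ℂ)
      = heatSymbol μ t η := by
  have hc : Continuous (heatSymbol μ t) := h.continuous_heatSymbol.comp (by fun_prop :
    Continuous fun η : Rd d => (t, η))
  have h1 : 𝓕⁻ (heatSymbol μ t) = fun x => (heatKernel μ t x : ℂ) := by
    ext x
    rw [Real.fourierInv_eq', heatKernel_ofReal]; rfl
  have h3 : Integrable (𝓕 (heatSymbol μ t)) := by
    have h4 : 𝓕 (heatSymbol μ t) = fun x => (𝓕⁻ (heatSymbol μ t)) (-x) := by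
      ext x; rw [Real.fourierInv_eq_fourier_neg, neg_neg]
    rw [h4, h1]
    exact ((hK.integrable ht).comp_neg).ofReal
  have h2 := congrFun (hc.fourier_fourierInv_eq (hK.integrable_heatSymbol h ht)
    h3) η
  rw [h1, Real.fourier_eq'] at h2
  rw [← h2]
  refine integral_congr_ae (ae_of_all _ fun y => ?_)
  simp only [smul_eq_mul, inner_neg_right, real_inner_comm]
  ring_nf

/-- Near the time `t`, the symbol at time `t / 2` dominates the Fourier integrals. -/
theorem HeatKernelBounds.continuousOn_heatKernel (hK : HeatKernelBounds μ σ T 𝒦)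
    (h : LevyCondition μ Λ) :
    ContinuousOn (fun q : ℝ × Rd d => heatKernel μ q.1 q.2) (strip (Rd d) T) := by
  intro q₀ h₀
  refine ContinuousAt.continuousWithinAt ?_
  simp only [heatKernel_eq]
  refine Complex.continuous_re.continuousAt.comp ?_
  have ht2 : q₀.1 / 2 ∈ Ioo 0 T := ⟨half_pos h₀.1.1, (half_lt_self h₀.1.1).trans h₀.1.2⟩
  refine continuousAt_of_dominated (bound := fun v => ‖heatSymbol μ (q₀.1 / 2) v‖) ?_ ?_
    (hK.integrable_heatSymbol h ht2).norm (ae_of_all _ fun v => ?_)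
  · refine Eventually.of_forall fun q => Continuous.aestronglyMeasurable ?_
    exact (by fun_prop : Continuous fun v : Rd d =>
      Complex.exp ((2 * Real.pi * ⟪v, q.2⟫ : ℝ) * Complex.I)).mul
      (h.continuous_heatSymbol.comp (by fun_prop : Continuous fun η : Rd d => (q.1, η)))
  · have : ∀ᶠ q : ℝ × Rd d in 𝓝 q₀, q₀.1 / 2 < q.1 :=
      continuousAt_fst.eventually_const_lt (half_lt_self h₀.1.1)
    filter_upwards [this] with q hq
    refine ae_of_all _ fun v => ?_
    rw [norm_exp_mul]
    exact h.norm_heatSymbol_anti hq.le v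
  · exact Continuous.continuousAt ((by fun_prop : Continuous fun q : ℝ × Rd d =>
      Complex.exp ((2 * Real.pi * ⟪v, q.2⟫ : ℝ) * Complex.I)).mul
      (h.continuous_heatSymbol.comp (by fun_prop : Continuous fun q : ℝ × Rd d => (q.1, v))))

open Classical in
/-- The heat kernel, extended by zero to times outside `(0,T)`. -/
noncomputable def heatKer (μ : Measure (Rd d)) (T t : ℝ) : Rd d → ℝ :=
  if t ∈ Ioo 0 T then heatKernel μ t else 0

theorem heatKer_of_mem {t : ℝ} (ht : t ∈ Ioo 0 T) : heatKer μ T t = heatKernel μ t := if_pos ht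

/-- Of the bounds on the heat kernel, those for the first two derivatives in `L¹` are needed for
the regularizing effect. -/
theorem HeatKernelBounds.isHeatKernel (hK : HeatKernelBounds μ σ T 𝒦) (h : LevyCondition μ Λ) :
    IsHeatKernel T (1 / σ) (max (max (𝒦 1 1) (𝒦 2 1)) 0) (heatKer μ T) := by
  have hb : ∀ (j : ℕ) (c : ℝ), 𝒦 j 1 ≤ c → ∀ t ∈ Ioo 0 T,
      ∫⁻ x, ‖iteratedFDeriv ℝ j (heatKernel μ t) x‖ₑ
        ≤ ENNReal.ofReal (c * t ^ (-(j * (1 / σ)))) := fun j c hc t ht => by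
    have h1 := hK.bound j 1 le_rfl t ht
    rw [ENNReal.ofReal_one, eLpNorm_one_eq_lintegral_enorm] at h1
    refine h1.trans (ENNReal.ofReal_le_ofReal ?_)
    have := ht.1.le
    rw [show -(1 / σ) * ((j : ℝ) + (1 - 1 / 1) * d) = -(j * (1 / σ)) by ring]
    gcongr
  refine ⟨?_, fun t ht => if_neg ht, fun t x => ?_, fun t => ?_, fun t ht => ?_, fun t => ?_,
    le_max_right _ _, fun t ht => ?_, fun t ht => ?_⟩
  · exact (hK.continuousOn_heatKernel h).congr fun q hq => by rw [heatKer_of_mem hq.1]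
  · rw [heatKer]; split_ifs with ht
    · exact hK.nonneg t ht x
    · exact le_rfl
  · rw [heatKer]; split_ifs with ht
    · exact hK.integrable ht
    · exact integrable_zero _ _ _
  · rw [heatKer_of_mem ht, integral_eq_lintegral_of_nonneg_ae (ae_of_all _ (hK.nonneg t ht))
      (hK.integrable ht).aestronglyMeasurable]
    have h1 := hK.mass t ht
    rw [eLpNorm_one_eq_lintegral_enorm] at h1
    rw [← ENNReal.toReal_one, ← h1]
    congr 1
    refine lintegral_congr fun x => ?_
    rw [Real.enorm_of_nonneg (hK.nonneg t ht x)]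
  · rw [heatKer]; split_ifs with ht
    · exact by exact_mod_cast contDiff_infty.1 (hK.smooth t ht) 2
    · exact contDiff_const
  · rw [heatKer_of_mem ht]
    have h1 := hb 1 _ ((le_max_left (𝒦 1 1) (𝒦 2 1)).trans (le_max_left _ 0)) t ht
    simp only [Nat.cast_one, one_mul] at h1
    refine le_trans (le_of_eq (lintegral_congr fun x => ?_)) h1
    rw [← ofReal_norm, ← ofReal_norm, norm_iteratedFDeriv_one]
  · rw [heatKer_of_mem ht]
    have h1 := hb 2 _ ((le_max_right (𝒦 1 1) (𝒦 2 1)).trans (le_max_left _ 0)) t ht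
    simp only [Nat.cast_ofNat] at h1
    refine le_trans (le_of_eq (lintegral_congr fun x => ?_)) h1
    have h2 := norm_iteratedFDeriv_fderiv (𝕜 := ℝ) (f := heatKernel μ t) (x := x) (n := 1)
    rw [norm_iteratedFDeriv_one] at h2
    rw [← ofReal_norm, ← ofReal_norm, h2]

end Symbol

/-! ### The Lévy operator generates the heat semigroup -/

section Generator

variable {d : ℕ} {μ : Measure (Rd d)} {Λ σ T : ℝ} {𝒦 : ℕ → ℝ → ℝ}

/-- The heat operator multiplies the Fourier side by `exp (t * symbol)`. -/
theorem HeatKernelBounds.heatOp_fourierRe (hK : HeatKernelBounds μ σ T 𝒦)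
    (h : LevyCondition μ Λ) {g : Rd d → ℂ} (hg : Integrable g) {t : ℝ} (ht : t ∈ Ioo 0 T)
    (x : Rd d) :
    heatOp (heatKer μ T) t (fourierRe g) x = fourierRe (fun v => g v * heatSymbol μ t v) x := by
  have hKi : Integrable fun y => (heatKernel μ t y : ℂ) := (hK.integrable ht).ofReal
  have hint : Integrable (Function.uncurry fun (y v : Rd d) => (heatKernel μ t y : ℂ)
      * (Complex.exp ((2 * Real.pi * ⟪v, x - y⟫ : ℝ) * Complex.I) * g v))
      ((volume : Measure (Rd d)).prod volume) := by
    refine (hKi.mul_prod hg).mono ?_ (ae_of_all _ fun p => ?_)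
    · refine AEStronglyMeasurable.mul (hKi.aestronglyMeasurable.comp_fst)
        (AEStronglyMeasurable.mul (Continuous.aestronglyMeasurable (by fun_prop))
          hg.aestronglyMeasurable.comp_snd)
    · simp only [Function.uncurry]
      rw [norm_mul, norm_exp_mul, norm_mul]
  have h1 : ∀ y, heatKer μ T t y • fourierRe g (x - y)
      = (∫ v, (heatKernel μ t y : ℂ)
        * (Complex.exp ((2 * Real.pi * ⟪v, x - y⟫ : ℝ) * Complex.I) * g v)).re := fun y => by
    rw [heatKer_of_mem ht, fourierRe, integral_const_mul, Complex.re_ofReal_mul, smul_eq_mul]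
  rw [heatOp]
  simp only [h1]
  have h2 : ∫ y, (∫ v, (heatKernel μ t y : ℂ)
        * (Complex.exp ((2 * Real.pi * ⟪v, x - y⟫ : ℝ) * Complex.I) * g v)).re
      = (∫ y, ∫ v, (heatKernel μ t y : ℂ)
        * (Complex.exp ((2 * Real.pi * ⟪v, x - y⟫ : ℝ) * Complex.I) * g v)).re :=
    integral_re hint.integral_prod_left
  rw [h2, integral_integral_swap hint, fourierRe]
  congr 2
  ext v
  rw [← hK.fourier_heatKernel h ht v, mul_left_comm, ← integral_const_mul, ← integral_const_mul]
  congr 1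
  ext y
  rw [sub_eq_add_neg, inner_add_right]
  push_cast
  rw [mul_add, add_mul, Complex.exp_add]
  ring_nf

theorem LevyCondition.integrable_mul_levySymbol (h : LevyCondition μ Λ) {g : Rd d → ℂ}
    (hg : StronglyMeasurable g) (hi : Integrable fun v => (1 + ‖v‖ ^ 2) * ‖g v‖) :
    Integrable fun v => g v * levySymbol μ ((2 * Real.pi) • v) := by
  have hpi : 0 ≤ 2 * Real.pi := by positivity
  refine (hi.const_mul ((2 + 3 * (2 * Real.pi) ^ 2) * max Λ 0)).mono' (hg.mul
    (h.continuous_levySymbol.comp (by fun_prop)).stronglyMeasurable).aestronglyMeasurable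
    (ae_of_all _ fun v => ?_)
  rw [norm_mul, mul_comm]
  have h1 := h.norm_levySymbol_le ((2 * Real.pi) • v)
  rw [norm_smul, Real.norm_of_nonneg hpi, mul_pow] at h1
  calc ‖levySymbol μ ((2 * Real.pi) • v)‖ * ‖g v‖
      ≤ ((2 + 3 * ((2 * Real.pi) ^ 2 * ‖v‖ ^ 2)) * max Λ 0) * ‖g v‖ := by gcongr
    _ ≤ ((2 + 3 * (2 * Real.pi) ^ 2) * (1 + ‖v‖ ^ 2) * max Λ 0) * ‖g v‖ := by
        have : 0 ≤ max Λ 0 := le_max_right _ _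
        gcongr
        nlinarith [sq_nonneg ‖v‖, sq_nonneg (2 * Real.pi)]
    _ = _ := by ring

/-- The plane waves are eigenfunctions of the Lévy operator, with the symbol as eigenvalue. -/
theorem LevyCondition.levyOp_fourierRe (h : LevyCondition μ Λ) {g : Rd d → ℂ}
    (hg : StronglyMeasurable g) (hi : Integrable fun v => (1 + ‖v‖ ^ 2) * ‖g v‖) (x : Rd d) :
    levyOp μ (fourierRe g) x
      = fourierRe (fun v => g v * levySymbol μ ((2 * Real.pi) • v)) x := by
  set e : Rd d → Rd d → ℂ := fun v y => Complex.exp ((2 * Real.pi * ⟪v, y⟫ : ℝ) * Complex.I)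
    with he
  -- the real linear form `z ↦ Re (w z)` on the line spanned by `v`
  set D : Rd d → Rd d → Rd d →L[ℝ] ℝ := fun v y =>
    (e v y * g v * Complex.I).re • ((2 * Real.pi) • innerSL ℝ v) with hD
  set b : Rd d → ℝ := fun v => (1 + (2 * Real.pi) + (2 * Real.pi) ^ 2) * ((1 + ‖v‖ ^ 2) * ‖g v‖)
    with hb
  have hb' : Integrable b := hi.const_mul _
  have hpi : 0 ≤ 2 * Real.pi := by positivity
  have hec : Continuous fun p : Rd d × Rd d => e p.1 p.2 := by fun_prop
  have hgi : Integrable g := hi.mono hg.aestronglyMeasurable (ae_of_all _ fun v => by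
    rw [norm_mul, norm_norm, Real.norm_of_nonneg (by positivity)]
    nlinarith [norm_nonneg (g v), mul_nonneg (sq_nonneg ‖v‖) (norm_nonneg (g v))])
  have hderiv : ∀ v y, HasFDerivAt (fun y => (e v y * g v).re) (D v y) y := fun v y => by
    have h1 : HasFDerivAt (fun y : Rd d => 2 * Real.pi * ⟪v, y⟫) ((2 * Real.pi) • innerSL ℝ v) y :=
      ((innerSL ℝ v).hasFDerivAt (x := y)).const_mul (2 * Real.pi)
    have h2 : HasDerivAt (fun r : ℝ => (Complex.exp ((r : ℂ) * Complex.I) * g v).re)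
        ((e v y * g v * Complex.I).re) (2 * Real.pi * ⟪v, y⟫) := by
      have h3 : HasDerivAt (fun r : ℝ => Complex.exp ((r : ℂ) * Complex.I) * g v)
          (e v y * (1 * Complex.I) * g v) (2 * Real.pi * ⟪v, y⟫) :=
        (((Complex.ofRealCLM.hasDerivAt (x := 2 * Real.pi * ⟪v, y⟫)).mul_const
          Complex.I).cexp).mul_const (g v)
      have h4 := Complex.reCLM.hasFDerivAt.comp_hasDerivAt _ h3
      refine h4.congr_deriv ?_
      simp only [Complex.reCLM_apply]
      congr 1
      ring
    exact h2.comp_hasFDerivAt y h1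
  have hnorm : ∀ v y, ‖e v y * g v‖ = ‖g v‖ := fun v y => norm_exp_mul _ _
  have hDle : ∀ v y, ‖D v y‖ ≤ 2 * Real.pi * ‖v‖ * ‖g v‖ := fun v y => by
    rw [hD, norm_smul, norm_smul, innerSL_apply_norm, Real.norm_of_nonneg hpi, mul_comm]
    gcongr
    refine (Complex.abs_re_le_norm _).trans ?_
    rw [norm_mul, hnorm, Complex.norm_I, mul_one]
  have hv : ∀ v : Rd d, ‖v‖ ≤ 1 + ‖v‖ ^ 2 := fun v => by nlinarith [sq_nonneg (‖v‖ - 1)]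
  have hDb : ∀ v y, ‖D v y‖ ≤ b v := fun v y => by
    refine (hDle v y).trans ?_
    have h1 : ‖v‖ * ‖g v‖ ≤ (1 + ‖v‖ ^ 2) * ‖g v‖ := by gcongr; exact hv v
    have h2 : 0 ≤ (1 + ‖v‖ ^ 2) * ‖g v‖ := by positivity
    rw [hb]
    nlinarith [mul_nonneg (sq_nonneg (2 * Real.pi)) h2]
  have hDm : ∀ y, StronglyMeasurable fun v => D v y := fun y => by
    have h1 : StronglyMeasurable fun v => (e v y * g v * Complex.I).re :=
      Complex.continuous_re.comp_stronglyMeasurable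
        ((((hec.comp (by fun_prop : Continuous fun v : Rd d => (v, y))).stronglyMeasurable).mul
          hg).mul stronglyMeasurable_const)
    exact h1.smul ((Continuous.stronglyMeasurable (by fun_prop :
      Continuous fun v : Rd d => (2 * Real.pi) • innerSL ℝ v)))
  have hDi : ∀ y, Integrable fun v => D v y := fun y =>
    hb'.mono' (hDm y).aestronglyMeasurable (ae_of_all _ fun v => hDb v y)
  have hFm : StronglyMeasurable (Function.uncurry fun (v y : Rd d) => (e v y * g v).re) :=
    Complex.continuous_re.comp_stronglyMeasurable
      (hec.stronglyMeasurable.mul (hg.comp_measurable measurable_fst))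
  have hF0 : ∀ v y, |(e v y * g v).re| ≤ b v := fun v y => by
    refine (Complex.abs_re_le_norm _).trans ?_
    rw [hnorm, hb]
    have h2 : 0 ≤ ‖v‖ ^ 2 * ‖g v‖ := by positivity
    have h3 : 0 ≤ (2 * Real.pi + (2 * Real.pi) ^ 2) * ((1 + ‖v‖ ^ 2) * ‖g v‖) := by positivity
    nlinarith
  have hlip : ∀ v y z, ‖D v y - D v z‖ ≤ b v * ‖y - z‖ := fun v y z => by
    have h1 : ‖e v y - e v z‖ ≤ 2 * Real.pi * ‖v‖ * ‖y - z‖ := by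
      have h2 : e v y - e v z = e v z
          * (Complex.exp (Complex.I * (2 * Real.pi * ⟪v, y - z⟫ : ℝ)) - 1) := by
        rw [mul_sub, mul_one, he, ← Complex.exp_add, inner_sub_right]
        congr 2
        push_cast; ring_nf
      rw [h2, norm_mul, Complex.norm_exp_ofReal_mul_I, one_mul]
      refine Real.norm_exp_I_mul_ofReal_sub_one_le.trans ?_
      rw [norm_mul, Real.norm_of_nonneg hpi, mul_assoc (2 * Real.pi)]
      exact mul_le_mul_of_nonneg_left (norm_inner_le_norm (𝕜 := ℝ) v (y - z)) hpi
    have h5 : D v y - D v z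
        = ((e v y - e v z) * g v * Complex.I).re • ((2 * Real.pi) • innerSL ℝ v) := by
      rw [sub_mul, sub_mul, Complex.sub_re]
      exact (sub_smul _ _ _).symm
    rw [h5, norm_smul, norm_smul, innerSL_apply_norm, Real.norm_of_nonneg hpi]
    calc ‖((e v y - e v z) * g v * Complex.I).re‖ * (2 * Real.pi * ‖v‖)
        ≤ (2 * Real.pi * ‖v‖ * ‖y - z‖) * ‖g v‖ * (2 * Real.pi * ‖v‖) := by
          gcongr
          refine (Complex.abs_re_le_norm _).trans ?_
          rw [norm_mul, norm_mul, Complex.norm_I, mul_one]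
          gcongr
      _ = (2 * Real.pi) ^ 2 * (‖v‖ ^ 2 * ‖g v‖) * ‖y - z‖ := by ring
      _ ≤ b v * ‖y - z‖ := by
          gcongr
          have h3 : 0 ≤ (1 + 2 * Real.pi) * ((1 + ‖v‖ ^ 2) * ‖g v‖) := by positivity
          have h4 : 0 ≤ (2 * Real.pi) ^ 2 * ‖g v‖ := by positivity
          rw [hb]; nlinarith
  have hre : ∀ y, fourierRe g y = ∫ v, (e v y * g v).re := fun y =>
    (integral_re (integrable_exp_mul hgi y)).symm
  have hfun : fourierRe g = fun y => ∫ v, (e v y * g v).re := funext hre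
  have hmain := h.levyOp_integral (F := fun v y => (e v y * g v).re) (F' := D) (x := x) hb' hFm
    (hDm x) hF0 (hDi x) hderiv hlip
    (hasFDerivAt_integral_of_dominated_of_fderiv_le (F := fun y v => (e v y * g v).re)
      (F' := fun y v => D v y) (bound := b) univ_mem
      (Eventually.of_forall fun y => (hFm.comp_measurable
        (g := fun v : Rd d => (v, y)) (by fun_prop)).aestronglyMeasurable)
      (integrable_exp_mul hgi x).re (hDm x).aestronglyMeasurable
      (ae_of_all _ fun v y _ => hDb v y) hb' (ae_of_all _ fun v y _ => hderiv v y))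
  rw [hfun, hmain.1, fourierRe]
  have hval : ∀ v, levyOp μ (fun y => (e v y * g v).re) x
      = (e v x * (g v * levySymbol μ ((2 * Real.pi) • v))).re := fun v => by
    rw [levyOp_eq, (hderiv v x).fderiv, ← mul_assoc]
    change _ = (e v x * g v * ∫ z, symbolIntegrand ((2 * Real.pi) • v) z ∂μ).re
    rw [← integral_const_mul]
    have hint := (h.integrable_symbolIntegrand ((2 * Real.pi) • v)).const_mul (e v x * g v)
    have h1 : (∫ z, e v x * g v * symbolIntegrand ((2 * Real.pi) • v) z ∂μ).re
        = ∫ z, (e v x * g v * symbolIntegrand ((2 * Real.pi) • v) z).re ∂μ :=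
      (integral_re hint).symm
    rw [h1]
    refine integral_congr_ae (ae_of_all _ fun z => ?_)
    have h2 : e v (x + z) = e v x * Complex.exp (Complex.I * (⟪(2 * Real.pi) • v, z⟫ : ℝ)) := by
      simp only [he]
      rw [← Complex.exp_add, inner_add_right, real_inner_smul_left]
      congr 1
      push_cast; ring
    have h3 : (D v x) z = (e v x * g v * (Complex.I * (⟪(2 * Real.pi) • v, z⟫ : ℝ))).re := by
      rw [hD, ← mul_assoc, mul_comm _ ((⟪(2 * Real.pi) • v, z⟫ : ℝ) : ℂ), Complex.re_ofReal_mul,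
        real_inner_smul_left]
      simp only [_root_.smul_apply, smul_eq_mul, innerSL_apply_apply]
      ring
    simp only [levyIntegrand, symbolIntegrand]
    by_cases hz : z ∈ ball (0 : Rd d) 1
    · simp only [indicator_of_mem hz, h3, h2, ← Complex.sub_re]
      congr 1; ring
    · simp only [indicator_of_notMem hz, h2, ← Complex.sub_re, sub_zero]
      congr 1; ring
  simp only [hval]
  refine integral_re (integrable_exp_mul (g := fun v => g v * levySymbol μ ((2 * Real.pi) • v))
    (h.integrable_mul_levySymbol hg hi) x)

/-- On the Fourier side the heat equation is an ordinary differential equation for each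
frequency; its integrated form is transformed back by Fubini. -/
theorem LevyCondition.fourierRe_heatSymbol_sub (h : LevyCondition μ Λ) {g : Rd d → ℂ}
    (hg : StronglyMeasurable g) (hi : Integrable fun v => (1 + ‖v‖ ^ 2) * ‖g v‖) {t : ℝ}
    (ht : 0 ≤ t) (x : Rd d) :
    fourierRe (fun v => g v * heatSymbol μ t v) x - fourierRe g x
      = ∫ r in (0 : ℝ)..t, fourierRe
        (fun v => g v * levySymbol μ ((2 * Real.pi) • v) * heatSymbol μ r v) x := by
  have hgi : Integrable g := hi.mono hg.aestronglyMeasurable (ae_of_all _ fun v => by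
    rw [norm_mul, norm_norm, Real.norm_of_nonneg (by positivity)]
    nlinarith [norm_nonneg (g v), mul_nonneg (sq_nonneg ‖v‖) (norm_nonneg (g v))])
  set p : Rd d → ℂ := fun v => g v * levySymbol μ ((2 * Real.pi) • v) with hp
  have hpi : Integrable p := h.integrable_mul_levySymbol hg hi
  have hsymb : Continuous fun q : ℝ × Rd d => heatSymbol μ q.1 q.2 := h.continuous_heatSymbol
  have hsc : ∀ r, Continuous (heatSymbol μ r) := fun r =>
    hsymb.comp (by fun_prop : Continuous fun v : Rd d => (r, v))
  have hgt : Integrable fun v => g v * heatSymbol μ t v :=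
    hgi.mono (hgi.aestronglyMeasurable.mul (hsc t).aestronglyMeasurable) (ae_of_all _ fun v => by
      rw [norm_mul]
      exact mul_le_of_le_one_right (norm_nonneg _) (h.norm_heatSymbol_le_one ht v))
  set f : ℝ → Rd d → ℂ := fun r v =>
    Complex.exp ((2 * Real.pi * ⟪v, x⟫ : ℝ) * Complex.I) * (p v * heatSymbol μ r v) with hf
  have hfi : Integrable (Function.uncurry f) ((volume.restrict (Ioc 0 t)).prod volume) := by
    have h1 : Integrable (fun q : ℝ × Rd d => (1 : ℂ) * p q.2)
        ((volume.restrict (Ioc 0 t)).prod volume) :=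
      Integrable.mul_prod (integrable_const (1 : ℂ)) hpi
    refine h1.mono ?_ ?_
    · refine AEStronglyMeasurable.mul (Continuous.aestronglyMeasurable (by fun_prop))
        (AEStronglyMeasurable.mul hpi.aestronglyMeasurable.comp_snd hsymb.aestronglyMeasurable)
    · have h2 : ∀ᵐ q ∂((volume.restrict (Ioc 0 t)).prod (volume : Measure (Rd d))),
          q.1 ∈ Ioc 0 t := by
        have h3 : ∀ᵐ r ∂(volume.restrict (Ioc 0 t)), r ∈ Ioc 0 t :=
          ae_restrict_mem measurableSet_Ioc
        exact Measure.quasiMeasurePreserving_fst.ae h3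
      filter_upwards [h2] with q hq
      simp only [Function.uncurry, hf]
      rw [norm_exp_mul, norm_mul, one_mul]
      exact mul_le_of_le_one_right (norm_nonneg _) (h.norm_heatSymbol_le_one hq.1.le _)
  have hswap := integral_integral_swap hfi
  rw [intervalIntegral.integral_of_le ht]
  change _ = ∫ r in Ioc 0 t, (∫ v, f r v).re
  have h5 : ∫ r in Ioc 0 t, (∫ v, f r v).re = (∫ r in Ioc 0 t, ∫ v, f r v).re :=
    integral_re hfi.integral_prod_left
  rw [h5, hswap, fourierRe, fourierRe, ← Complex.sub_re,
    ← integral_sub (integrable_exp_mul hgt x) (integrable_exp_mul hgi x)]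
  congr 2
  ext v
  rw [← intervalIntegral.integral_of_le ht]
  have h6 : ∀ r : ℝ, HasDerivAt (fun r : ℝ => heatSymbol μ r v)
      (levySymbol μ ((2 * Real.pi) • v) * heatSymbol μ r v) r := fun r => by
    have h7 : HasDerivAt (fun r : ℝ => (r : ℂ) * levySymbol μ ((2 * Real.pi) • v))
        (1 * levySymbol μ ((2 * Real.pi) • v)) r :=
      (Complex.ofRealCLM.hasDerivAt (x := r)).mul_const _
    refine h7.cexp.congr_deriv ?_
    rw [heatSymbol, one_mul, mul_comm]
  have h8 : ∫ r in (0 : ℝ)..t, levySymbol μ ((2 * Real.pi) • v) * heatSymbol μ r v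
      = heatSymbol μ t v - 1 := by
    rw [intervalIntegral.integral_eq_sub_of_hasDerivAt (fun r _ => h6 r)
      ((Continuous.mul continuous_const
        (hsymb.comp (by fun_prop : Continuous fun r : ℝ => (r, v)))).intervalIntegrable _ _)]
    simp [heatSymbol]
  simp only [hf, hp, mul_assoc]
  rw [intervalIntegral.integral_const_mul, intervalIntegral.integral_const_mul, h8]
  ring

/-- `φ` satisfies the integrated heat equation `P_t φ - φ = ∫₀ᵗ P_r L φ dr` on `(0,T)`. -/
def SolvesHeat (μ : Measure (Rd d)) (T : ℝ) (φ : Rd d → ℝ) : Prop :=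
  ∀ t ∈ Ioo 0 T, ∀ x, heatOp (heatKer μ T) t φ x - φ x
    = ∫ r in (0 : ℝ)..t, heatOp (heatKer μ T) r (levyOp μ φ) x

theorem HeatKernelBounds.solvesHeat_fourierRe (hK : HeatKernelBounds μ σ T 𝒦)
    (h : LevyCondition μ Λ) {g : Rd d → ℂ} (hg : StronglyMeasurable g)
    (hi : Integrable fun v => (1 + ‖v‖ ^ 2) * ‖g v‖) : SolvesHeat μ T (fourierRe g) := by
  intro t ht x
  have hgi : Integrable g := hi.mono hg.aestronglyMeasurable (ae_of_all _ fun v => by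
    rw [norm_mul, norm_norm, Real.norm_of_nonneg (by positivity)]
    nlinarith [norm_nonneg (g v), mul_nonneg (sq_nonneg ‖v‖) (norm_nonneg (g v))])
  rw [hK.heatOp_fourierRe h hgi ht, h.fourierRe_heatSymbol_sub hg hi ht.1.le,
    intervalIntegral.integral_of_le ht.1.le, intervalIntegral.integral_of_le ht.1.le]
  refine setIntegral_congr_fun measurableSet_Ioc fun r hr => ?_
  have hL : levyOp μ (fourierRe g)
      = fourierRe fun v => g v * levySymbol μ ((2 * Real.pi) • v) :=
    funext (h.levyOp_fourierRe hg hi)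
  simp only [hL]
  rw [hK.heatOp_fourierRe h (h.integrable_mul_levySymbol hg hi) ⟨hr.1, hr.2.trans_lt ht.2⟩]

/-- A test function is the inverse Fourier transform of a Schwartz function. -/
theorem HeatKernelBounds.solvesHeat_of_hasCompactSupport (hK : HeatKernelBounds μ σ T 𝒦)
    (h : LevyCondition μ Λ) {φ : Rd d → ℝ} (hφ : ContDiff ℝ ∞ φ) (hs : HasCompactSupport φ) :
    SolvesHeat μ T φ := by
  have hs' : HasCompactSupport fun x => (φ x : ℂ) := hs.comp_left Complex.ofReal_zero
  have hφ' : ContDiff ℝ ∞ fun x => (φ x : ℂ) := Complex.ofRealCLM.contDiff.comp hφ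
  set f : SchwartzMap (Rd d) ℂ := hs'.toSchwartzMap hφ' with hf
  have hfx : ∀ x, f x = (φ x : ℂ) := fun x => rfl
  have h1 : φ = fourierRe (𝓕 f : SchwartzMap (Rd d) ℂ) := by
    ext x
    have h2 := congrFun (Continuous.fourierInv_fourier_eq (f := (f : Rd d → ℂ)) f.continuous
      f.integrable (by rw [← SchwartzMap.fourier_coe]; exact (𝓕 f).integrable)) x
    rw [Real.fourierInv_eq', hfx] at h2
    rw [fourierRe, ← Complex.ofReal_re (φ x), ← h2]
    rfl
  rw [h1]
  refine hK.solvesHeat_fourierRe h (𝓕 f).continuous.stronglyMeasurable ?_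
  have h0 := (𝓕 f).integrable_pow_mul volume 0
  have h2 := (𝓕 f).integrable_pow_mul volume 2
  refine (h0.add h2).congr (ae_of_all _ fun v => ?_)
  simp only [Pi.add_apply, pow_zero]
  ring

end Generator

/-! ### Functions with a bounded Lipschitz derivative -/

section LipschitzDeriv

variable {d : ℕ} {μ : Measure (Rd d)} {Λ σ T : ℝ} {𝒦 : ℕ → ℝ → ℝ}

/-- `φ` is bounded by `b` and has the derivative `φ'`, which is bounded by `b` and `b`-Lipschitz. -/
structure HasLipschitzDeriv (b : ℝ) (φ : Rd d → ℝ) (φ' : Rd d → Rd d →L[ℝ] ℝ) : Prop where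
  hasFDerivAt : ∀ x, HasFDerivAt φ (φ' x) x
  bound : ∀ x, |φ x| ≤ b
  bound' : ∀ x, ‖φ' x‖ ≤ b
  lipschitz : ∀ x y, ‖φ' x - φ' y‖ ≤ b * ‖x - y‖

namespace HasLipschitzDeriv

variable {b : ℝ} {φ : Rd d → ℝ} {φ' : Rd d → Rd d →L[ℝ] ℝ}

theorem nonneg (h : HasLipschitzDeriv b φ φ') : 0 ≤ b := (abs_nonneg _).trans (h.bound 0)

theorem continuous (h : HasLipschitzDeriv b φ φ') : Continuous φ :=
  continuous_iff_continuousAt.2 fun x => (h.hasFDerivAt x).continuousAt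

theorem continuous' (h : HasLipschitzDeriv b φ φ') : Continuous φ' :=
  (LipschitzWith.of_dist_le_mul (K := b.toNNReal) fun x y => by
    rw [dist_eq_norm, dist_eq_norm, Real.coe_toNNReal _ h.nonneg]
    exact h.lipschitz x y).continuous

theorem fderiv_eq (h : HasLipschitzDeriv b φ φ') : fderiv ℝ φ = φ' :=
  funext fun x => (h.hasFDerivAt x).fderiv

theorem abs_sub_le (h : HasLipschitzDeriv b φ φ') (x y : Rd d) : |φ x - φ y| ≤ b * ‖x - y‖ :=
  norm_sub_le_of_hasFDerivAt h.hasFDerivAt h.bound' x y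

theorem add (h : HasLipschitzDeriv b φ φ') {c : ℝ} {ψ : Rd d → ℝ} {ψ' : Rd d → Rd d →L[ℝ] ℝ}
    (hψ : HasLipschitzDeriv c ψ ψ') :
    HasLipschitzDeriv (b + c) (fun x => φ x + ψ x) (fun x => φ' x + ψ' x) where
  hasFDerivAt x := (h.hasFDerivAt x).fun_add (hψ.hasFDerivAt x)
  bound x := (abs_add_le _ _).trans (add_le_add (h.bound x) (hψ.bound x))
  bound' x := (norm_add_le _ _).trans (add_le_add (h.bound' x) (hψ.bound' x))
  lipschitz x y := by
    rw [add_sub_add_comm, add_mul]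
    exact (norm_add_le _ _).trans (add_le_add (h.lipschitz x y) (hψ.lipschitz x y))

theorem integrable_levyIntegrand (h : HasLipschitzDeriv b φ φ') (hμ : LevyCondition μ Λ)
    (x : Rd d) : Integrable (levyIntegrand φ (φ' x) x) μ :=
  hμ.integrable_levyIntegrand h.continuous.measurable h.bound (fun y _ => h.hasFDerivAt y)
    h.nonneg (fun y _ => h.lipschitz y x)

theorem levyOp_add (h : HasLipschitzDeriv b φ φ') (hμ : LevyCondition μ Λ) {c : ℝ}
    {ψ : Rd d → ℝ} {ψ' : Rd d → Rd d →L[ℝ] ℝ} (hψ : HasLipschitzDeriv c ψ ψ') (x : Rd d) :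
    levyOp μ (fun x => φ x + ψ x) x = levyOp μ φ x + levyOp μ ψ x := by
  rw [levyOp_eq, levyOp_eq, levyOp_eq, ((h.add hψ).hasFDerivAt x).fderiv, h.fderiv_eq,
    hψ.fderiv_eq, ← integral_add (h.integrable_levyIntegrand hμ x)
      (hψ.integrable_levyIntegrand hμ x)]
  refine integral_congr_ae (ae_of_all _ fun z => ?_)
  simp only [levyIntegrand]
  by_cases hz : z ∈ ball (0 : Rd d) 1
  · simp only [indicator_of_mem hz, _root_.add_apply]
    ring
  · simp only [indicator_of_notMem hz]
    ring

theorem abs_levyOp_le (h : HasLipschitzDeriv b φ φ') (hμ : LevyCondition μ Λ) (x : Rd d) :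
    |levyOp μ φ x| ≤ 3 * b * max Λ 0 :=
  (hμ.abs_levyOp_le h.bound h.hasFDerivAt h.nonneg (fun x y => h.lipschitz y x) x).trans
    (le_of_eq (by ring))

theorem levyOp_const_mul_translate (h : HasLipschitzDeriv b φ φ') (c : ℝ) (x y : Rd d) :
    levyOp μ (fun x => c * φ (x - y)) x = c * levyOp μ φ (x - y) := by
  have h1 : HasFDerivAt (fun x => c * φ (x - y)) (c • φ' (x - y)) x :=
    ((hasFDerivAt_comp_sub (f := φ) y).2 (h.hasFDerivAt (x - y))).const_mul c
  rw [levyOp_eq, levyOp_eq, h1.fderiv, h.fderiv_eq, ← integral_const_mul]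
  refine integral_congr_ae (ae_of_all _ fun z => ?_)
  simp only [levyIntegrand]
  rw [show x + z - y = x - y + z by abel]
  by_cases hz : z ∈ ball (0 : Rd d) 1
  · simp only [indicator_of_mem hz, _root_.smul_apply, smul_eq_mul]
    ring
  · simp only [indicator_of_notMem hz]
    ring

/-- Averages of translates keep the bounds. -/
theorem average (h : HasLipschitzDeriv b φ φ') {ρ : Rd d → ℝ} (hi : Integrable ρ)
    (h0 : ∀ y, 0 ≤ ρ y) (h1 : ∫ y, ρ y ≤ 1) :
    HasLipschitzDeriv b (fun x => ∫ y, ρ y • φ (x - y)) (fun x => ∫ y, ρ y • φ' (x - y)) := by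
  have i0 : ∀ x, Integrable fun y => ρ y • φ (x - y) := fun x => by
    refine (hi.mul_const b).mono' (hi.aestronglyMeasurable.smul
      (h.continuous.comp (by fun_prop)).aestronglyMeasurable) (ae_of_all _ fun y => ?_)
    rw [norm_smul, Real.norm_of_nonneg (h0 y)]
    exact mul_le_mul_of_nonneg_left (h.bound _) (h0 y)
  have i1 : ∀ x, Integrable fun y => ρ y • φ' (x - y) := fun x => by
    refine (hi.mul_const b).mono' (hi.aestronglyMeasurable.smul
      (h.continuous'.comp (by fun_prop)).aestronglyMeasurable) (ae_of_all _ fun y => ?_)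
    rw [norm_smul, Real.norm_of_nonneg (h0 y)]
    exact mul_le_mul_of_nonneg_left (h.bound' _) (h0 y)
  have key : ∀ {F : Type} [NormedAddCommGroup F] [NormedSpace ℝ F] (f : Rd d → F) (c : ℝ),
      0 ≤ c → (∀ y, ‖f y‖ ≤ c) → ‖∫ y, ρ y • f y‖ ≤ c := fun f c hc hf => by
    refine (norm_integral_le_of_norm_le (hi.mul_const c) (ae_of_all _ fun y => ?_)).trans ?_
    · rw [norm_smul, Real.norm_of_nonneg (h0 y)]
      exact mul_le_mul_of_nonneg_left (hf y) (h0 y)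
    · rw [integral_mul_const]
      exact mul_le_of_le_one_left hc h1
  refine ⟨fun x => ?_, fun x => by
    rw [← Real.norm_eq_abs]; exact key (fun y => φ (x - y)) b h.nonneg fun y => h.bound _,
    fun x => key _ b h.nonneg fun y => h.bound' _, fun x y => ?_⟩
  · refine hasFDerivAt_integral_of_dominated_of_fderiv_le (F := fun x y => ρ y • φ (x - y))
      (F' := fun x y => ρ y • φ' (x - y)) (bound := fun y => ρ y * b) univ_mem
      (Eventually.of_forall fun x => (i0 x).aestronglyMeasurable) (i0 x)
      (i1 x).aestronglyMeasurable (ae_of_all _ fun y z _ => ?_) (hi.mul_const b)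
      (ae_of_all _ fun y z _ => ?_)
    · rw [norm_smul, Real.norm_of_nonneg (h0 y)]
      exact mul_le_mul_of_nonneg_left (h.bound' _) (h0 y)
    · exact ((hasFDerivAt_comp_sub (f := φ) y).2 (h.hasFDerivAt (z - y))).const_smul (ρ y)
  · rw [← integral_sub (i1 x) (i1 y)]
    rw [integral_congr_ae (ae_of_all _ fun z => (smul_sub (ρ z) (φ' (x - z)) (φ' (y - z))).symm)]
    refine key (fun z => φ' (x - z) - φ' (y - z)) _ (mul_nonneg h.nonneg (norm_nonneg _))
      fun z => ?_
    refine (h.lipschitz _ _).trans (le_of_eq ?_)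
    congr 2
    abel

/-- Cutting off at scale `1 / r ≥ 1` keeps the bounds up to a constant that is independent
of `r`. -/
theorem cutoff (h : HasLipschitzDeriv b φ φ') {C : ℝ} (hC : 0 ≤ C) {χ : Rd d → ℝ}
    (hχ : ContDiff ℝ 2 χ) (h01 : ∀ y, 0 ≤ χ y ∧ χ y ≤ 1) (h1 : ∀ y, ‖fderiv ℝ χ y‖ ≤ C)
    (h2 : ∀ y z, ‖fderiv ℝ χ y - fderiv ℝ χ z‖ ≤ C * ‖y - z‖) {r : ℝ} (hr : r ∈ Icc (0 : ℝ) 1) :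
    HasLipschitzDeriv (b * (1 + 3 * C)) (fun x => χ (r • x) * φ x)
      (fun x => χ (r • x) • φ' x + φ x • (r • fderiv ℝ χ (r • x))) := by
  have hb := h.nonneg
  have hr0 := hr.1
  have hd : ∀ x, HasFDerivAt (fun x : Rd d => χ (r • x)) (r • fderiv ℝ χ (r • x)) x := fun x => by
    have h3 := ((hχ.differentiable two_ne_zero) (r • x)).hasFDerivAt.comp x
      ((hasFDerivAt_id x).const_smul r)
    refine h3.congr_fderiv ?_
    ext v
    simp
  have hχ1 : ∀ x, |χ x| ≤ 1 := fun x => abs_le.2 ⟨by linarith [(h01 x).1], (h01 x).2⟩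
  have hd1 : ∀ x, ‖r • fderiv ℝ χ (r • x)‖ ≤ C := fun x => by
    rw [norm_smul, Real.norm_of_nonneg hr0]
    exact (mul_le_of_le_one_left (norm_nonneg _) hr.2).trans (h1 _)
  have hd2 : ∀ x y, ‖r • fderiv ℝ χ (r • x) - r • fderiv ℝ χ (r • y)‖ ≤ C * ‖x - y‖ :=
    fun x y => by
    rw [← smul_sub, norm_smul, Real.norm_of_nonneg hr0]
    refine (mul_le_of_le_one_left (norm_nonneg _) hr.2).trans ((h2 _ _).trans ?_)
    rw [← smul_sub, norm_smul, Real.norm_of_nonneg hr0]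
    gcongr
    exact mul_le_of_le_one_left (norm_nonneg _) hr.2
  have hχl : ∀ x y : Rd d, |χ (r • x) - χ (r • y)| ≤ C * ‖x - y‖ :=
    norm_sub_le_of_hasFDerivAt hd hd1
  refine ⟨fun x => ?_, fun x => ?_, fun x => ?_, fun x y => ?_⟩
  · exact (hd x).mul (h.hasFDerivAt x)
  · rw [abs_mul]
    calc |χ (r • x)| * |φ x| ≤ 1 * b := by gcongr; exacts [hχ1 _, h.bound x]
      _ ≤ b * (1 + 3 * C) := by nlinarith [mul_nonneg hb hC]
  · calc ‖χ (r • x) • φ' x + φ x • (r • fderiv ℝ χ (r • x))‖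
        ≤ |χ (r • x)| * ‖φ' x‖ + |φ x| * ‖r • fderiv ℝ χ (r • x)‖ := by
          refine (norm_add_le _ _).trans (le_of_eq ?_)
          rw [norm_smul, norm_smul (φ x), Real.norm_eq_abs, Real.norm_eq_abs]
      _ ≤ 1 * b + b * C := by gcongr; exacts [hχ1 _, h.bound' x, h.bound x, hd1 x]
      _ ≤ b * (1 + 3 * C) := by nlinarith [mul_nonneg hb hC]
  · have e : ∀ (p q s u : ℝ) (A B D G : Rd d →L[ℝ] ℝ), (p • A + s • D) - (q • B + u • G)
        = (p • (A - B) + (p - q) • B) + (s • (D - G) + (s - u) • G) := by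
      intros; module
    rw [e]
    calc _ ≤ (|χ (r • x)| * ‖φ' x - φ' y‖ + |χ (r • x) - χ (r • y)| * ‖φ' y‖)
          + (|φ x| * ‖r • fderiv ℝ χ (r • x) - r • fderiv ℝ χ (r • y)‖
            + |φ x - φ y| * ‖r • fderiv ℝ χ (r • y)‖) := by
          simp only [← Real.norm_eq_abs, ← norm_smul]
          exact (norm_add_le _ _).trans (add_le_add (norm_add_le _ _) (norm_add_le _ _))
      _ ≤ (1 * (b * ‖x - y‖) + (C * ‖x - y‖) * b)
          + (b * (C * ‖x - y‖) + (b * ‖x - y‖) * C) := by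
          gcongr
          exacts [hχ1 _, h.lipschitz x y, hχl x y, h.bound' y, h.bound x, hd2 x y,
            h.abs_sub_le x y, hd1 y]
      _ = b * (1 + 3 * C) * ‖x - y‖ := by ring

/-- Functions with bounded Lipschitz derivative are limits of test functions, with uniform
bounds. -/
theorem exists_approx (h : HasLipschitzDeriv b φ φ') :
    ∃ (c : ℝ) (f : ℕ → Rd d → ℝ) (f' : ℕ → Rd d → Rd d →L[ℝ] ℝ),
      (∀ n, HasLipschitzDeriv c (f n) (f' n)) ∧ (∀ n, ContDiff ℝ ∞ (f n)) ∧
      (∀ n, HasCompactSupport (f n)) ∧ (∀ x, Tendsto (fun n => f n x) atTop (𝓝 (φ x))) ∧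
      ∀ x, Tendsto (fun n => f' n x) atTop (𝓝 (φ' x)) := by
  obtain ⟨χ, C, hC, hχ, hχ0, hχ1, hχ2, hχ3, hχ4⟩ := exists_bump d
  -- cut off at the scale `1 / r`, then mollify at the scale `r`
  set r : ℕ → ℝ := fun n => 1 / ((n : ℝ) + 1) with hr
  have hr0 : ∀ n, 0 < r n := fun n => by simp only [hr]; positivity
  have hr1 : ∀ n, r n ≤ 1 := fun n => by
    simp only [hr]; rw [div_le_one (by positivity)]; linarith [(Nat.cast_nonneg n : (0 : ℝ) ≤ n)]
  have hrt : Tendsto r atTop (𝓝 0) := tendsto_one_div_add_atTop_nhds_zero_nat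
  set c := b * (1 + 3 * C) with hc
  set ψ : ℕ → Rd d → ℝ := fun n x => χ (r n • x) * φ x with hψ
  set ψ' : ℕ → Rd d → Rd d →L[ℝ] ℝ :=
    fun n x => χ (r n • x) • φ' x + φ x • (r n • fderiv ℝ χ (r n • x)) with hψ'
  have hψl : ∀ n, HasLipschitzDeriv c (ψ n) (ψ' n) := fun n =>
    h.cutoff hC hχ hχ1 hχ3 hχ4 ⟨(hr0 n).le, hr1 n⟩
  let ρ : ℕ → ContDiffBump (0 : Rd d) := fun n =>
    ⟨r n / 2, r n, half_pos (hr0 n), half_lt_self (hr0 n)⟩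
  set f : ℕ → Rd d → ℝ := fun n x => ∫ y, (ρ n).normed volume y • ψ n (x - y) with hf
  set f' : ℕ → Rd d → Rd d →L[ℝ] ℝ :=
    fun n x => ∫ y, (ρ n).normed volume y • ψ' n (x - y) with hf'
  have hfl : ∀ n, HasLipschitzDeriv c (f n) (f' n) := fun n =>
    (hψl n).average (ρ n).integrable_normed (fun y => (ρ n).nonneg_normed y)
      (ρ n).integral_normed.le
  have hs : ∀ n, HasCompactSupport (ψ n) := fun n => by
    refine HasCompactSupport.intro (isCompact_closedBall (0 : Rd d) (2 / r n)) fun x hx => ?_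
    have h3 : 2 ≤ ‖r n • x‖ := by
      rw [norm_smul, Real.norm_of_nonneg (hr0 n).le]
      have : 2 / r n < ‖x‖ := by simpa using hx
      rw [div_lt_iff₀ (hr0 n)] at this
      linarith
    simp only [hψ, hχ2 _ h3, zero_mul]
  have hconv : ∀ n, f n = (convolution ((ρ n).normed volume) (ψ n)
      (ContinuousLinearMap.lsmul ℝ ℝ) volume) := fun n => rfl
  have hconv' : ∀ n, f' n = (convolution ((ρ n).normed volume) (ψ' n)
      (ContinuousLinearMap.lsmul ℝ ℝ) volume) := fun n => rfl
  refine ⟨c, f, f', hfl, fun n => ?_, fun n => ?_, fun x => ?_, fun x => ?_⟩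
  · rw [hconv]
    exact (ρ n).hasCompactSupport_normed.contDiff_convolution_left _ (ρ n).contDiff_normed
      (hψl n).continuous.locallyIntegrable
  · rw [hconv]
    exact (ρ n).hasCompactSupport_normed.convolution _ (hs n)
  · have h1 : Tendsto (fun n => ψ n x) atTop (𝓝 (φ x)) := by
      have h2 : Tendsto (fun n => χ (r n • x)) atTop (𝓝 (χ ((0 : ℝ) • x))) :=
        (hχ.continuous.tendsto _).comp (hrt.smul_const x)
      rw [zero_smul, hχ0] at h2
      simpa using h2.mul_const (φ x)
    have h3 : Tendsto (fun n => c * r n) atTop (𝓝 0) := by simpa using hrt.const_mul c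
    have h4 : ∀ n, dist (f n x) (ψ n x) ≤ c * r n := fun n => by
      rw [hconv]
      refine (ρ n).dist_normed_convolution_le (hψl n).continuous.aestronglyMeasurable fun y hy => ?_
      rw [dist_eq_norm]
      refine ((hψl n).abs_sub_le y x).trans ?_
      rw [← dist_eq_norm]
      exact mul_le_mul_of_nonneg_left (le_of_lt hy) (hψl n).nonneg
    have h5 : Tendsto (fun n => dist (f n x) (ψ n x)) atTop (𝓝 0) :=
      squeeze_zero (fun _ => dist_nonneg) h4 h3
    exact (tendsto_iff_of_dist h5).2 h1
  · have h1 : Tendsto (fun n => ψ' n x) atTop (𝓝 (φ' x)) := by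
      have h2 : Tendsto (fun n => χ (r n • x)) atTop (𝓝 (χ ((0 : ℝ) • x))) :=
        (hχ.continuous.tendsto _).comp (hrt.smul_const x)
      rw [zero_smul, hχ0] at h2
      have h6 : Tendsto (fun n => fderiv ℝ χ (r n • x)) atTop (𝓝 (fderiv ℝ χ ((0 : ℝ) • x))) :=
        ((hχ.continuous_fderiv two_ne_zero).tendsto _).comp (hrt.smul_const x)
      simpa using (h2.smul_const (φ' x)).add ((hrt.smul h6).const_smul (φ x))
    have h3 : Tendsto (fun n => c * r n) atTop (𝓝 0) := by simpa using hrt.const_mul c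
    have h4 : ∀ n, dist (f' n x) (ψ' n x) ≤ c * r n := fun n => by
      rw [hconv']
      refine (ρ n).dist_normed_convolution_le (hψl n).continuous'.aestronglyMeasurable
        fun y hy => ?_
      rw [dist_eq_norm]
      refine ((hψl n).lipschitz y x).trans ?_
      rw [← dist_eq_norm]
      exact mul_le_mul_of_nonneg_left (le_of_lt hy) (hψl n).nonneg
    have h5 : Tendsto (fun n => dist (f' n x) (ψ' n x)) atTop (𝓝 0) :=
      squeeze_zero (fun _ => dist_nonneg) h4 h3
    exact (tendsto_iff_of_dist h5).2 h1

end HasLipschitzDeriv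

theorem LevyCondition.stronglyMeasurable_levyOp (h : LevyCondition μ Λ) {Ω : Type*}
    [MeasurableSpace Ω] {G : Ω → Rd d → ℝ} {G' : Ω → Rd d → Rd d →L[ℝ] ℝ}
    (hG : StronglyMeasurable fun p : Ω × Rd d => G p.1 p.2)
    (hG' : StronglyMeasurable fun p : Ω × Rd d => G' p.1 p.2)
    (hd : ∀ s x, HasFDerivAt (G s) (G' s x) x) :
    StronglyMeasurable fun p : Ω × Rd d => levyOp μ (G p.1) p.2 := by
  have := h.sFinite
  simp only [levyOp_eq, (hd _ _).fderiv]
  refine StronglyMeasurable.integral_prod_right'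
    (f := fun p : (Ω × Rd d) × Rd d => levyIntegrand (G p.1.1) (G' p.1.1 p.1.2) p.1.2 p.2) ?_
  unfold levyIntegrand
  refine ((hG.comp_measurable (g := fun p : (Ω × Rd d) × Rd d => (p.1.1, p.1.2 + p.2))
    (by fun_prop)).sub (hG.comp_measurable measurable_fst)).sub ?_
  have h1 : (fun p : (Ω × Rd d) × Rd d =>
      (ball (0 : Rd d) 1).indicator (fun z => G' p.1.1 p.1.2 z) p.2)
      = (univ ×ˢ ball (0 : Rd d) 1).indicator
        (fun p : (Ω × Rd d) × Rd d => G' p.1.1 p.1.2 p.2) := by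
    ext p; by_cases hp : p.2 ∈ ball (0 : Rd d) 1 <;> simp [indicator, hp]
  have h2 : StronglyMeasurable (fun p : (Ω × Rd d) × Rd d => G' p.1.1 p.1.2 p.2) :=
    (isBoundedBilinearMap_apply (𝕜 := ℝ) (E := Rd d) (F := ℝ)).continuous.comp_stronglyMeasurable
      ((hG'.comp_measurable measurable_fst).prodMk measurable_snd.stronglyMeasurable)
  change StronglyMeasurable (fun p : (Ω × Rd d) × Rd d =>
      (ball (0 : Rd d) 1).indicator (fun z => G' p.1.1 p.1.2 z) p.2)
  rw [h1]
  exact h2.indicator (MeasurableSet.univ.prod measurableSet_ball)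

theorem HasLipschitzDeriv.stronglyMeasurable_levyOp {b : ℝ} {φ : Rd d → ℝ}
    {φ' : Rd d → Rd d →L[ℝ] ℝ} (hφ : HasLipschitzDeriv b φ φ') (h : LevyCondition μ Λ) :
    StronglyMeasurable (levyOp μ φ) :=
  (h.stronglyMeasurable_levyOp (Ω := Unit) (G := fun _ => φ) (G' := fun _ => φ')
    (hφ.continuous.stronglyMeasurable.comp_measurable measurable_snd)
    (hφ.continuous'.stronglyMeasurable.comp_measurable measurable_snd)
    (fun _ => hφ.hasFDerivAt)).comp_measurable (g := fun x => ((), x)) (by fun_prop)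

end LipschitzDeriv

/-! ### The time derivative of mild solutions -/

section Mild

variable {d : ℕ} {μ : Measure (Rd d)} {Λ σ T : ℝ} {𝒦 : ℕ → ℝ → ℝ}

theorem IsHeatKernel.tendsto_heatOp {E F : Type*} [NormedAddCommGroup E] [NormedSpace ℝ E]
    [FiniteDimensional ℝ E] [MeasureSpace E] [BorelSpace E]
    [(volume : Measure E).IsAddHaarMeasure] [NormedAddCommGroup F] [NormedSpace ℝ F]
    [CompleteSpace F] {T a C : ℝ} {k : ℝ → E → ℝ} (hk : IsHeatKernel T a C k)
    {f : ℕ → E → F} {φ : E → F} {b : ℝ} (hf : ∀ n, StronglyMeasurable (f n))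
    (hb : ∀ n x, ‖f n x‖ ≤ b) (h : ∀ x, Tendsto (fun n => f n x) atTop (𝓝 (φ x))) (t : ℝ)
    (x : E) : Tendsto (fun n => heatOp k t (f n) x) atTop (𝓝 (heatOp k t φ x)) := by
  refine tendsto_integral_of_dominated_convergence (fun y => k t y * b)
    (fun n => (hk.integrable_smul t x (hf n) (hb n)).aestronglyMeasurable)
    ((hk.integrable t).mul_const b) (fun n => ae_of_all _ fun y => ?_)
    (ae_of_all _ fun y => (h _).const_smul _)
  rw [norm_smul, Real.norm_of_nonneg (hk.nonneg t y)]
  exact mul_le_mul_of_nonneg_left (hb n _) (hk.nonneg t y)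

theorem IsHeatKernel.stronglyMeasurable_heatOp_time {E F : Type*} [NormedAddCommGroup E]
    [NormedSpace ℝ E]
    [FiniteDimensional ℝ E] [MeasureSpace E] [BorelSpace E]
    [(volume : Measure E).IsAddHaarMeasure] [NormedAddCommGroup F] [NormedSpace ℝ F]
    [CompleteSpace F] {T a C : ℝ} {k : ℝ → E → ℝ} (hk : IsHeatKernel T a C k) {φ : E → F}
    (hφ : StronglyMeasurable φ) :
    StronglyMeasurable fun q : ℝ × E => heatOp k q.1 φ q.2 := by
  have h := (hk.stronglyMeasurable_heatOp (g := fun _ => φ)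
    (hφ.comp_measurable measurable_snd)).comp_measurable
    (g := fun q : ℝ × E => ((q.1, (0 : ℝ)), q.2)) (by fun_prop)
  refine (congrArg StronglyMeasurable (funext fun q => ?_)).mp h
  simp

namespace HasLipschitzDeriv

variable {b : ℝ} {φ : Rd d → ℝ} {φ' : Rd d → Rd d →L[ℝ] ℝ}

/-- The integrated heat equation passes from test functions to the limit, by the continuity of
`L` and of the heat operator under bounded pointwise convergence. -/
theorem solvesHeat (h : HasLipschitzDeriv b φ φ') (hK : HeatKernelBounds μ σ T 𝒦)
    (hμ : LevyCondition μ Λ) : SolvesHeat μ T φ := by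
  intro t ht x
  have hk := hK.isHeatKernel hμ
  obtain ⟨c, f, f', hf, hfs, hfc, h0, h1⟩ := h.exists_approx
  have hL : ∀ x, Tendsto (fun n => levyOp μ (f n) x) atTop (𝓝 (levyOp μ φ x)) := fun x =>
    hμ.tendsto_levyOp (fun n => (hf n).bound) (fun n => (hf n).hasFDerivAt) (hf 0).nonneg
      (fun n x y => (hf n).lipschitz y x) (h.hasFDerivAt x) h0 (h1 x)
  have hLm : ∀ n, StronglyMeasurable (levyOp μ (f n)) := fun n =>
    (hf n).stronglyMeasurable_levyOp hμ
  have hLb : ∀ n x, ‖levyOp μ (f n) x‖ ≤ 3 * c * max Λ 0 := fun n x => (hf n).abs_levyOp_le hμ x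
  have l1 : Tendsto (fun n => heatOp (heatKer μ T) t (f n) x - f n x) atTop
      (𝓝 (heatOp (heatKer μ T) t φ x - φ x)) :=
    (hk.tendsto_heatOp (fun n => (hf n).continuous.stronglyMeasurable) (fun n => (hf n).bound)
      h0 t x).sub (h0 x)
  have l2 : Tendsto (fun n => ∫ r in (0 : ℝ)..t, heatOp (heatKer μ T) r (levyOp μ (f n)) x) atTop
      (𝓝 (∫ r in (0 : ℝ)..t, heatOp (heatKer μ T) r (levyOp μ φ) x)) := by
    refine intervalIntegral.tendsto_integral_filter_of_dominated_convergence
      (fun _ => 3 * c * max Λ 0) (Eventually.of_forall fun n =>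
        ((hk.stronglyMeasurable_heatOp_time (hLm n)).comp_measurable
          (g := fun r : ℝ => (r, x)) (by fun_prop)).aestronglyMeasurable)
      (Eventually.of_forall fun n => ae_of_all _ fun r _ => hk.norm_heatOp_le r x (hLb n))
      intervalIntegrable_const (ae_of_all _ fun r _ => hk.tendsto_heatOp hLm hLb hL r x)
  refine tendsto_nhds_unique l1 (l2.congr fun n => ?_)
  exact (hK.solvesHeat_of_hasCompactSupport hμ (hfs n) (hfc n) t ht x).symm

theorem heatOp (h : HasLipschitzDeriv b φ φ') {a C : ℝ} {k : ℝ → Rd d → ℝ}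
    (hk : IsHeatKernel T a C k) (t : ℝ) :
    HasLipschitzDeriv b (heatOp k t φ) (_root_.heatOp k t φ') :=
  h.average (hk.integrable t) (hk.nonneg t) (hk.integral_le_one t)

/-- The Lévy operator commutes with the heat operator, as it is linear and commutes with
translations. -/
theorem levyOp_heatOp (h : HasLipschitzDeriv b φ φ') (hμ : LevyCondition μ Λ) {a C : ℝ}
    {k : ℝ → Rd d → ℝ} (hk : IsHeatKernel T a C k) (t : ℝ) (x : Rd d) :
    levyOp μ (_root_.heatOp k t φ) x = _root_.heatOp k t (levyOp μ φ) x := by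
  have hm : ∀ y, HasLipschitzDeriv (k t y * b) (fun x => k t y • φ (x - y))
      (fun x => k t y • φ' (x - y)) := fun y => by
    have h0 := hk.nonneg t y
    refine ⟨fun x => ((hasFDerivAt_comp_sub (f := φ) y).2 (h.hasFDerivAt (x - y))).fun_const_smul _,
      fun x => ?_, fun x => ?_, fun x z => ?_⟩
    · rw [smul_eq_mul, abs_mul, abs_of_nonneg h0]
      exact mul_le_mul_of_nonneg_left (h.bound _) h0
    · rw [norm_smul, Real.norm_of_nonneg h0]
      exact mul_le_mul_of_nonneg_left (h.bound' _) h0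
    · rw [show k t y • φ' (x - y) - k t y • φ' (z - y) = k t y • (φ' (x - y) - φ' (z - y)) from
        (smul_sub _ _ _).symm, norm_smul, Real.norm_of_nonneg h0, mul_assoc]
      refine mul_le_mul_of_nonneg_left ((h.lipschitz _ _).trans (le_of_eq ?_)) h0
      rw [sub_sub_sub_cancel_right]
  have hkm : StronglyMeasurable (k t) := (hk.contDiff t).continuous.stronglyMeasurable
  have h1 := (hμ.levyOp_integral (Ω := Rd d) (m := volume)
    (F := fun y x => k t y • φ (x - y)) (F' := fun y x => k t y • φ' (x - y))
    (b := fun y => k t y * b) (x := x) ((hk.integrable t).mul_const b)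
    ((hkm.comp_measurable measurable_fst).smul
      (h.continuous.stronglyMeasurable.comp_measurable
        (g := fun p : Rd d × Rd d => p.2 - p.1) (by fun_prop)))
    (hkm.smul (h.continuous'.stronglyMeasurable.comp_measurable
        (g := fun y : Rd d => x - y) (by fun_prop)))
    (fun y => (hm y).bound) (hk.integrable_smul t x h.continuous'.stronglyMeasurable h.bound')
    (fun y => (hm y).hasFDerivAt) (fun y => (hm y).lipschitz)
    ((h.heatOp hk t).hasFDerivAt x)).1
  refine h1.trans (integral_congr_ae (ae_of_all _ fun y => ?_))
  exact h.levyOp_const_mul_translate (k t y) x y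

end HasLipschitzDeriv

/-- A bounded measurable source on `(0,T)` whose space derivative is bounded and Lipschitz. -/
structure IsC11Source (T b : ℝ) (g : ℝ → Rd d → ℝ) (g' : ℝ → Rd d → Rd d →L[ℝ] ℝ) : Prop where
  source : IsSource T b g
  source' : IsSource T b g'
  hasFDerivAt : ∀ t x, HasFDerivAt (g t) (g' t x) x
  lipschitz : ∀ t x y, ‖g' t x - g' t y‖ ≤ b * ‖x - y‖

namespace IsC11Source

variable {b : ℝ} {g : ℝ → Rd d → ℝ} {g' : ℝ → Rd d → Rd d →L[ℝ] ℝ}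

theorem hasLipschitzDeriv (h : IsC11Source T b g g') (t : ℝ) : HasLipschitzDeriv b (g t) (g' t) :=
  ⟨h.hasFDerivAt t, h.source.bound t, h.source'.bound t, h.lipschitz t⟩

theorem levyOp_zero {t : ℝ} (h : IsC11Source T b g g') (ht : t ∉ Ioo 0 T) :
    levyOp μ (g t) = 0 := by
  ext x
  rw [h.source.zero t ht, levyOp_eq]
  have : fderiv ℝ (0 : Rd d → ℝ) x = 0 := fderiv_const_apply _
  rw [this]
  simp [levyIntegrand]

theorem levyOp (h : IsC11Source T b g g') (hμ : LevyCondition μ Λ) :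
    IsSource T (3 * b * max Λ 0) fun t => levyOp μ (g t) where
  stronglyMeasurable := hμ.stronglyMeasurable_levyOp h.source.stronglyMeasurable
    h.source'.stronglyMeasurable h.hasFDerivAt
  zero _ ht := h.levyOp_zero ht
  bound t x := (h.hasLipschitzDeriv t).abs_levyOp_le hμ x

variable {a C : ℝ} {k : ℝ → Rd d → ℝ}

theorem hasLipschitzDeriv_duhamel (h : IsC11Source T b g g') (hk : IsHeatKernel T a C k) (t : ℝ) :
    HasLipschitzDeriv (max T 0 * b) (duhamel k g t) (duhamel k g' t) := by
  have hi : ∫ s, (Ioo 0 T).indicator (fun _ => b) s = max T 0 * b := by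
    rw [integral_indicator measurableSet_Ioo, setIntegral_const, smul_eq_mul,
      Real.volume_real_Ioo, sub_zero]
  have hii : ∀ c : ℝ, Integrable ((Ioo 0 T).indicator fun _ => c) := fun c =>
    (integrable_indicator_iff measurableSet_Ioo).2 (integrableOn_const (by simp))
  refine ⟨fun x => hk.hasFDerivAt_duhamel h.source h.source' h.hasFDerivAt t x, fun x => ?_,
    fun x => ?_, fun x y => ?_⟩
  · rw [← hi]
    exact norm_integral_le_of_norm_le (hii b) (ae_of_all _ fun s =>
      hk.norm_heatOp_source_le h.source t s x)
  · rw [← hi]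
    exact norm_integral_le_of_norm_le (hii b) (ae_of_all _ fun s =>
      hk.norm_heatOp_source_le h.source' t s x)
  · rw [← hi, duhamel, duhamel, ← integral_sub (hk.integrable_heatOp h.source' t x)
      (hk.integrable_heatOp h.source' t y), ← integral_mul_const]
    refine norm_integral_le_of_norm_le ((hii b).mul_const _) (ae_of_all _ fun s => ?_)
    by_cases hs : s ∈ Ioo 0 T
    · rw [indicator_of_mem hs]
      exact ((h.hasLipschitzDeriv s).heatOp hk (t - s)).lipschitz x y
    · rw [indicator_of_notMem hs, hk.heatOp_source_eq_zero h.source' hs,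
        hk.heatOp_source_eq_zero h.source' hs, zero_mul, sub_self, norm_zero]

theorem levyOp_duhamel (h : IsC11Source T b g g') (hμ : LevyCondition μ Λ)
    (hk : IsHeatKernel T a C k) (t : ℝ) (x : Rd d) :
    _root_.levyOp μ (duhamel k g t) x = duhamel k (fun s => _root_.levyOp μ (g s)) t x := by
  have h1 := (hμ.levyOp_integral (Ω := ℝ) (m := volume)
    (F := fun s x => heatOp k (t - s) (g s) x) (F' := fun s x => heatOp k (t - s) (g' s) x)
    (b := (Ioo 0 T).indicator fun _ => b) (x := x)
    ((integrable_indicator_iff measurableSet_Ioo).2 (integrableOn_const (by simp)))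
    ((hk.stronglyMeasurable_heatOp h.source.stronglyMeasurable).comp_measurable
      (g := fun p : ℝ × Rd d => ((t, p.1), p.2)) (by fun_prop))
    (hk.stronglyMeasurable_heatOp_left h.source'.stronglyMeasurable t x)
    (fun s y => hk.norm_heatOp_source_le h.source t s y) (hk.integrable_heatOp h.source' t x)
    (fun s => ((h.hasLipschitzDeriv s).heatOp hk (t - s)).hasFDerivAt) (fun s y z => ?_)
    (hk.hasFDerivAt_duhamel h.source h.source' h.hasFDerivAt t x)).1
  · refine h1.trans (integral_congr_ae (ae_of_all _ fun s => ?_))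
    exact (h.hasLipschitzDeriv s).levyOp_heatOp hμ hk (t - s) x
  · by_cases hs : s ∈ Ioo 0 T
    · rw [indicator_of_mem hs]
      exact ((h.hasLipschitzDeriv s).heatOp hk (t - s)).lipschitz y z
    · rw [indicator_of_notMem hs, hk.heatOp_source_eq_zero h.source' hs,
        hk.heatOp_source_eq_zero h.source' hs, zero_mul, sub_self, norm_zero]

/-- Duhamel's integral solves the inhomogeneous heat equation, in integrated form. -/
theorem duhamel_eq (h : IsC11Source T b g g') (hK : HeatKernelBounds μ σ T 𝒦)
    (hμ : LevyCondition μ Λ) {t : ℝ} (ht : t ∈ Ioo 0 T) (x : Rd d) :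
    duhamel (heatKer μ T) g t x
      = ∫ r in (0 : ℝ)..t,
        (g r x + duhamel (heatKer μ T) (fun s => _root_.levyOp μ (g s)) r x) := by
  have hk := hK.isHeatKernel hμ
  set k := heatKer μ T with hkdef
  have hL := h.levyOp hμ
  have hb0 := (h.hasLipschitzDeriv 0).nonneg
  set B := 3 * b * max Λ 0 with hB
  have hi : ∀ (S c : ℝ), Integrable ((Ioo 0 S).indicator fun _ => c) := fun S c =>
    (integrable_indicator_iff measurableSet_Ioo).2 (integrableOn_const (by simp))
  -- the full two-parameter integrand, which vanishes unless `0 < s < r`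
  have hint : Integrable (Function.uncurry fun (s r : ℝ) =>
      heatOp k (r - s) (_root_.levyOp μ (g s)) x) (volume.prod (volume.restrict (Ioc 0 t))) := by
    have h1 : Integrable (fun p : ℝ × ℝ => (Ioo 0 T).indicator (fun _ => B) p.1 * (1 : ℝ))
        (volume.prod (volume.restrict (Ioc 0 t))) :=
      (hi T B).mul_prod (integrable_const (1 : ℝ))
    refine h1.mono' ?_ (ae_of_all _ fun p => ?_)
    · exact ((hk.stronglyMeasurable_heatOp (g := fun s => _root_.levyOp μ (g s))
        hL.stronglyMeasurable).comp_measurable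
        (g := fun p : ℝ × ℝ => ((p.2, p.1), x)) (by fun_prop)).aestronglyMeasurable
    · rw [mul_one]; exact hk.norm_heatOp_source_le hL p.2 p.1 x
  have hgx : StronglyMeasurable fun s => g s x :=
    h.source.stronglyMeasurable.comp_measurable (g := fun s : ℝ => (s, x)) (by fun_prop)
  have hgi : Integrable fun s => (Ioc 0 t).indicator (fun s => g s x) s := by
    refine (integrable_indicator_iff measurableSet_Ioc).2
      (Integrable.mono' (integrable_const b) hgx.aestronglyMeasurable
        (ae_of_all _ fun s => h.source.bound s x))
  -- the integrated heat equation for each slice `g s`. At `s = t` the left-hand heat operator is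
  -- zero by convention, and the extra term restores the identity; this is a null set of times
  have key : ∀ s, heatOp k (t - s) (g s) x + (if s = t then g t x else 0)
      = (Ioc 0 t).indicator (fun s => g s x) s
        + ∫ r in Ioc 0 t, heatOp k (r - s) (_root_.levyOp μ (g s)) x := by
    intro s
    by_cases hs0 : 0 < s
    swap
    · have hs : s ∉ Ioo 0 T := fun h => hs0 h.1
      rw [hk.heatOp_source_eq_zero h.source hs, indicator_of_notMem fun h => hs0 h.1]
      simp only [hk.heatOp_source_eq_zero hL hs, integral_zero]
      rw [if_neg (fun h : s = t => hs0 (h ▸ ht.1))]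
    rcases lt_trichotomy s t with hst | hst | hst
    · have hts : t - s ∈ Ioo 0 T := ⟨sub_pos.2 hst, by linarith [ht.2]⟩
      have h2 := (h.hasLipschitzDeriv s).solvesHeat hK hμ (t - s) hts x
      rw [if_neg hst.ne, indicator_of_mem (show s ∈ Ioc 0 t from ⟨hs0, hst.le⟩), add_zero,
        ← sub_eq_iff_eq_add', h2, ← intervalIntegral.integral_of_le ht.1.le]
      have h3 := intervalIntegral.integral_comp_sub_right
        (fun r => heatOp k r (_root_.levyOp μ (g s)) x) s (a := s) (b := t)
      rw [sub_self] at h3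
      rw [← h3]
      have hii : ∀ u v : ℝ, IntervalIntegrable
          (fun r => heatOp k (r - s) (_root_.levyOp μ (g s)) x) volume u v := fun u v => by
        refine (intervalIntegrable_const (c := B)).mono_fun'
          ((hk.stronglyMeasurable_heatOp (g := fun s => _root_.levyOp μ (g s))
        hL.stronglyMeasurable).comp_measurable
            (g := fun r : ℝ => ((r, s), x)) (by fun_prop)).aestronglyMeasurable
          (ae_of_all _ fun r => hk.norm_heatOp_le _ _ (hL.bound s))
      rw [← intervalIntegral.integral_add_adjacent_intervals (hii 0 s) (hii s t)]
      have h4 : ∫ r in (0 : ℝ)..s, heatOp k (r - s) (_root_.levyOp μ (g s)) x = 0 := by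
        rw [intervalIntegral.integral_of_le hs0.le]
        refine setIntegral_eq_zero_of_forall_eq_zero fun r hr => ?_
        exact hk.heatOp_eq_zero (fun h => by linarith [h.1, hr.2]) _ _
      rw [h4, zero_add]
    · subst hst
      rw [if_pos rfl, sub_self, hk.heatOp_eq_zero (fun h => lt_irrefl _ h.1),
        indicator_of_mem (show s ∈ Ioc 0 s from ⟨hs0, le_rfl⟩), zero_add, left_eq_add]
      refine setIntegral_eq_zero_of_forall_eq_zero fun r hr => ?_
      exact hk.heatOp_eq_zero (fun h => by linarith [h.1, hr.2]) _ _
    · rw [if_neg hst.ne', hk.heatOp_eq_zero (fun h => by linarith [h.1]),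
        indicator_of_notMem fun h => by linarith [h.2]]
      simp only [zero_add]
      refine (setIntegral_eq_zero_of_forall_eq_zero fun r hr => ?_).symm
      exact hk.heatOp_eq_zero (fun h => by linarith [h.1, hr.2]) _ _
  have hswap := integral_integral_swap hint
  have hae : ∀ᵐ s : ℝ, s ≠ t := by simp [ae_iff, measure_singleton]
  have h5 : duhamel k g t x = ∫ s, ((Ioc 0 t).indicator (fun s => g s x) s
        + ∫ r in Ioc 0 t, heatOp k (r - s) (_root_.levyOp μ (g s)) x) := by
    refine integral_congr_ae ?_
    filter_upwards [hae] with s hs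
    rw [← key s, if_neg hs, add_zero]
  have h6 : Integrable (fun r => duhamel k (fun s => _root_.levyOp μ (g s)) r x)
      (volume.restrict (Ioc 0 t)) := hint.integral_prod_right
  have h7 : Integrable fun s => ∫ r in Ioc 0 t, heatOp k (r - s) (_root_.levyOp μ (g s)) x :=
    hint.integral_prod_left
  rw [h5, integral_add hgi h7, hswap, integral_indicator measurableSet_Ioc,
    intervalIntegral.integral_of_le ht.1.le,
    integral_add ((integrable_indicator_iff measurableSet_Ioc).1 hgi) h6]
  rfl

end IsC11Source

/-- The time derivative of the mild solution with the initial value `φ` and the source `g`. -/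
noncomputable def mildRate (μ : Measure (Rd d)) (T : ℝ) (φ : Rd d → ℝ) (g : ℝ → Rd d → ℝ)
    (t : ℝ) (x : Rd d) : ℝ :=
  heatOp (heatKer μ T) t (levyOp μ φ) x
    + (g t x + duhamel (heatKer μ T) (fun s => levyOp μ (g s)) t x)

section MildRate

variable {b c : ℝ} {φ : Rd d → ℝ} {φ' : Rd d → Rd d →L[ℝ] ℝ} {g : ℝ → Rd d → ℝ}
  {g' : ℝ → Rd d → Rd d →L[ℝ] ℝ} (hK : HeatKernelBounds μ σ T 𝒦) (hμ : LevyCondition μ Λ)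
  (hφ : HasLipschitzDeriv b φ φ') (hg : IsC11Source T c g g')
include hK hμ hφ hg

theorem stronglyMeasurable_mildRate :
    StronglyMeasurable fun q : ℝ × Rd d => mildRate μ T φ g q.1 q.2 := by
  have hk := hK.isHeatKernel hμ
  exact (hk.stronglyMeasurable_heatOp_time (hφ.stronglyMeasurable_levyOp hμ)).add
    (hg.source.stronglyMeasurable.add (hk.stronglyMeasurable_duhamel (hg.levyOp hμ)))

theorem abs_mildRate_le (t : ℝ) (x : Rd d) :
    |mildRate μ T φ g t x| ≤ 3 * b * max Λ 0 + (c + max T 0 * (3 * c * max Λ 0)) := by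
  have hk := hK.isHeatKernel hμ
  refine (abs_add_le _ _).trans (add_le_add ?_ ((abs_add_le _ _).trans (add_le_add ?_ ?_)))
  · exact hk.norm_heatOp_le (φ := levyOp μ φ) t x fun y => hφ.abs_levyOp_le hμ y
  · exact hg.source.bound t x
  · have hi : ∫ s, (Ioo 0 T).indicator (fun _ => 3 * c * max Λ 0) s
        = max T 0 * (3 * c * max Λ 0) := by
      rw [integral_indicator measurableSet_Ioo, setIntegral_const, smul_eq_mul,
        Real.volume_real_Ioo, sub_zero]
    rw [← hi]
    exact norm_integral_le_of_norm_le ((integrable_indicator_iff measurableSet_Ioo).2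
      (integrableOn_const (by simp))) (ae_of_all _ fun s =>
      hk.norm_heatOp_source_le (hg.levyOp hμ) t s x)

theorem mild_eq_integral {t : ℝ} (ht : t ∈ Ioo 0 T) (x : Rd d) :
    heatOp (heatKer μ T) t φ x + duhamel (heatKer μ T) g t x
      = φ x + ∫ r in (0 : ℝ)..t, mildRate μ T φ g r x := by
  have hk := hK.isHeatKernel hμ
  have h1 := hφ.solvesHeat hK hμ t ht x
  have i1 : IntervalIntegrable (fun r => heatOp (heatKer μ T) r (levyOp μ φ) x) volume 0 t :=
    (intervalIntegrable_const (c := 3 * b * max Λ 0)).mono_fun'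
      ((hk.stronglyMeasurable_heatOp_time (hφ.stronglyMeasurable_levyOp hμ)).comp_measurable
        (g := fun r : ℝ => (r, x)) (by fun_prop)).aestronglyMeasurable
      (ae_of_all _ fun r => hk.norm_heatOp_le r x fun y => hφ.abs_levyOp_le hμ y)
  have i3 : IntervalIntegrable (fun r => mildRate μ T φ g r x) volume 0 t :=
    (intervalIntegrable_const (c := 3 * b * max Λ 0 + (c + max T 0 * (3 * c * max Λ 0)))).mono_fun'
      ((stronglyMeasurable_mildRate hK hμ hφ hg).comp_measurable
        (g := fun r : ℝ => (r, x)) (by fun_prop)).aestronglyMeasurable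
      (ae_of_all _ fun r => abs_mildRate_le hK hμ hφ hg r x)
  have h2 : ∫ r in (0 : ℝ)..t,
      (g r x + duhamel (heatKer μ T) (fun s => levyOp μ (g s)) r x)
      = (∫ r in (0 : ℝ)..t, mildRate μ T φ g r x)
        - ∫ r in (0 : ℝ)..t, heatOp (heatKer μ T) r (levyOp μ φ) x := by
    rw [← intervalIntegral.integral_sub i3 i1]
    refine intervalIntegral.integral_congr fun r _ => ?_
    simp only [mildRate]; ring
  rw [hg.duhamel_eq hK hμ ht, h2, ← h1]
  ring

theorem levyOp_mild (t : ℝ) (x : Rd d) :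
    levyOp μ (fun x => heatOp (heatKer μ T) t φ x + duhamel (heatKer μ T) g t x) x
      = mildRate μ T φ g t x - g t x := by
  have hk := hK.isHeatKernel hμ
  rw [(hφ.heatOp hk t).levyOp_add hμ (hg.hasLipschitzDeriv_duhamel hk t),
    hφ.levyOp_heatOp hμ hk, hg.levyOp_duhamel hμ hk, mildRate]
  ring

theorem continuousOn_mildRate
    (hc : ContinuousOn (fun q : ℝ × Rd d => g q.1 q.2) (strip (Rd d) T)) :
    ContinuousOn (fun q : ℝ × Rd d => mildRate μ T φ g q.1 q.2) (strip (Rd d) T) := by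
  have hk := hK.isHeatKernel hμ
  exact (hk.continuousOn_heatOp (hφ.stronglyMeasurable_levyOp hμ)
    (fun y => hφ.abs_levyOp_le hμ y)).add (hc.add (hk.continuousOn_duhamel (hg.levyOp hμ)))

end MildRate

end Mild

-- needed for the instances on iterated spaces of continuous linear maps
set_option maxSynthPendingDepth 3

/-! ### Functions with two bounded derivatives and a Lipschitz second derivative -/

section BoundedJets

variable {V W G : Type*} [NormedAddCommGroup V] [NormedSpace ℝ V] [NormedAddCommGroup W]
  [NormedSpace ℝ W] [NormedAddCommGroup G] [NormedSpace ℝ G]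

/-- The second derivative of a composition `f ∘ g`, in terms of the first and second derivatives
`A`, `S` of `f` and `P`, `Q` of `g`. -/
noncomputable def chainSnd (A : W →L[ℝ] G) (S : W →L[ℝ] W →L[ℝ] G) (P : V →L[ℝ] W)
    (Q : V →L[ℝ] V →L[ℝ] W) : V →L[ℝ] V →L[ℝ] G :=
  (ContinuousLinearMap.compL ℝ V W G A).comp Q
    + ((ContinuousLinearMap.compL ℝ V W G).flip P).comp (S.comp P)

theorem chainSnd_apply (A : W →L[ℝ] G) (S : W →L[ℝ] W →L[ℝ] G) (P : V →L[ℝ] W)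
    (Q : V →L[ℝ] V →L[ℝ] W) (x y : V) : chainSnd A S P Q x y = A (Q x y) + S (P x) (P y) := rfl

theorem norm_chainSnd_le (A : W →L[ℝ] G) (S : W →L[ℝ] W →L[ℝ] G) (P : V →L[ℝ] W)
    (Q : V →L[ℝ] V →L[ℝ] W) : ‖chainSnd A S P Q‖ ≤ ‖A‖ * ‖Q‖ + ‖S‖ * ‖P‖ ^ 2 := by
  refine ContinuousLinearMap.opNorm_le_bound₂ _ (by positivity) fun x y => ?_
  rw [chainSnd_apply]
  calc ‖A (Q x y) + S (P x) (P y)‖ ≤ ‖A‖ * (‖Q‖ * ‖x‖ * ‖y‖) + ‖S‖ * (‖P‖ * ‖x‖) * (‖P‖ * ‖y‖) := by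
        refine (norm_add_le _ _).trans (add_le_add ?_ ?_)
        · exact (A.le_opNorm _).trans (by gcongr; exact Q.le_opNorm₂ x y)
        · exact (S.le_opNorm₂ _ _).trans (by gcongr <;> exact P.le_opNorm _)
    _ = _ := by ring

theorem norm_chainSnd_sub_le (A A' : W →L[ℝ] G) (S S' : W →L[ℝ] W →L[ℝ] G) (P P' : V →L[ℝ] W)
    (Q Q' : V →L[ℝ] V →L[ℝ] W) :
    ‖chainSnd A S P Q - chainSnd A' S' P' Q'‖ ≤ (‖A - A'‖ * ‖Q‖ + ‖A'‖ * ‖Q - Q'‖)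
      + (‖S - S'‖ * ‖P‖ ^ 2 + ‖S'‖ * ‖P - P'‖ * (‖P‖ + ‖P'‖)) := by
  refine ContinuousLinearMap.opNorm_le_bound₂ _ (by positivity) fun x y => ?_
  have e : (chainSnd A S P Q - chainSnd A' S' P' Q') x y
      = ((A - A') (Q x y) + A' ((Q - Q') x y))
        + ((S - S') (P x) (P y) + (S' ((P - P') x) (P y) + S' (P' x) ((P - P') y))) := by
    change (A (Q x y) + S (P x) (P y)) - (A' (Q' x y) + S' (P' x) (P' y))
      = ((A (Q x y) - A' (Q x y)) + A' (Q x y - Q' x y))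
        + ((S (P x) (P y) - S' (P x) (P y))
          + (S' (P x - P' x) (P y) + S' (P' x) (P y - P' y)))
    rw [map_sub A', map_sub S', map_sub (S' (P' x))]
    change _ = _ + (_ + ((S' (P x) (P y) - S' (P' x) (P y)) + _))
    abel
  rw [e]
  calc _ ≤ (‖A - A'‖ * (‖Q‖ * ‖x‖ * ‖y‖) + ‖A'‖ * (‖Q - Q'‖ * ‖x‖ * ‖y‖))
        + (‖S - S'‖ * (‖P‖ * ‖x‖) * (‖P‖ * ‖y‖) + (‖S'‖ * (‖P - P'‖ * ‖x‖) * (‖P‖ * ‖y‖)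
          + ‖S'‖ * (‖P'‖ * ‖x‖) * (‖P - P'‖ * ‖y‖))) := by
        refine (norm_add_le _ _).trans (add_le_add ((norm_add_le _ _).trans (add_le_add ?_ ?_))
          ((norm_add_le _ _).trans (add_le_add ?_ ((norm_add_le _ _).trans (add_le_add ?_ ?_)))))
        · exact ((A - A').le_opNorm _).trans (by gcongr; exact Q.le_opNorm₂ x y)
        · exact (A'.le_opNorm _).trans (by gcongr; exact (Q - Q').le_opNorm₂ x y)
        · exact ((S - S').le_opNorm₂ _ _).trans (by gcongr <;> exact P.le_opNorm _)
        · exact (S'.le_opNorm₂ _ _).trans (by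
            gcongr
            · exact (P - P').le_opNorm _
            · exact P.le_opNorm _)
        · exact (S'.le_opNorm₂ _ _).trans (by
            gcongr
            · exact P'.le_opNorm _
            · exact (P - P').le_opNorm _)
    _ = _ := by ring

theorem HasFDerivAt.chainSnd {A : V → W →L[ℝ] G} {P : V → V →L[ℝ] W} {x : V}
    {S : W →L[ℝ] W →L[ℝ] G} {Q : V →L[ℝ] V →L[ℝ] W}
    (hA : HasFDerivAt A (S.comp (P x)) x) (hP : HasFDerivAt P Q x) :
    HasFDerivAt (fun x => (A x).comp (P x)) (_root_.chainSnd (A x) S (P x) Q) x :=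
  hA.clm_comp hP

/-- `f` has the first and second derivatives `f₁`, `f₂`; on the set `s` they are bounded by `B`
and `B`-Lipschitz. -/
structure BoundedJet (s : Set V) (B : ℝ) (f : V → G) (f₁ : V → V →L[ℝ] G)
    (f₂ : V → V →L[ℝ] V →L[ℝ] G) : Prop where
  hasFDerivAt : ∀ x, HasFDerivAt f (f₁ x) x
  hasFDerivAt' : ∀ x, HasFDerivAt f₁ (f₂ x) x
  bound₁ : ∀ x ∈ s, ‖f₁ x‖ ≤ B
  bound₂ : ∀ x ∈ s, ‖f₂ x‖ ≤ B
  lipschitz₁ : ∀ x ∈ s, ∀ y ∈ s, ‖f₁ x - f₁ y‖ ≤ B * ‖x - y‖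
  lipschitz₂ : ∀ x ∈ s, ∀ y ∈ s, ‖f₂ x - f₂ y‖ ≤ B * ‖x - y‖

namespace BoundedJet

variable {s : Set V} {B : ℝ} {f : V → G} {f₁ : V → V →L[ℝ] G} {f₂ : V → V →L[ℝ] V →L[ℝ] G}

theorem mk' (h : ∀ x, HasFDerivAt f (f₁ x) x) (h' : ∀ x, HasFDerivAt f₁ (f₂ x) x)
    (hs : Convex ℝ s) (h1 : ∀ x ∈ s, ‖f₁ x‖ ≤ B) (h2 : ∀ x ∈ s, ‖f₂ x‖ ≤ B)
    (h3 : ∀ x ∈ s, ∀ y ∈ s, ‖f₂ x - f₂ y‖ ≤ B * ‖x - y‖) : BoundedJet s B f f₁ f₂ :=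
  ⟨h, h', h1, h2, fun _ hx _ hy => hs.norm_image_sub_le_of_norm_hasFDerivWithin_le
    (fun z _ => (h' z).hasFDerivWithinAt) h2 hy hx, h3⟩

theorem mono (h : BoundedJet s B f f₁ f₂) {B' : ℝ} (hB : B ≤ B') : BoundedJet s B' f f₁ f₂ :=
  ⟨h.hasFDerivAt, h.hasFDerivAt', fun x hx => (h.bound₁ x hx).trans hB,
    fun x hx => (h.bound₂ x hx).trans hB,
    fun x hx y hy => (h.lipschitz₁ x hx y hy).trans (by gcongr),
    fun x hx y hy => (h.lipschitz₂ x hx y hy).trans (by gcongr)⟩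

theorem nonneg (h : BoundedJet univ B f f₁ f₂) : 0 ≤ B :=
  (norm_nonneg _).trans (h.bound₁ 0 (mem_univ _))

theorem continuous₂ (h : BoundedJet univ B f f₁ f₂) : Continuous f₂ :=
  (LipschitzWith.of_dist_le_mul (K := B.toNNReal) fun x y => by
    rw [dist_eq_norm, dist_eq_norm, Real.coe_toNNReal _ h.nonneg]
    exact h.lipschitz₂ x (mem_univ _) y (mem_univ _)).continuous

theorem clm (L : V →L[ℝ] G) : BoundedJet univ ‖L‖ L (fun _ => L) (fun _ => 0) := by
  refine BoundedJet.mk' (fun x => L.hasFDerivAt) (fun x => hasFDerivAt_const L x) convex_univ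
    (fun _ _ => le_rfl) (fun _ _ => ?_) (fun x _ y _ => ?_)
  · exact (le_of_eq ContinuousLinearMap.opNorm_zero).trans (norm_nonneg L)
  · rw [sub_self]
    exact (le_of_eq ContinuousLinearMap.opNorm_zero).trans (by positivity)

theorem add (h : BoundedJet univ B f f₁ f₂) {C : ℝ} {g : V → G} {g₁ : V → V →L[ℝ] G}
    {g₂ : V → V →L[ℝ] V →L[ℝ] G} (hg : BoundedJet univ C g g₁ g₂) :
    BoundedJet univ (B + C) (fun x => f x + g x) (fun x => f₁ x + g₁ x) (fun x => f₂ x + g₂ x) := by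
  refine BoundedJet.mk' (fun x => (h.hasFDerivAt x).fun_add (hg.hasFDerivAt x))
    (fun x => (h.hasFDerivAt' x).fun_add (hg.hasFDerivAt' x)) convex_univ
    (fun x hx => (norm_add_le _ _).trans (add_le_add (h.bound₁ x hx) (hg.bound₁ x hx)))
    (fun x hx => (norm_add_le _ _).trans (add_le_add (h.bound₂ x hx) (hg.bound₂ x hx)))
    (fun x hx y hy => ?_)
  rw [add_sub_add_comm, add_mul]
  exact (norm_add_le _ _).trans (add_le_add (h.lipschitz₂ x hx y hy) (hg.lipschitz₂ x hx y hy))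

/-- The chain rule for jets, with an explicit bound. The outer function need only be controlled on
a set that contains the range of the inner one. -/
theorem comp {s : Set W} {g : W → G} {g₁ : W → W →L[ℝ] G} {g₂ : W → W →L[ℝ] W →L[ℝ] G}
    (hB : 0 ≤ B) (hg : BoundedJet s B g g₁ g₂) {D : ℝ} {h : V → W} {h₁ : V → V →L[ℝ] W}
    {h₂ : V → V →L[ℝ] V →L[ℝ] W} (hh : BoundedJet univ D h h₁ h₂) (hs : ∀ x, h x ∈ s) :
    BoundedJet univ (B * (1 + D) ^ 3) (fun x => g (h x)) (fun x => (g₁ (h x)).comp (h₁ x))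
      (fun x => chainSnd (g₁ (h x)) (g₂ (h x)) (h₁ x) (h₂ x)) := by
  have hD := hh.nonneg
  have hlip : ∀ x y, ‖h x - h y‖ ≤ D * ‖x - y‖ :=
    norm_sub_le_of_hasFDerivAt hh.hasFDerivAt fun x => hh.bound₁ x (mem_univ _)
  have e : (1 + D) ^ 3 = 1 + 3 * D + 3 * D ^ 2 + D ^ 3 := by ring
  refine BoundedJet.mk' (fun x => (hg.hasFDerivAt (h x)).comp x (hh.hasFDerivAt x))
    (fun x => HasFDerivAt.chainSnd ((hg.hasFDerivAt' (h x)).comp x (hh.hasFDerivAt x))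
      (hh.hasFDerivAt' x)) convex_univ (fun x _ => ?_) (fun x _ => ?_) (fun x _ y _ => ?_)
  · refine (ContinuousLinearMap.opNorm_comp_le _ _).trans ((mul_le_mul (hg.bound₁ _ (hs x))
      (hh.bound₁ x (mem_univ _)) (norm_nonneg _) hB).trans ?_)
    refine mul_le_mul_of_nonneg_left ?_ hB
    rw [e]; nlinarith [pow_nonneg hD 2, pow_nonneg hD 3]
  · refine (norm_chainSnd_le _ _ _ _).trans ?_
    calc _ ≤ B * D + B * D ^ 2 := by
          have h1 := hg.bound₁ _ (hs x)
          have h2 := hg.bound₂ _ (hs x)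
          have h3 := hh.bound₁ x (mem_univ _)
          have h4 := hh.bound₂ x (mem_univ _)
          have n1 := norm_nonneg (h₁ x)
          have n2 := norm_nonneg (h₂ x)
          gcongr
      _ = B * (D + D ^ 2) := by ring
      _ ≤ _ := by
          refine mul_le_mul_of_nonneg_left ?_ hB
          rw [e]; nlinarith [pow_nonneg hD 2, pow_nonneg hD 3]
  · refine (norm_chainSnd_sub_le _ _ _ _ _ _ _ _).trans ?_
    have h0 := hlip x y
    have h1 := (hg.lipschitz₁ _ (hs x) _ (hs y)).trans (mul_le_mul_of_nonneg_left h0 hB)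
    have h2 := (hg.lipschitz₂ _ (hs x) _ (hs y)).trans (mul_le_mul_of_nonneg_left h0 hB)
    have h3 := hg.bound₁ _ (hs y)
    have h4 := hg.bound₂ _ (hs y)
    have h5 := hh.bound₁ x (mem_univ _)
    have h6 := hh.bound₂ x (mem_univ _)
    have h7 := hh.bound₁ y (mem_univ _)
    have h8 := hh.lipschitz₁ x (mem_univ _) y (mem_univ _)
    have h9 := hh.lipschitz₂ x (mem_univ _) y (mem_univ _)
    have n0 := norm_nonneg (x - y)
    calc _ ≤ (B * (D * ‖x - y‖) * D + B * (D * ‖x - y‖))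
          + (B * (D * ‖x - y‖) * D ^ 2 + B * (D * ‖x - y‖) * (D + D)) := by
          have n1 := norm_nonneg (h₁ x)
          have n2 := norm_nonneg (h₂ x)
          gcongr
      _ = B * (D + 3 * D ^ 2 + D ^ 3) * ‖x - y‖ := by ring
      _ ≤ _ := by
          refine mul_le_mul_of_nonneg_right (mul_le_mul_of_nonneg_left ?_ hB) n0
          rw [e]; linarith

end BoundedJet

theorem exists_norm_fderiv_le {f : V → G} (hf : ContDiff ℝ 1 f) (hs : HasCompactSupport f) :
    ∃ C, ∀ x, ‖fderiv ℝ f x‖ ≤ C :=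
  (hs.fderiv ℝ).exists_bound_of_continuous (hf.continuous_fderiv one_ne_zero)

theorem HasCompactSupport.exists_boundedJet {f : V → G} (hf : ContDiff ℝ 3 f)
    (hs : HasCompactSupport (fderiv ℝ f)) :
    ∃ B, BoundedJet univ B f (fderiv ℝ f) (fderiv ℝ (fderiv ℝ f)) := by
  have h1 : ContDiff ℝ 2 (fderiv ℝ f) := hf.fderiv_right (by norm_num)
  have h2 : ContDiff ℝ 1 (fderiv ℝ (fderiv ℝ f)) := h1.fderiv_right (by norm_num)
  obtain ⟨B1, hB1⟩ := hs.exists_bound_of_continuous h1.continuous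
  obtain ⟨B2, hB2⟩ := exists_norm_fderiv_le (h1.of_le one_le_two) hs
  have hs2 : HasCompactSupport (fderiv ℝ (fderiv ℝ f)) := hs.fderiv ℝ
  obtain ⟨B3, hB3⟩ := exists_norm_fderiv_le h2 hs2
  set B := max B1 (max B2 B3) with hB
  have hB3' : ∀ x, ‖fderiv ℝ (fderiv ℝ (fderiv ℝ f)) x‖ ≤ B := fun x =>
    (hB3 x).trans ((le_max_right _ _).trans (le_max_right _ _))
  exact ⟨B, BoundedJet.mk' (fun x => (hf.differentiable (by norm_num) x).hasFDerivAt)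
    (fun x => (h1.differentiable (by norm_num) x).hasFDerivAt) convex_univ
    (fun x _ => (hB1 x).trans (le_max_left _ _))
    (fun x _ => (hB2 x).trans ((le_max_left _ _).trans (le_max_right _ _)))
    (fun x _ y _ => norm_sub_le_of_hasFDerivAt
      (fun z => (h2.differentiable one_ne_zero z).hasFDerivAt) hB3' x y)⟩

end BoundedJets

/-! ### Picard iteration for jets -/

section Picard

variable {E : Type*} [NormedAddCommGroup E] [NormedSpace ℝ E] [FiniteDimensional ℝ E]
  [MeasureSpace E] [BorelSpace E] [(volume : Measure E).IsAddHaarMeasure]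
variable {F : Type*} [NormedAddCommGroup F] [NormedSpace ℝ F] [CompleteSpace F]
variable {G : Type*} [NormedAddCommGroup G] [NormedSpace ℝ G] [CompleteSpace G]

/-- Stated for a generic finite-dimensional domain, so that second countability need not be found
again for iterated spaces of linear maps. -/
theorem Continuous.stronglyMeasurable_of_finiteDimensional {φ : E → F} (h : Continuous φ) :
    StronglyMeasurable φ := h.stronglyMeasurable

open Classical in
/-- The restriction of `w` to times in `(0,T)`, extended by zero. -/
noncomputable def cutTime (T : ℝ) (w : ℝ → E → F) (t : ℝ) (x : E) : F :=
  if t ∈ Ioo 0 T then w t x else 0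

theorem cutTime_of_mem {T t : ℝ} (ht : t ∈ Ioo 0 T) (w : ℝ → E → F) : cutTime T w t = w t :=
  funext fun _ => if_pos ht

theorem cutTime_of_notMem {T t : ℝ} (ht : t ∉ Ioo 0 T) (w : ℝ → E → F) : cutTime T w t = 0 :=
  funext fun _ => if_neg ht

theorem cutTime_eq_indicator (T : ℝ) (w : ℝ → E → F) :
    (fun q : ℝ × E => cutTime T w q.1 q.2) = (strip E T).indicator fun q => w q.1 q.2 := by
  ext q
  by_cases hq : q.1 ∈ Ioo 0 T
  · rw [cutTime_of_mem hq, indicator_of_mem (show q ∈ strip E T from ⟨hq, mem_univ _⟩)]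
  · rw [cutTime_of_notMem hq, indicator_of_notMem fun h : q ∈ strip E T => hq h.1]; rfl

theorem isSource_cutTime {T b : ℝ} {w : ℝ → E → F} (hb0 : 0 ≤ b)
    (hm : StronglyMeasurable ((strip E T).indicator fun q : ℝ × E => w q.1 q.2))
    (hb : ∀ t ∈ Ioo 0 T, ∀ x, ‖w t x‖ ≤ b) : IsSource T b (cutTime T w) where
  stronglyMeasurable := by rw [cutTime_eq_indicator]; exact hm
  zero _ hs := cutTime_of_notMem hs w
  bound s x := by
    by_cases hs : s ∈ Ioo 0 T
    · rw [cutTime_of_mem hs]; exact hb s hs x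
    · rw [cutTime_of_notMem hs]; simpa using hb0

theorem hasFDerivAt_cutTime {T : ℝ} {w : ℝ → E → F} {w' : ℝ → E → E →L[ℝ] F}
    (h : ∀ t ∈ Ioo 0 T, ∀ x, HasFDerivAt (w t) (w' t x) x) (t : ℝ) (x : E) :
    HasFDerivAt (cutTime T w t) (cutTime T w' t x) x := by
  by_cases ht : t ∈ Ioo 0 T
  · rw [cutTime_of_mem ht, cutTime_of_mem ht]; exact h t ht x
  · rw [cutTime_of_notMem ht, cutTime_of_notMem ht]; exact hasFDerivAt_const 0 x

namespace IsHeatKernel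

variable {T a C : ℝ} {k : ℝ → E → ℝ} (hk : IsHeatKernel T a C k)
include hk

theorem heatOp_sub {t : ℝ} {x : E} {φ ψ : E → F} (hφ : StronglyMeasurable φ)
    (hψ : StronglyMeasurable ψ) {b c : ℝ} (hb : ∀ y, ‖φ y‖ ≤ b) (hc : ∀ y, ‖ψ y‖ ≤ c) :
    heatOp k t (fun y => φ y - ψ y) x = heatOp k t φ x - heatOp k t ψ x := by
  rw [heatOp, heatOp, heatOp, ← integral_sub (hk.integrable_smul t x hφ hb)
    (hk.integrable_smul t x hψ hc)]
  simp only [smul_sub]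

theorem gradOp_sub {t : ℝ} {x : E} {φ ψ : E → F} (hφ : StronglyMeasurable φ)
    (hψ : StronglyMeasurable ψ) {b c : ℝ} (hb : ∀ y, ‖φ y‖ ≤ b) (hc : ∀ y, ‖ψ y‖ ≤ c) :
    gradOp k t (fun y => φ y - ψ y) x = gradOp k t φ x - gradOp k t ψ x := by
  rw [gradOp, gradOp, gradOp, ← integral_sub (hk.integrable_smulRight t x hφ hb)
    (hk.integrable_smulRight t x hψ hc)]
  congr 1
  ext y v
  simp [smul_sub]

theorem weighted_duhamel_sub_le (ha : a < 1) {l : ℝ} (hl : 0 ≤ l) {b b' : ℝ}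
    {g g' : ℝ → E → F} (hg : IsSource T b g) (hg' : IsSource T b' g') {c : ℝ} (hc0 : 0 ≤ c)
    (hc : ∀ s ∈ Ioo 0 T, ∀ x, ‖g s x - g' s x‖ ≤ c * Real.exp (l * s)) (t : ℝ) (x : E) :
    ‖duhamel k g t x - duhamel k g' t x‖ ≤ weightMass T a C l * c * Real.exp (l * t) ∧
      ‖gradDuhamel k g t x - gradDuhamel k g' t x‖
        ≤ weightMass T a C l * c * Real.exp (l * t) := by
  have hm : ∀ s, StronglyMeasurable (g s) := fun s =>
    hg.stronglyMeasurable.comp_measurable (g := fun y : E => (s, y)) (by fun_prop)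
  have hm' : ∀ s, StronglyMeasurable (g' s) := fun s =>
    hg'.stronglyMeasurable.comp_measurable (g := fun y : E => (s, y)) (by fun_prop)
  have h := hk.weighted_duhamel_le (g := fun s y => g s y - g' s y) ha hl (t := t) hc hc0
    (fun s hs => by ext y; simp [hg.zero s hs, hg'.zero s hs]) x
  have e1 : duhamel k (fun s y => g s y - g' s y) t x = duhamel k g t x - duhamel k g' t x := by
    rw [duhamel, duhamel, duhamel, ← integral_sub (hk.integrable_heatOp hg t x)
      (hk.integrable_heatOp hg' t x)]
    exact integral_congr_ae (ae_of_all _ fun s =>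
      hk.heatOp_sub (hm s) (hm' s) (hg.bound s) (hg'.bound s))
  have e2 : gradDuhamel k (fun s y => g s y - g' s y) t x
      = gradDuhamel k g t x - gradDuhamel k g' t x := by
    rw [gradDuhamel, gradDuhamel, gradDuhamel, ← integral_sub (hk.integrable_gradOp hg ha x)
      (hk.integrable_gradOp hg' ha x)]
    exact integral_congr_ae (ae_of_all _ fun s =>
      hk.gradOp_sub (hm s) (hm' s) (hg.bound s) (hg'.bound s))
  rw [e1, e2] at h
  exact h

end IsHeatKernel

/-- A function on the strip together with candidates for its first three space derivatives. -/
structure Jet (E G : Type*) [NormedAddCommGroup E] [NormedSpace ℝ E] [NormedAddCommGroup G]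
    [NormedSpace ℝ G] where
  v₀ : ℝ → E → G
  v₁ : ℝ → E → E →L[ℝ] G
  v₂ : ℝ → E → E →L[ℝ] E →L[ℝ] G
  v₃ : ℝ → E → E →L[ℝ] E →L[ℝ] E →L[ℝ] G

/-- The components of the jet are continuous on the strip, each is the space derivative of the
preceding one, and they are bounded by the given constants times `exp (l t)`. -/
structure Jet.IsGood (U : Jet E G) (T l R₁ R₂ R₃ : ℝ) : Prop where
  c₀ : ContinuousOn (fun q : ℝ × E => U.v₀ q.1 q.2) (strip E T)
  c₁ : ContinuousOn (fun q : ℝ × E => U.v₁ q.1 q.2) (strip E T)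
  c₂ : ContinuousOn (fun q : ℝ × E => U.v₂ q.1 q.2) (strip E T)
  c₃ : ContinuousOn (fun q : ℝ × E => U.v₃ q.1 q.2) (strip E T)
  d₀ : ∀ t ∈ Ioo 0 T, ∀ x, HasFDerivAt (U.v₀ t) (U.v₁ t x) x
  d₁ : ∀ t ∈ Ioo 0 T, ∀ x, HasFDerivAt (U.v₁ t) (U.v₂ t x) x
  d₂ : ∀ t ∈ Ioo 0 T, ∀ x, HasFDerivAt (U.v₂ t) (U.v₃ t x) x
  b₀ : ∀ t ∈ Ioo 0 T, ∀ x, ‖U.v₀ t x‖ ≤ R₁ * Real.exp (l * t)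
  b₁ : ∀ t ∈ Ioo 0 T, ∀ x, ‖U.v₁ t x‖ ≤ R₁ * Real.exp (l * t)
  b₂ : ∀ t ∈ Ioo 0 T, ∀ x, ‖U.v₂ t x‖ ≤ R₂ * Real.exp (l * t)
  b₃ : ∀ t ∈ Ioo 0 T, ∀ x, ‖U.v₃ t x‖ ≤ R₃ * Real.exp (l * t)

/-- Initial data with three bounded derivatives. -/
structure InitialJet (M : ℝ) (φ₀ : E → G) (φ₁ : E → E →L[ℝ] G) (φ₂ : E → E →L[ℝ] E →L[ℝ] G)
    (φ₃ : E → E →L[ℝ] E →L[ℝ] E →L[ℝ] G) : Prop where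
  d₀ : ∀ x, HasFDerivAt φ₀ (φ₁ x) x
  d₁ : ∀ x, HasFDerivAt φ₁ (φ₂ x) x
  d₂ : ∀ x, HasFDerivAt φ₂ (φ₃ x) x
  c₃ : Continuous φ₃
  b₀ : ∀ x, ‖φ₀ x‖ ≤ M
  b₁ : ∀ x, ‖φ₁ x‖ ≤ M
  b₂ : ∀ x, ‖φ₂ x‖ ≤ M
  b₃ : ∀ x, ‖φ₃ x‖ ≤ M

/-- A source with two bounded space derivatives. -/
structure SourceJet (T M : ℝ) (f₀ : ℝ → E → G) (f₁ : ℝ → E → E →L[ℝ] G)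
    (f₂ : ℝ → E → E →L[ℝ] E →L[ℝ] G) : Prop where
  c₀ : ContinuousOn (fun q : ℝ × E => f₀ q.1 q.2) (strip E T)
  c₁ : ContinuousOn (fun q : ℝ × E => f₁ q.1 q.2) (strip E T)
  m₂ : StronglyMeasurable ((strip E T).indicator fun q : ℝ × E => f₂ q.1 q.2)
  d₀ : ∀ t ∈ Ioo 0 T, ∀ x, HasFDerivAt (f₀ t) (f₁ t x) x
  d₁ : ∀ t ∈ Ioo 0 T, ∀ x, HasFDerivAt (f₁ t) (f₂ t x) x
  b₀ : ∀ t ∈ Ioo 0 T, ∀ x, ‖f₀ t x‖ ≤ M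
  b₁ : ∀ t ∈ Ioo 0 T, ∀ x, ‖f₁ t x‖ ≤ M
  b₂ : ∀ t ∈ Ioo 0 T, ∀ x, ‖f₂ t x‖ ≤ M

/-- A nonlinearity `N₀(x, v, Dv)` along with the expressions `N₁`, `N₂` for the first two
derivatives of `x ↦ N₀(x, v(x), Dv(x))`. The highest derivatives enter `N₁` and `N₂` with
linear growth only, and all three expressions are Lipschitz on bounded sets. -/
structure IsTower (B : ℝ) (N₀ : E → G → (E →L[ℝ] G) → G)
    (N₁ : E → G → (E →L[ℝ] G) → (E →L[ℝ] E →L[ℝ] G) → E →L[ℝ] G)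
    (N₂ : E → G → (E →L[ℝ] G) → (E →L[ℝ] E →L[ℝ] G) → (E →L[ℝ] E →L[ℝ] E →L[ℝ] G) →
      E →L[ℝ] E →L[ℝ] G) : Prop where
  c₀ : Continuous fun p : E × G × (E →L[ℝ] G) => N₀ p.1 p.2.1 p.2.2
  c₁ : Continuous fun p : E × G × (E →L[ℝ] G) × (E →L[ℝ] E →L[ℝ] G) =>
    N₁ p.1 p.2.1 p.2.2.1 p.2.2.2
  c₂ : Continuous fun p : E × G × (E →L[ℝ] G) × (E →L[ℝ] E →L[ℝ] G) ×
    (E →L[ℝ] E →L[ℝ] E →L[ℝ] G) => N₂ p.1 p.2.1 p.2.2.1 p.2.2.2.1 p.2.2.2.2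
  d₀ : ∀ (v : E → G) (v₁ : E → E →L[ℝ] G) (v₂ : E → E →L[ℝ] E →L[ℝ] G),
    (∀ x, HasFDerivAt v (v₁ x) x) → (∀ x, HasFDerivAt v₁ (v₂ x) x) →
    ∀ x, HasFDerivAt (fun x => N₀ x (v x) (v₁ x)) (N₁ x (v x) (v₁ x) (v₂ x)) x
  d₁ : ∀ (v : E → G) (v₁ : E → E →L[ℝ] G) (v₂ : E → E →L[ℝ] E →L[ℝ] G)
    (v₃ : E → E →L[ℝ] E →L[ℝ] E →L[ℝ] G), (∀ x, HasFDerivAt v (v₁ x) x) →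
    (∀ x, HasFDerivAt v₁ (v₂ x) x) → (∀ x, HasFDerivAt v₂ (v₃ x) x) →
    ∀ x, HasFDerivAt (fun x => N₁ x (v x) (v₁ x) (v₂ x)) (N₂ x (v x) (v₁ x) (v₂ x) (v₃ x)) x
  b₀ : ∀ x u p, ‖N₀ x u p‖ ≤ B
  b₁ : ∀ x u p q, ‖N₁ x u p q‖ ≤ B * (1 + ‖p‖ + ‖q‖)
  b₂ : ∀ x u p q r, ‖N₂ x u p q r‖ ≤ B * (‖q‖ + ‖r‖) + B * (1 + ‖p‖ + ‖q‖) ^ 2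
  lip : ∀ R, ∃ K, 0 ≤ K ∧ ∀ η x u u' p p' q q' r r', ‖p‖ ≤ R → ‖p'‖ ≤ R → ‖q‖ ≤ R → ‖q'‖ ≤ R →
    ‖r‖ ≤ R → ‖r'‖ ≤ R → ‖u - u'‖ ≤ η → ‖p - p'‖ ≤ η → ‖q - q'‖ ≤ η → ‖r - r'‖ ≤ η →
    ‖N₀ x u p - N₀ x u' p'‖ ≤ K * η ∧ ‖N₁ x u p q - N₁ x u' p' q'‖ ≤ K * η ∧
      ‖N₂ x u p q r - N₂ x u' p' q' r'‖ ≤ K * η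

section Step

variable (T : ℝ) (k : ℝ → E → ℝ) (φ₀ : E → G) (φ₁ : E → E →L[ℝ] G) (φ₂ : E → E →L[ℝ] E →L[ℝ] G)
    (φ₃ : E → E →L[ℝ] E →L[ℝ] E →L[ℝ] G) (f₀ : ℝ → E → G) (f₁ : ℝ → E → E →L[ℝ] G)
    (f₂ : ℝ → E → E →L[ℝ] E →L[ℝ] G) (N₀ : E → G → (E →L[ℝ] G) → G)
    (N₁ : E → G → (E →L[ℝ] G) → (E →L[ℝ] E →L[ℝ] G) → E →L[ℝ] G)
    (N₂ : E → G → (E →L[ℝ] G) → (E →L[ℝ] E →L[ℝ] G) → (E →L[ℝ] E →L[ℝ] E →L[ℝ] G) →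
      E →L[ℝ] E →L[ℝ] G)

/-- The right hand side `f - N(x, u, Du)` along a jet. -/
noncomputable def Jet.src₀ (U : Jet E G) : ℝ → E → G :=
  cutTime T fun t x => f₀ t x - N₀ x (U.v₀ t x) (U.v₁ t x)

/-- The first derivative of the right hand side along a jet. -/
noncomputable def Jet.src₁ (U : Jet E G) : ℝ → E → E →L[ℝ] G :=
  cutTime T fun t x => f₁ t x - N₁ x (U.v₀ t x) (U.v₁ t x) (U.v₂ t x)

/-- The second derivative of the right hand side along a jet. -/
noncomputable def Jet.src₂ (U : Jet E G) : ℝ → E → E →L[ℝ] E →L[ℝ] G :=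
  cutTime T fun t x => f₂ t x - N₂ x (U.v₀ t x) (U.v₁ t x) (U.v₂ t x) (U.v₃ t x)

/-- One step of the Picard iteration for the mild formulation. In the last component the
derivative falls on the kernel, because the source has two derivatives only. -/
noncomputable def Jet.step (U : Jet E G) : Jet E G where
  v₀ t x := heatOp k t φ₀ x + duhamel k (U.src₀ T f₀ N₀) t x
  v₁ t x := heatOp k t φ₁ x + duhamel k (U.src₁ T f₁ N₁) t x
  v₂ t x := heatOp k t φ₂ x + duhamel k (U.src₂ T f₂ N₂) t x
  v₃ t x := heatOp k t φ₃ x + gradDuhamel k (U.src₂ T f₂ N₂) t x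

end Step

section PicardStep

variable {T a C M B l R₁ R₂ R₃ : ℝ} {k : ℝ → E → ℝ} {φ₀ : E → G} {φ₁ : E → E →L[ℝ] G}
    {φ₂ : E → E →L[ℝ] E →L[ℝ] G}
    {φ₃ : E → E →L[ℝ] E →L[ℝ] E →L[ℝ] G} {f₀ : ℝ → E → G} {f₁ : ℝ → E → E →L[ℝ] G}
    {f₂ : ℝ → E → E →L[ℝ] E →L[ℝ] G} {N₀ : E → G → (E →L[ℝ] G) → G}
    {N₁ : E → G → (E →L[ℝ] G) → (E →L[ℝ] E →L[ℝ] G) → E →L[ℝ] G}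
    {N₂ : E → G → (E →L[ℝ] G) → (E →L[ℝ] E →L[ℝ] G) → (E →L[ℝ] E →L[ℝ] E →L[ℝ] G) →
      E →L[ℝ] E →L[ℝ] G}

theorem mul_exp_le_mul_exp {l t T c : ℝ} (hc : 0 ≤ c) (hl : 0 ≤ l) (ht : t ∈ Ioo 0 T) :
    c * Real.exp (l * t) ≤ c * Real.exp (l * T) := by
  have := ht.2.le
  gcongr

theorem le_mul_exp {l t T c : ℝ} (hc : 0 ≤ c) (hl : 0 ≤ l) (ht : t ∈ Ioo 0 T) :
    c ≤ c * Real.exp (l * t) :=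
  le_mul_of_one_le_right hc (Real.one_le_exp (mul_nonneg hl ht.1.le))

namespace Jet.IsGood

variable {U : Jet E G} (hU : U.IsGood T l R₁ R₂ R₃) (hf : SourceJet T M f₀ f₁ f₂)
  (hN : IsTower B N₀ N₁ N₂) (hM : 0 ≤ M) (hB : 0 ≤ B)
include hU hf hN hM hB

theorem norm_src₀_le (t : ℝ) (ht : t ∈ Ioo 0 T) (x : E) : ‖U.src₀ T f₀ N₀ t x‖ ≤ M + B := by
  rw [Jet.src₀, cutTime_of_mem ht]
  exact (norm_sub_le _ _).trans (add_le_add (hf.b₀ t ht x) (hN.b₀ _ _ _))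

theorem norm_src₁_le (t : ℝ) (ht : t ∈ Ioo 0 T) (x : E) : ‖U.src₁ T f₁ N₁ t x‖
    ≤ M + B * (1 + R₁ * Real.exp (l * t) + R₂ * Real.exp (l * t)) := by
  rw [Jet.src₁, cutTime_of_mem ht]
  refine (norm_sub_le _ _).trans (add_le_add (hf.b₁ t ht x) ((hN.b₁ _ _ _ _).trans ?_))
  gcongr
  exacts [hU.b₁ t ht x, hU.b₂ t ht x]

theorem norm_src₂_le (t : ℝ) (ht : t ∈ Ioo 0 T) (x : E) : ‖U.src₂ T f₂ N₂ t x‖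
    ≤ M + (B * (R₂ * Real.exp (l * t) + R₃ * Real.exp (l * t))
      + B * (1 + R₁ * Real.exp (l * t) + R₂ * Real.exp (l * t)) ^ 2) := by
  rw [Jet.src₂, cutTime_of_mem ht]
  refine (norm_sub_le _ _).trans (add_le_add (hf.b₂ t ht x) ((hN.b₂ _ _ _ _ _).trans ?_))
  gcongr
  exacts [hU.b₂ t ht x, hU.b₃ t ht x, hU.b₁ t ht x, hU.b₂ t ht x]

theorem continuousOn_src₀ :
    ContinuousOn (fun q : ℝ × E => U.src₀ T f₀ N₀ q.1 q.2) (strip E T) := by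
  have h : ContinuousOn (fun q : ℝ × E => f₀ q.1 q.2 - N₀ q.2 (U.v₀ q.1 q.2) (U.v₁ q.1 q.2))
      (strip E T) :=
    hf.c₀.sub (hN.c₀.comp_continuousOn (continuousOn_snd.prodMk (hU.c₀.prodMk hU.c₁)))
  refine h.congr fun q hq => ?_
  simp only [Jet.src₀, cutTime_of_mem hq.1]

variable (hl : 0 ≤ l) (hR1 : 0 ≤ R₁) (hR2 : 0 ≤ R₂) (hR3 : 0 ≤ R₃)
include hl hR1 hR2 hR3

theorem isSource_src₀ : IsSource T (M + B) (U.src₀ T f₀ N₀) := by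
  refine isSource_cutTime (by positivity) ?_ fun t ht x => ?_
  · exact ContinuousOn.stronglyMeasurable_indicator' (hf.c₀.sub (hN.c₀.comp_continuousOn
      (continuousOn_snd.prodMk (hU.c₀.prodMk hU.c₁)))) (measurableSet_strip T)
  · have := hU.norm_src₀_le hf hN hM hB t ht x
    rwa [Jet.src₀, cutTime_of_mem ht] at this

theorem isSource_src₁ : IsSource T
    (M + B * (1 + R₁ * Real.exp (l * T) + R₂ * Real.exp (l * T))) (U.src₁ T f₁ N₁) := by
  refine isSource_cutTime (by positivity) ?_ fun t ht x => ?_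
  · exact ContinuousOn.stronglyMeasurable_indicator' (hf.c₁.sub (hN.c₁.comp_continuousOn
      (continuousOn_snd.prodMk (hU.c₀.prodMk (hU.c₁.prodMk hU.c₂))))) (measurableSet_strip T)
  · have := hU.norm_src₁_le hf hN hM hB t ht x
    rw [Jet.src₁, cutTime_of_mem ht] at this
    refine this.trans ?_
    gcongr M + B * (1 + ?_ + ?_)
    exacts [mul_exp_le_mul_exp hR1 hl ht, mul_exp_le_mul_exp hR2 hl ht]

theorem isSource_src₂ : IsSource T
    (M + (B * (R₂ * Real.exp (l * T) + R₃ * Real.exp (l * T))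
      + B * (1 + R₁ * Real.exp (l * T) + R₂ * Real.exp (l * T)) ^ 2)) (U.src₂ T f₂ N₂) := by
  refine isSource_cutTime (by positivity) ?_ fun t ht x => ?_
  · have h1 := ContinuousOn.stronglyMeasurable_indicator' (hN.c₂.comp_continuousOn
      (continuousOn_snd.prodMk (hU.c₀.prodMk (hU.c₁.prodMk (hU.c₂.prodMk hU.c₃)))))
      (measurableSet_strip T)
    have h2 := hf.m₂.sub h1
    rw [← indicator_sub'] at h2
    exact h2
  · have := hU.norm_src₂_le hf hN hM hB t ht x
    rw [Jet.src₂, cutTime_of_mem ht] at this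
    refine this.trans ?_
    have e1 := mul_exp_le_mul_exp hR1 hl ht
    have e2 := mul_exp_le_mul_exp hR2 hl ht
    have e3 := mul_exp_le_mul_exp hR3 hl ht
    gcongr M + (B * (?_ + ?_) + B * (1 + ?_ + ?_) ^ 2)

theorem hasFDerivAt_src₀ (t : ℝ) (x : E) :
    HasFDerivAt (U.src₀ T f₀ N₀ t) (U.src₁ T f₁ N₁ t x) x :=
  hasFDerivAt_cutTime (fun t ht x => (hf.d₀ t ht x).fun_sub
    (hN.d₀ _ _ _ (hU.d₀ t ht) (hU.d₁ t ht) x)) t x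

theorem hasFDerivAt_src₁ (t : ℝ) (x : E) :
    HasFDerivAt (U.src₁ T f₁ N₁ t) (U.src₂ T f₂ N₂ t x) x :=
  hasFDerivAt_cutTime (fun t ht x => (hf.d₁ t ht x).fun_sub
    (hN.d₁ _ _ _ _ (hU.d₀ t ht) (hU.d₁ t ht) (hU.d₂ t ht) x)) t x

end Jet.IsGood

variable (hk : IsHeatKernel T a C k) (ha0 : 0 < a) (ha : a < 1)
  (hφ : InitialJet M φ₀ φ₁ φ₂ φ₃) (hf : SourceJet T M f₀ f₁ f₂) (hN : IsTower B N₀ N₁ N₂)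
  (hM : 0 ≤ M) (hB : 0 ≤ B)
include hk ha0 ha hφ hf hN hM hB

/-- The Picard step preserves the bounds. For `u` and `Du`, the source and the initial data are
bounded by `M + B` and `M`, and `weightMass ≤ 1`. For the second and third derivatives the source contains
the derivative itself with the factor `B`; since `weightMass * B ≤ 1 / 2`, half of the bound absorbs
this term, hence the factor `2` in `R₂` and `R₃`. -/
theorem Jet.IsGood.step (hl : 0 ≤ l) (hδ : weightMass T a C l ≤ 1 / (2 * (B + 1)))
    (h1 : R₁ = M + (M + B))
    (h2 : R₂ = 2 * (M + (M + B * (1 + R₁ * Real.exp (l * T)))))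
    (h3 : R₃ = 2 * (M + (M + (B * (R₂ * Real.exp (l * T))
      + B * (1 + R₁ * Real.exp (l * T) + R₂ * Real.exp (l * T)) ^ 2))))
    {U : Jet E G} (hU : U.IsGood T l R₁ R₂ R₃) :
    (U.step T k φ₀ φ₁ φ₂ φ₃ f₀ f₁ f₂ N₀ N₁ N₂).IsGood T l R₁ R₂ R₃ := by
  have hR1 : 0 ≤ R₁ := by rw [h1]; positivity
  have hR2 : 0 ≤ R₂ := by rw [h2]; positivity
  have hR3 : 0 ≤ R₃ := by rw [h3]; positivity
  have s0 := hU.isSource_src₀ hf hN hM hB hl hR1 hR2 hR3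
  have s1 := hU.isSource_src₁ hf hN hM hB hl hR1 hR2 hR3
  have s2 := hU.isSource_src₂ hf hN hM hB hl hR1 hR2 hR3
  have e0 := hU.hasFDerivAt_src₀ hf hN hM hB hl hR1 hR2 hR3
  have e1 := hU.hasFDerivAt_src₁ hf hN hM hB hl hR1 hR2 hR3
  have m0 : StronglyMeasurable φ₀ := (continuous_iff_continuousAt.2 fun x =>
    (hφ.d₀ x).continuousAt).stronglyMeasurable
  have m1 : StronglyMeasurable φ₁ := (continuous_iff_continuousAt.2 fun x =>
    (hφ.d₁ x).continuousAt).stronglyMeasurable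
  have m2 : StronglyMeasurable φ₂ := (continuous_iff_continuousAt.2 fun x =>
    (hφ.d₂ x).continuousAt).stronglyMeasurable
  have m3 : StronglyMeasurable φ₃ := hφ.c₃.stronglyMeasurable_of_finiteDimensional
  have hδ1 : weightMass T a C l ≤ 1 := hδ.trans (by
    rw [div_le_one (by positivity)]; linarith)
  have hδB : weightMass T a C l * B ≤ 1 / 2 := by
    calc weightMass T a C l * B ≤ 1 / (2 * (B + 1)) * B := by gcongr
      _ ≤ 1 / 2 := by
        rw [div_mul_eq_mul_div, div_le_div_iff₀ (by positivity) (by positivity)]; linarith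
  -- the two forms of the derivative of the Duhamel integral agree
  have u1 : ∀ t x, duhamel k (U.src₁ T f₁ N₁) t x = gradDuhamel k (U.src₀ T f₀ N₀) t x :=
    fun t x => (hk.hasFDerivAt_duhamel s0 s1 e0 t x).unique
      (hk.hasFDerivAt_duhamel_gradDuhamel s0 ha x)
  have u2 : ∀ t x, duhamel k (U.src₂ T f₂ N₂) t x = gradDuhamel k (U.src₁ T f₁ N₁) t x :=
    fun t x => (hk.hasFDerivAt_duhamel s1 s2 e1 t x).unique
      (hk.hasFDerivAt_duhamel_gradDuhamel s1 ha x)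
  have w0 := fun t => hk.weighted_duhamel_le (g := U.src₀ T f₀ N₀) ha hl (t := t) (c := M + B)
    (fun s hs x => (hU.norm_src₀_le hf hN hM hB s hs x).trans
      (le_mul_exp (by positivity) hl hs)) (by positivity) s0.zero
  have w1 := fun t => hk.weighted_duhamel_le (g := U.src₁ T f₁ N₁) ha hl (t := t)
    (c := M + B * (1 + R₁ * Real.exp (l * T)) + B * R₂)
    (fun s hs x => (hU.norm_src₁_le hf hN hM hB s hs x).trans (by
      have p1 := mul_exp_le_mul_exp hR1 hl hs
      have p2 : M + B * (1 + R₁ * Real.exp (l * T))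
          ≤ (M + B * (1 + R₁ * Real.exp (l * T))) * Real.exp (l * s) :=
        le_mul_exp (by positivity) hl hs
      have p3 := mul_le_mul_of_nonneg_left p1 hB
      linarith)) (by positivity) s1.zero
  have w2 := fun t => hk.weighted_duhamel_le (g := U.src₂ T f₂ N₂) ha hl (t := t)
    (c := M + (B * (R₂ * Real.exp (l * T))
      + B * (1 + R₁ * Real.exp (l * T) + R₂ * Real.exp (l * T)) ^ 2) + B * R₃)
    (fun s hs x => (hU.norm_src₂_le hf hN hM hB s hs x).trans (by
      have p1 := mul_exp_le_mul_exp hR1 hl hs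
      have p2 := mul_exp_le_mul_exp hR2 hl hs
      have p3 := le_mul_exp (c := M + (B * (R₂ * Real.exp (l * T))
        + B * (1 + R₁ * Real.exp (l * T) + R₂ * Real.exp (l * T)) ^ 2)) (by positivity) hl hs
      have p4 := mul_le_mul_of_nonneg_left p2 hB
      have p5 : B * (1 + R₁ * Real.exp (l * s) + R₂ * Real.exp (l * s)) ^ 2
          ≤ B * (1 + R₁ * Real.exp (l * T) + R₂ * Real.exp (l * T)) ^ 2 := by
        gcongr B * (1 + ?_ + ?_) ^ 2
      linarith)) (by positivity) s2.zero
  have key : ∀ {t : ℝ}, t ∈ Ioo 0 T → ∀ {p q : ℝ} (c R : ℝ), p ≤ M → 0 ≤ c →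
      R = 2 * (M + c) → q ≤ weightMass T a C l * (c + B * R) * Real.exp (l * t) →
      p + q ≤ R * Real.exp (l * t) := fun {t} ht {p q} c R hp hc hR hq => by
    have hR0 : 0 ≤ R := by rw [hR]; positivity
    have h4 : weightMass T a C l * (c + B * R) ≤ c + R / 2 := by nlinarith
    have h5 := mul_le_mul_of_nonneg_right h4 (Real.exp_pos (l * t)).le
    have h6 := le_mul_exp (c := M) hM hl ht
    calc p + q ≤ M * Real.exp (l * t) + (c + R / 2) * Real.exp (l * t) := by linarith
      _ = R * Real.exp (l * t) := by rw [hR]; ring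
  have key0 : ∀ {t : ℝ}, t ∈ Ioo 0 T → ∀ {p q : ℝ}, p ≤ M →
      q ≤ weightMass T a C l * (M + B) * Real.exp (l * t) →
      p + q ≤ R₁ * Real.exp (l * t) := fun {t} ht {p q} hp hq => by
    have h4 : weightMass T a C l * (M + B) ≤ M + B :=
      mul_le_of_le_one_left (by positivity) hδ1
    have h5 := mul_le_mul_of_nonneg_right h4 (Real.exp_pos (l * t)).le
    have h6 := le_mul_exp (c := M) hM hl ht
    rw [h1, add_mul]
    linarith
  refine ⟨?_, ?_, ?_, ?_, ?_, ?_, ?_, ?_, ?_, ?_, ?_⟩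
  · exact (hk.continuousOn_heatOp m0 hφ.b₀).add (hk.continuousOn_duhamel s0)
  · exact (hk.continuousOn_heatOp m1 hφ.b₁).add (hk.continuousOn_duhamel s1)
  · exact (hk.continuousOn_heatOp m2 hφ.b₂).add (hk.continuousOn_duhamel s2)
  · exact (hk.continuousOn_heatOp m3 hφ.b₃).add (hk.continuousOn_gradDuhamel s2 ha0 ha)
  · exact fun t _ x => (hk.hasFDerivAt_heatOp t x m0 m1 hφ.b₀ hφ.b₁ hφ.d₀).add
      (hk.hasFDerivAt_duhamel s0 s1 e0 t x)
  · exact fun t _ x => (hk.hasFDerivAt_heatOp t x m1 m2 hφ.b₁ hφ.b₂ hφ.d₁).add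
      (hk.hasFDerivAt_duhamel s1 s2 e1 t x)
  · exact fun t _ x => (hk.hasFDerivAt_heatOp t x m2 m3 hφ.b₂ hφ.b₃ hφ.d₂).add
      (hk.hasFDerivAt_duhamel_gradDuhamel s2 ha x)
  · exact fun t ht x => (norm_add_le _ _).trans
      (key0 ht (hk.norm_heatOp_le t x hφ.b₀) (w0 t x).1)
  · refine fun t ht x => (norm_add_le _ _).trans
      (key0 ht (hk.norm_heatOp_le t x hφ.b₁) ?_)
    rw [u1]; exact (w0 t x).2
  · refine fun t ht x => (norm_add_le _ _).trans
      (key ht _ _ (hk.norm_heatOp_le t x hφ.b₂) (by positivity) h2 ?_)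
    rw [u2]; exact (w1 t x).2
  · exact fun t ht x => (norm_add_le _ _).trans
      (key ht _ _ (hk.norm_heatOp_le t x hφ.b₃) (by positivity) h3 (w2 t x).2)

end PicardStep

end Picard

/-! ### The limit of the Picard iteration -/

section PicardLimit

variable {E : Type*} [NormedAddCommGroup E] [NormedSpace ℝ E] [FiniteDimensional ℝ E]
  [MeasureSpace E] [BorelSpace E] [(volume : Measure E).IsAddHaarMeasure]
variable {F : Type*} [NormedAddCommGroup F] [NormedSpace ℝ F] [CompleteSpace F]
variable {G : Type*} [NormedAddCommGroup G] [NormedSpace ℝ G] [CompleteSpace G]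

/-- `V n` converges to `W` geometrically, uniformly on the strip. -/
def GeomTendsto (T c : ℝ) (V : ℕ → ℝ → E → F) (W : ℝ → E → F) : Prop :=
  ∀ n, ∀ t ∈ Ioo 0 T, ∀ x, ‖V n t x - W t x‖ ≤ c / 2 ^ n

theorem exists_geomTendsto {T c : ℝ} {V : ℕ → ℝ → E → F}
    (h : ∀ n, ∀ t ∈ Ioo 0 T, ∀ x, ‖V n t x - V (n + 1) t x‖ ≤ c / 2 / 2 ^ n) :
    ∃ W, GeomTendsto T c V W := by
  have h1 : ∀ t x, ∃ w, t ∈ Ioo 0 T → Tendsto (fun n => V n t x) atTop (𝓝 w) := fun t x => by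
    by_cases ht : t ∈ Ioo 0 T
    · obtain ⟨w, hw⟩ := cauchySeq_tendsto_of_complete (cauchySeq_of_le_geometric_two
        (f := fun n => V n t x) fun n => by rw [dist_eq_norm]; exact h n t ht x)
      exact ⟨w, fun _ => hw⟩
    · exact ⟨0, fun h => absurd h ht⟩
  choose W hW using h1
  refine ⟨W, fun n t ht x => ?_⟩
  rw [← dist_eq_norm]
  exact dist_le_of_le_geometric_two_of_tendsto (f := fun n => V n t x)
    (fun n => by rw [dist_eq_norm]; exact h n t ht x) (hW t x ht) n

namespace GeomTendsto

variable {T c : ℝ} {V : ℕ → ℝ → E → F} {W : ℝ → E → F} (h : GeomTendsto T c V W)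
include h

theorem tendsto_div : Tendsto (fun n : ℕ => c / 2 ^ n) atTop (𝓝 0) := by
  have := (tendsto_pow_atTop_nhds_zero_of_lt_one (r := (1 / 2 : ℝ)) (by norm_num)
    (by norm_num)).const_mul c
  rw [mul_zero] at this
  refine this.congr fun n => ?_
  rw [div_pow, one_pow, mul_one_div]

theorem tendstoUniformlyOn : TendstoUniformlyOn (fun n (q : ℝ × E) => V n q.1 q.2)
    (fun q => W q.1 q.2) atTop (strip E T) := by
  rw [Metric.tendstoUniformlyOn_iff]
  intro ε hε
  filter_upwards [h.tendsto_div.eventually_lt_const hε] with n hn q hq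
  rw [dist_comm, dist_eq_norm]
  exact (h n q.1 hq.1 q.2).trans_lt hn

theorem continuousOn (hV : ∀ n, ContinuousOn (fun q : ℝ × E => V n q.1 q.2) (strip E T)) :
    ContinuousOn (fun q : ℝ × E => W q.1 q.2) (strip E T) :=
  h.tendstoUniformlyOn.continuousOn (Frequently.of_forall hV)

theorem tendsto {t : ℝ} (ht : t ∈ Ioo 0 T) (x : E) :
    Tendsto (fun n => V n t x) atTop (𝓝 (W t x)) :=
  h.tendstoUniformlyOn.tendsto_at (x := (t, x)) ⟨ht, mem_univ _⟩

theorem norm_le {b : ℝ} {t : ℝ} (ht : t ∈ Ioo 0 T) (x : E) (hb : ∀ n, ‖V n t x‖ ≤ b) :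
    ‖W t x‖ ≤ b :=
  le_of_tendsto (h.tendsto ht x).norm (Eventually.of_forall hb)

theorem hasFDerivAt {V' : ℕ → ℝ → E → E →L[ℝ] F} {W' : ℝ → E → E →L[ℝ] F}
    (h' : GeomTendsto T c V' W') {t : ℝ} (ht : t ∈ Ioo 0 T)
    (hV : ∀ n x, HasFDerivAt (V n t) (V' n t x) x) (x : E) : HasFDerivAt (W t) (W' t x) x := by
  refine hasFDerivAt_of_tendstoUniformly (l := atTop) (f := fun n => V n t)
    (f' := fun n => V' n t) ?_ hV (fun y => h.tendsto ht y) x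
  rw [Metric.tendstoUniformly_iff]
  intro ε hε
  filter_upwards [h'.tendsto_div.eventually_lt_const hε] with n hn y
  rw [dist_comm, dist_eq_norm]
  exact (h' n t ht y).trans_lt hn

end GeomTendsto

/-- The jets `U` and `U'` differ by at most `c exp (l t)`. -/
structure Jet.Near (T l c : ℝ) (U U' : Jet E G) : Prop where
  n₀ : ∀ t ∈ Ioo 0 T, ∀ x, ‖U.v₀ t x - U'.v₀ t x‖ ≤ c * Real.exp (l * t)
  n₁ : ∀ t ∈ Ioo 0 T, ∀ x, ‖U.v₁ t x - U'.v₁ t x‖ ≤ c * Real.exp (l * t)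
  n₂ : ∀ t ∈ Ioo 0 T, ∀ x, ‖U.v₂ t x - U'.v₂ t x‖ ≤ c * Real.exp (l * t)
  n₃ : ∀ t ∈ Ioo 0 T, ∀ x, ‖U.v₃ t x - U'.v₃ t x‖ ≤ c * Real.exp (l * t)

variable {T a C M B l R₁ R₂ R₃ : ℝ} {k : ℝ → E → ℝ} {φ₀ : E → G} {φ₁ : E → E →L[ℝ] G}
    {φ₂ : E → E →L[ℝ] E →L[ℝ] G}
    {φ₃ : E → E →L[ℝ] E →L[ℝ] E →L[ℝ] G} {f₀ : ℝ → E → G} {f₁ : ℝ → E → E →L[ℝ] G}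
    {f₂ : ℝ → E → E →L[ℝ] E →L[ℝ] G} {N₀ : E → G → (E →L[ℝ] G) → G}
    {N₁ : E → G → (E →L[ℝ] G) → (E →L[ℝ] E →L[ℝ] G) → E →L[ℝ] G}
    {N₂ : E → G → (E →L[ℝ] G) → (E →L[ℝ] E →L[ℝ] G) → (E →L[ℝ] E →L[ℝ] E →L[ℝ] G) →
      E →L[ℝ] E →L[ℝ] G}

variable (hk : IsHeatKernel T a C k) (ha0 : 0 < a) (ha : a < 1)
  (hφ : InitialJet M φ₀ φ₁ φ₂ φ₃) (hf : SourceJet T M f₀ f₁ f₂) (hN : IsTower B N₀ N₁ N₂)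
  (hM : 0 ≤ M) (hB : 0 ≤ B)

include hk ha hf hN hM hB in
/-- The Picard step is a contraction in a weighted norm. -/
theorem Jet.IsGood.exists_contraction (hl : 0 ≤ l) (hR1 : 0 ≤ R₁) (hR2 : 0 ≤ R₂) (hR3 : 0 ≤ R₃) :
    ∃ l', 0 ≤ l' ∧ ∀ (U U' : Jet E G) (c : ℝ), U.IsGood T l R₁ R₂ R₃ → U'.IsGood T l R₁ R₂ R₃ →
      0 ≤ c → Jet.Near T l' c U U' →
      Jet.Near T l' (c / 2) (U.step T k φ₀ φ₁ φ₂ φ₃ f₀ f₁ f₂ N₀ N₁ N₂)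
        (U'.step T k φ₀ φ₁ φ₂ φ₃ f₀ f₁ f₂ N₀ N₁ N₂) := by
  -- the Lipschitz constant on bounded sets depends on the bounds for good jets, so the weight `l'`
  -- of the contraction is chosen after the weight `l` of the bounds
  set R : ℝ := max (R₁ * Real.exp (l * T)) (max (R₂ * Real.exp (l * T)) (R₃ * Real.exp (l * T)))
  obtain ⟨K, hK0, hK⟩ := hN.lip R
  obtain ⟨l', hl', hδ⟩ := exists_weightMass_le (T := T) (C := C) ha
    (δ := 1 / (2 * (K + 1))) (by positivity)
  refine ⟨l', hl', fun U U' c hU hU' hc hnear => ?_⟩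
  have b1 : ∀ {U : Jet E G}, U.IsGood T l R₁ R₂ R₃ → ∀ t ∈ Ioo 0 T, ∀ x, ‖U.v₁ t x‖ ≤ R :=
    fun hU t ht x => (hU.b₁ t ht x).trans ((mul_exp_le_mul_exp hR1 hl ht).trans (le_max_left _ _))
  have b2 : ∀ {U : Jet E G}, U.IsGood T l R₁ R₂ R₃ → ∀ t ∈ Ioo 0 T, ∀ x, ‖U.v₂ t x‖ ≤ R :=
    fun hU t ht x => (hU.b₂ t ht x).trans ((mul_exp_le_mul_exp hR2 hl ht).trans
      ((le_max_left _ _).trans (le_max_right _ _)))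
  have b3 : ∀ {U : Jet E G}, U.IsGood T l R₁ R₂ R₃ → ∀ t ∈ Ioo 0 T, ∀ x, ‖U.v₃ t x‖ ≤ R :=
    fun hU t ht x => (hU.b₃ t ht x).trans ((mul_exp_le_mul_exp hR3 hl ht).trans
      ((le_max_right _ _).trans (le_max_right _ _)))
  have hKt := fun t (ht : t ∈ Ioo 0 T) x => hK (c * Real.exp (l' * t)) x _ _ _ _ _ _ _ _
    (b1 hU t ht x) (b1 hU' t ht x) (b2 hU t ht x) (b2 hU' t ht x) (b3 hU t ht x) (b3 hU' t ht x)
    (hnear.n₀ t ht x) (hnear.n₁ t ht x) (hnear.n₂ t ht x) (hnear.n₃ t ht x)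
  have s0 := hU.isSource_src₀ hf hN hM hB hl hR1 hR2 hR3
  have s1 := hU.isSource_src₁ hf hN hM hB hl hR1 hR2 hR3
  have s2 := hU.isSource_src₂ hf hN hM hB hl hR1 hR2 hR3
  have s0' := hU'.isSource_src₀ hf hN hM hB hl hR1 hR2 hR3
  have s1' := hU'.isSource_src₁ hf hN hM hB hl hR1 hR2 hR3
  have s2' := hU'.isSource_src₂ hf hN hM hB hl hR1 hR2 hR3
  have w0 := hk.weighted_duhamel_sub_le ha hl' s0 s0' (c := K * c) (by positivity)
    fun t ht x => by
      rw [Jet.src₀, Jet.src₀, cutTime_of_mem ht, cutTime_of_mem ht, sub_sub_sub_cancel_left,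
        norm_sub_rev, mul_assoc]
      exact (hKt t ht x).1
  have w1 := hk.weighted_duhamel_sub_le ha hl' s1 s1' (c := K * c) (by positivity)
    fun t ht x => by
      rw [Jet.src₁, Jet.src₁, cutTime_of_mem ht, cutTime_of_mem ht, sub_sub_sub_cancel_left,
        norm_sub_rev, mul_assoc]
      exact (hKt t ht x).2.1
  have w2 := hk.weighted_duhamel_sub_le ha hl' s2 s2' (c := K * c) (by positivity)
    fun t ht x => by
      rw [Jet.src₂, Jet.src₂, cutTime_of_mem ht, cutTime_of_mem ht, sub_sub_sub_cancel_left,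
        norm_sub_rev, mul_assoc]
      exact (hKt t ht x).2.2
  have hδK : weightMass T a C l' * (K * c) ≤ c / 2 := by
    calc weightMass T a C l' * (K * c) ≤ 1 / (2 * (K + 1)) * (K * c) := by gcongr
      _ = (K / (K + 1)) * (c / 2) := by field_simp
      _ ≤ 1 * (c / 2) := by
        gcongr
        rw [div_le_one (by positivity)]; linarith
      _ = c / 2 := one_mul _
  have fin : ∀ t : ℝ, weightMass T a C l' * (K * c) * Real.exp (l' * t)
      ≤ c / 2 * Real.exp (l' * t) := fun t => by gcongr
  refine ⟨fun t _ x => ?_, fun t _ x => ?_, fun t _ x => ?_, fun t _ x => ?_⟩ <;>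
    simp only [Jet.step] <;> rw [add_sub_add_left_eq_sub]
  · exact (w0 t x).1.trans (fin t)
  · exact (w1 t x).1.trans (fin t)
  · exact (w2 t x).1.trans (fin t)
  · exact (w2 t x).2.trans (fin t)

include hk ha0 ha hφ hf hN hM hB in
/-- The mild formulation of the semilinear problem has a solution with three bounded space
derivatives. -/
theorem exists_mild_solution (hl : 0 ≤ l) (hδ : weightMass T a C l ≤ 1 / (2 * (B + 1)))
    (h1 : R₁ = M + (M + B))
    (h2 : R₂ = 2 * (M + (M + B * (1 + R₁ * Real.exp (l * T)))))
    (h3 : R₃ = 2 * (M + (M + (B * (R₂ * Real.exp (l * T))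
      + B * (1 + R₁ * Real.exp (l * T) + R₂ * Real.exp (l * T)) ^ 2)))) :
    ∃ U : Jet E G, U.IsGood T l R₁ R₂ R₃ ∧ ∀ t ∈ Ioo 0 T, ∀ x,
      U.v₀ t x = heatOp k t φ₀ x + duhamel k (U.src₀ T f₀ N₀) t x := by
  have hR1 : 0 ≤ R₁ := by rw [h1]; positivity
  have hR2 : 0 ≤ R₂ := by rw [h2]; positivity
  have hR3 : 0 ≤ R₃ := by rw [h3]; positivity
  obtain ⟨l', hl', hcon⟩ := Jet.IsGood.exists_contraction (φ₀ := φ₀) (φ₁ := φ₁) (φ₂ := φ₂)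
    (φ₃ := φ₃) (l := l) hk ha hf hN hM hB hl hR1 hR2 hR3
  set Φ : Jet E G → Jet E G := fun U => U.step T k φ₀ φ₁ φ₂ φ₃ f₀ f₁ f₂ N₀ N₁ N₂ with hΦ
  -- the iterates of the zero jet converge geometrically, each component uniformly on the strip;
  -- limits of derivatives are derivatives of limits
  set Z : Jet E G := ⟨fun _ _ => 0, fun _ _ => 0, fun _ _ => 0, fun _ _ => 0⟩ with hZ
  have hZg : Z.IsGood T l R₁ R₂ R₃ := by
    refine ⟨continuousOn_const, continuousOn_const, continuousOn_const, continuousOn_const,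
      fun _ _ x => hasFDerivAt_const 0 x, fun _ _ x => hasFDerivAt_const 0 x,
      fun _ _ x => hasFDerivAt_const 0 x, ?_, ?_, ?_, ?_⟩ <;>
    · intro t _ x
      simp only [hZ, norm_zero]
      positivity
  set U : ℕ → Jet E G := fun n => Φ^[n] Z with hUdef
  have hUs : ∀ n, U (n + 1) = Φ (U n) := fun n => Function.iterate_succ_apply' Φ n Z
  have hUg : ∀ n, (U n).IsGood T l R₁ R₂ R₃ := fun n => by
    induction n with
    | zero => exact hZg
    | succ n ih =>
      rw [hUs]
      exact ih.step hk ha0 ha hφ hf hN hM hB hl hδ h1 h2 h3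
  set c₀ : ℝ := (R₁ + R₂ + R₃) * Real.exp (l * T) with hc₀
  have hc₀0 : 0 ≤ c₀ := by positivity
  have hnear : ∀ n, Jet.Near T l' (c₀ / 2 ^ n) (U n) (U (n + 1)) := fun n => by
    induction n with
    | zero =>
      have hb : ∀ {t : ℝ}, t ∈ Ioo 0 T → ∀ {r s : ℝ}, 0 ≤ s → s ≤ R₁ + R₂ + R₃ →
          r ≤ s * Real.exp (l * t) → r ≤ c₀ / 2 ^ 0 * Real.exp (l' * t) := by
        intro t ht r s hs0 hs hr
        rw [pow_zero, div_one]
        refine hr.trans ((mul_exp_le_mul_exp hs0 hl ht).trans (le_trans ?_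
          (le_mul_exp hc₀0 hl' ht)))
        rw [hc₀]; gcongr
      have hg := hUg (0 + 1)
      have e0 : U 0 = Z := rfl
      refine ⟨fun t ht x => hb ht hR1 (by linarith) ?_, fun t ht x => hb ht hR1 (by linarith) ?_,
        fun t ht x => hb ht hR2 (by linarith) ?_, fun t ht x => hb ht hR3 (by linarith) ?_⟩
      · rw [norm_sub_rev, e0]; simp only [hZ, sub_zero]; exact hg.b₀ t ht x
      · rw [norm_sub_rev, e0]; simp only [hZ, sub_zero]; exact hg.b₁ t ht x
      · rw [norm_sub_rev, e0]; simp only [hZ, sub_zero]; exact hg.b₂ t ht x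
      · rw [norm_sub_rev, e0]; simp only [hZ, sub_zero]; exact hg.b₃ t ht x
    | succ n ih =>
      have h4 := hcon (U n) (U (n + 1)) _ (hUg n) (hUg (n + 1)) (by positivity) ih
      rw [show c₀ / 2 ^ (n + 1) = c₀ / 2 ^ n / 2 by rw [pow_succ, div_div]]
      rw [hUs (n + 1)]
      nth_rw 1 [hUs n]
      exact h4
  set c := 2 * (c₀ * Real.exp (l' * T)) with hc
  have hgeo : ∀ n t, t ∈ Ioo 0 T → ∀ r : ℝ, r ≤ c₀ / 2 ^ n * Real.exp (l' * t) →
      r ≤ c / 2 / 2 ^ n := fun n t ht r hr => by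
    refine hr.trans ((mul_exp_le_mul_exp (by positivity) hl' ht).trans (le_of_eq ?_))
    rw [hc]; ring
  obtain ⟨W₀, g0⟩ := exists_geomTendsto (V := fun n => (U n).v₀)
    fun n t ht x => hgeo n t ht _ ((hnear n).n₀ t ht x)
  obtain ⟨W₁, g1⟩ := exists_geomTendsto (V := fun n => (U n).v₁)
    fun n t ht x => hgeo n t ht _ ((hnear n).n₁ t ht x)
  obtain ⟨W₂, g2⟩ := exists_geomTendsto (V := fun n => (U n).v₂)
    fun n t ht x => hgeo n t ht _ ((hnear n).n₂ t ht x)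
  obtain ⟨W₃, g3⟩ := exists_geomTendsto (V := fun n => (U n).v₃)
    fun n t ht x => hgeo n t ht _ ((hnear n).n₃ t ht x)
  set W : Jet E G := ⟨W₀, W₁, W₂, W₃⟩ with hW
  have hWg : W.IsGood T l R₁ R₂ R₃ :=
    ⟨g0.continuousOn fun n => (hUg n).c₀, g1.continuousOn fun n => (hUg n).c₁,
      g2.continuousOn fun n => (hUg n).c₂, g3.continuousOn fun n => (hUg n).c₃,
      fun t ht => g0.hasFDerivAt g1 ht fun n => (hUg n).d₀ t ht,
      fun t ht => g1.hasFDerivAt g2 ht fun n => (hUg n).d₁ t ht,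
      fun t ht => g2.hasFDerivAt g3 ht fun n => (hUg n).d₂ t ht,
      fun t ht x => g0.norm_le ht x fun n => (hUg n).b₀ t ht x,
      fun t ht x => g1.norm_le ht x fun n => (hUg n).b₁ t ht x,
      fun t ht x => g2.norm_le ht x fun n => (hUg n).b₂ t ht x,
      fun t ht x => g3.norm_le ht x fun n => (hUg n).b₃ t ht x⟩
  refine ⟨W, hWg, fun t ht x => ?_⟩
  have hc0 : 0 ≤ c := by rw [hc]; positivity
  have hnW : ∀ n, Jet.Near T l' (c / 2 ^ n) (U n) W := fun n =>
    ⟨fun t ht x => (g0 n t ht x).trans (le_mul_exp (by positivity) hl' ht),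
      fun t ht x => (g1 n t ht x).trans (le_mul_exp (by positivity) hl' ht),
      fun t ht x => (g2 n t ht x).trans (le_mul_exp (by positivity) hl' ht),
      fun t ht x => (g3 n t ht x).trans (le_mul_exp (by positivity) hl' ht)⟩
  have l1 : Tendsto (fun n => (U (n + 1)).v₀ t x) atTop (𝓝 ((Φ W).v₀ t x)) := by
    rw [tendsto_iff_norm_sub_tendsto_zero]
    refine squeeze_zero (fun _ => norm_nonneg _) (g := fun n => c / 2 ^ n / 2 * Real.exp (l' * t))
      (fun n => ?_) ?_
    · rw [hUs]
      exact (hcon (U n) W _ (hUg n) hWg (by positivity) (hnW n)).n₀ t ht x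
    · simpa using (g0.tendsto_div.div_const 2).mul_const (Real.exp (l' * t))
  exact tendsto_nhds_unique ((g0.tendsto ht x).comp (tendsto_add_atTop_nat 1)) l1

end PicardLimit

/-! ### The nonlinearity along a jet, and its truncation -/

section TowerOfJet

variable {E G W : Type*} [NormedAddCommGroup E] [NormedSpace ℝ E] [NormedAddCommGroup G]
  [NormedSpace ℝ G] [NormedAddCommGroup W] [NormedSpace ℝ W]

/-- The derivative of `x ↦ i₀ x + i₁ (v x) + i₂ (Dv x)`. -/
noncomputable def argFst (i₀ : E →L[ℝ] W) (i₁ : G →L[ℝ] W) (i₂ : (E →L[ℝ] G) →L[ℝ] W)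
    (p : E →L[ℝ] G) (q : E →L[ℝ] E →L[ℝ] G) : E →L[ℝ] W :=
  i₀ + (i₁.comp p + i₂.comp q)

/-- The second derivative of `x ↦ i₀ x + i₁ (v x) + i₂ (Dv x)`. -/
noncomputable def argSnd (i₁ : G →L[ℝ] W) (i₂ : (E →L[ℝ] G) →L[ℝ] W)
    (q : E →L[ℝ] E →L[ℝ] G) (r : E →L[ℝ] E →L[ℝ] E →L[ℝ] G) : E →L[ℝ] E →L[ℝ] W :=
  (ContinuousLinearMap.compL ℝ E G W i₁).comp q
    + (ContinuousLinearMap.compL ℝ E (E →L[ℝ] G) W i₂).comp r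

variable {i₀ : E →L[ℝ] W} {i₁ : G →L[ℝ] W} {i₂ : (E →L[ℝ] G) →L[ℝ] W}

theorem hasFDerivAt_arg {v : E → G} {v₁ : E → E →L[ℝ] G} {v₂ : E → E →L[ℝ] E →L[ℝ] G} {x : E}
    (h : HasFDerivAt v (v₁ x) x) (h' : HasFDerivAt v₁ (v₂ x) x) :
    HasFDerivAt (fun x => i₀ x + (i₁ (v x) + i₂ (v₁ x))) (argFst i₀ i₁ i₂ (v₁ x) (v₂ x)) x :=
  i₀.hasFDerivAt.fun_add ((i₁.hasFDerivAt.comp x h).fun_add (i₂.hasFDerivAt.comp x h'))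

theorem hasFDerivAt_argFst {v₁ : E → E →L[ℝ] G} {v₂ : E → E →L[ℝ] E →L[ℝ] G}
    {v₃ : E → E →L[ℝ] E →L[ℝ] E →L[ℝ] G} {x : E}
    (h : HasFDerivAt v₁ (v₂ x) x) (h' : HasFDerivAt v₂ (v₃ x) x) :
    HasFDerivAt (fun x => argFst i₀ i₁ i₂ (v₁ x) (v₂ x)) (argSnd i₁ i₂ (v₂ x) (v₃ x)) x :=
  (((ContinuousLinearMap.compL ℝ E G W i₁).hasFDerivAt.comp x h).fun_add
    ((ContinuousLinearMap.compL ℝ E (E →L[ℝ] G) W i₂).hasFDerivAt.comp x h')).const_add i₀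

section Continuity

variable {X : Type*} [TopologicalSpace X]

theorem continuous_arg {x : X → E} {u : X → G} {p : X → E →L[ℝ] G} (hx : Continuous x)
    (hu : Continuous u) (hp : Continuous p) :
    Continuous fun z => i₀ (x z) + (i₁ (u z) + i₂ (p z)) :=
  (i₀.continuous.comp hx).add ((i₁.continuous.comp hu).add (i₂.continuous.comp hp))

theorem continuous_argFst {p : X → E →L[ℝ] G} {q : X → E →L[ℝ] E →L[ℝ] G} (hp : Continuous p)
    (hq : Continuous q) : Continuous fun z => argFst i₀ i₁ i₂ (p z) (q z) :=
  continuous_const.add ((continuous_const.clm_comp hp).add (continuous_const.clm_comp hq))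

theorem continuous_argSnd {q : X → E →L[ℝ] E →L[ℝ] G} {r : X → E →L[ℝ] E →L[ℝ] E →L[ℝ] G}
    (hq : Continuous q) (hr : Continuous r) : Continuous fun z => argSnd i₁ i₂ (q z) (r z) :=
  (continuous_const.clm_comp hq).add (continuous_const.clm_comp hr)

theorem Continuous.chainSnd {A : X → W →L[ℝ] G} {S : X → W →L[ℝ] W →L[ℝ] G}
    {P : X → E →L[ℝ] W} {Q : X → E →L[ℝ] E →L[ℝ] W} (hA : Continuous A) (hS : Continuous S)
    (hP : Continuous P) (hQ : Continuous Q) :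
    Continuous fun z => _root_.chainSnd (A z) (S z) (P z) (Q z) :=
  (((ContinuousLinearMap.compL ℝ E W G).continuous.comp hA).clm_comp hQ).add
    (((ContinuousLinearMap.compL ℝ E W G).flip.continuous.comp hP).clm_comp (hS.clm_comp hP))

end Continuity

section Norms

variable (h0 : ‖i₀‖ ≤ 1) (h1 : ‖i₁‖ ≤ 1) (h2 : ‖i₂‖ ≤ 1)
include h1 h2

theorem norm_argSnd_le (q : E →L[ℝ] E →L[ℝ] G) (r : E →L[ℝ] E →L[ℝ] E →L[ℝ] G) :
    ‖argSnd i₁ i₂ q r‖ ≤ ‖q‖ + ‖r‖ := by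
  refine ContinuousLinearMap.opNorm_le_bound₂ _ (by positivity) fun x y => ?_
  change ‖i₁ (q x y) + i₂ (r x y)‖ ≤ _
  calc _ ≤ 1 * (‖q‖ * ‖x‖ * ‖y‖) + 1 * (‖r‖ * ‖x‖ * ‖y‖) := by
        refine (norm_add_le _ _).trans (add_le_add ((i₁.le_opNorm _).trans ?_)
          ((i₂.le_opNorm _).trans ?_))
        · gcongr; exact q.le_opNorm₂ x y
        · gcongr; exact r.le_opNorm₂ x y
    _ = _ := by ring

theorem norm_arg_sub_le (x : E) (u u' : G) (p p' : E →L[ℝ] G) :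
    ‖(i₀ x + (i₁ u + i₂ p)) - (i₀ x + (i₁ u' + i₂ p'))‖ ≤ ‖u - u'‖ + ‖p - p'‖ := by
  have e : (i₀ x + (i₁ u + i₂ p)) - (i₀ x + (i₁ u' + i₂ p')) = i₁ (u - u') + i₂ (p - p') := by
    rw [map_sub, map_sub]; abel
  rw [e]
  refine (norm_add_le _ _).trans (add_le_add ((i₁.le_opNorm _).trans ?_)
    ((i₂.le_opNorm _).trans ?_))
  · exact mul_le_of_le_one_left (norm_nonneg _) h1
  · exact mul_le_of_le_one_left (norm_nonneg _) h2

theorem norm_comp_add_comp_le (p : E →L[ℝ] G) (q : E →L[ℝ] E →L[ℝ] G) :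
    ‖i₁.comp p + i₂.comp q‖ ≤ ‖p‖ + ‖q‖ := by
  refine (norm_add_le _ _).trans (add_le_add ((ContinuousLinearMap.opNorm_comp_le _ _).trans ?_)
    ((ContinuousLinearMap.opNorm_comp_le _ _).trans ?_))
  · exact mul_le_of_le_one_left (norm_nonneg _) h1
  · exact mul_le_of_le_one_left (norm_nonneg _) h2

theorem norm_argFst_sub_le (p p' : E →L[ℝ] G) (q q' : E →L[ℝ] E →L[ℝ] G) :
    ‖argFst i₀ i₁ i₂ p q - argFst i₀ i₁ i₂ p' q'‖ ≤ ‖p - p'‖ + ‖q - q'‖ := by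
  have e : argFst i₀ i₁ i₂ p q - argFst i₀ i₁ i₂ p' q'
      = i₁.comp (p - p') + i₂.comp (q - q') := by
    rw [argFst, argFst, ContinuousLinearMap.comp_sub, ContinuousLinearMap.comp_sub]; abel
  rw [e]
  exact norm_comp_add_comp_le h1 h2 _ _

theorem norm_argSnd_sub_le (q q' : E →L[ℝ] E →L[ℝ] G) (r r' : E →L[ℝ] E →L[ℝ] E →L[ℝ] G) :
    ‖argSnd i₁ i₂ q r - argSnd i₁ i₂ q' r'‖ ≤ ‖q - q'‖ + ‖r - r'‖ := by
  have e : argSnd i₁ i₂ q r - argSnd i₁ i₂ q' r' = argSnd i₁ i₂ (q - q') (r - r') := by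
    rw [argSnd, argSnd, argSnd, ContinuousLinearMap.comp_sub, ContinuousLinearMap.comp_sub]; abel
  rw [e]
  exact norm_argSnd_le h1 h2 _ _

include h0

theorem norm_argFst_le (p : E →L[ℝ] G) (q : E →L[ℝ] E →L[ℝ] G) :
    ‖argFst i₀ i₁ i₂ p q‖ ≤ 1 + ‖p‖ + ‖q‖ := by
  rw [add_assoc]
  exact (norm_add_le _ _).trans (add_le_add h0 (norm_comp_add_comp_le h1 h2 p q))

/-- The expressions for the first two derivatives of `x ↦ h(x, v(x), Dv(x))` are Lipschitz on
bounded sets of jets. -/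
theorem BoundedJet.lip_tower {B : ℝ} {h : W → G} {h₁ : W → W →L[ℝ] G}
    {h₂ : W → W →L[ℝ] W →L[ℝ] G} (hj : BoundedJet univ B h h₁ h₂) (R : ℝ) :
    ∃ K, 0 ≤ K ∧ ∀ (η : ℝ) (x : E) (u u' : G) (p p' : E →L[ℝ] G) (q q' : E →L[ℝ] E →L[ℝ] G)
      (r r' : E →L[ℝ] E →L[ℝ] E →L[ℝ] G), ‖p‖ ≤ R → ‖p'‖ ≤ R → ‖q‖ ≤ R → ‖q'‖ ≤ R →
      ‖r‖ ≤ R → ‖r'‖ ≤ R → ‖u - u'‖ ≤ η → ‖p - p'‖ ≤ η → ‖q - q'‖ ≤ η → ‖r - r'‖ ≤ η →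
      ‖h (i₀ x + (i₁ u + i₂ p)) - h (i₀ x + (i₁ u' + i₂ p'))‖ ≤ K * η ∧
      ‖(h₁ (i₀ x + (i₁ u + i₂ p))).comp (argFst i₀ i₁ i₂ p q)
        - (h₁ (i₀ x + (i₁ u' + i₂ p'))).comp (argFst i₀ i₁ i₂ p' q')‖ ≤ K * η ∧
      ‖chainSnd (h₁ (i₀ x + (i₁ u + i₂ p))) (h₂ (i₀ x + (i₁ u + i₂ p)))
        (argFst i₀ i₁ i₂ p q) (argSnd i₁ i₂ q r)
        - chainSnd (h₁ (i₀ x + (i₁ u' + i₂ p'))) (h₂ (i₀ x + (i₁ u' + i₂ p')))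
        (argFst i₀ i₁ i₂ p' q') (argSnd i₁ i₂ q' r')‖ ≤ K * η := by
  have hB := hj.nonneg
  set P : ℝ := 1 + |R| + |R| with hP
  set Q : ℝ := |R| + |R| with hQ
  refine ⟨2 * B * (1 + P + Q + P ^ 2 + 2 * P), by positivity, ?_⟩
  intro η x u u' p p' q q' r r' hp hp' hq hq' hr hr' du dp dq dr
  have hη : 0 ≤ η := (norm_nonneg _).trans du
  have hR := le_abs_self R
  have a0 : ‖(i₀ x + (i₁ u + i₂ p)) - (i₀ x + (i₁ u' + i₂ p'))‖ ≤ 2 * η :=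
    (norm_arg_sub_le h1 h2 x u u' p p').trans (by linarith)
  have a1 : ‖argFst i₀ i₁ i₂ p q - argFst i₀ i₁ i₂ p' q'‖ ≤ 2 * η :=
    (norm_argFst_sub_le h1 h2 p p' q q').trans (by linarith)
  have a2 : ‖argSnd i₁ i₂ q r - argSnd i₁ i₂ q' r'‖ ≤ 2 * η :=
    (norm_argSnd_sub_le h1 h2 q q' r r').trans (by linarith)
  have b1 : ‖argFst i₀ i₁ i₂ p q‖ ≤ P := (norm_argFst_le h0 h1 h2 p q).trans (by
    rw [hP]; linarith)
  have b1' : ‖argFst i₀ i₁ i₂ p' q'‖ ≤ P := (norm_argFst_le h0 h1 h2 p' q').trans (by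
    rw [hP]; linarith)
  have b2 : ‖argSnd i₁ i₂ q r‖ ≤ Q := (norm_argSnd_le h1 h2 q r).trans (by
    rw [hQ]; linarith)
  set w := i₀ x + (i₁ u + i₂ p)
  set w' := i₀ x + (i₁ u' + i₂ p')
  set p1 := argFst i₀ i₁ i₂ p q
  set p1' := argFst i₀ i₁ i₂ p' q'
  set p2 := argSnd i₁ i₂ q r
  set p2' := argSnd i₁ i₂ q' r'
  have hP0 : 0 ≤ P := by positivity
  have hQ0 : 0 ≤ Q := by positivity
  have g0 : ‖h w - h w'‖ ≤ B * (2 * η) :=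
    (norm_sub_le_of_hasFDerivAt hj.hasFDerivAt (fun z => hj.bound₁ z (mem_univ _)) w w').trans
      (by gcongr)
  have g1 : ‖h₁ w - h₁ w'‖ ≤ B * (2 * η) :=
    (hj.lipschitz₁ w (mem_univ _) w' (mem_univ _)).trans (by gcongr)
  have g2 : ‖h₂ w - h₂ w'‖ ≤ B * (2 * η) :=
    (hj.lipschitz₂ w (mem_univ _) w' (mem_univ _)).trans (by gcongr)
  have m1 := hj.bound₁ w' (mem_univ _)
  have m2 := hj.bound₂ w' (mem_univ _)
  have hBη : 0 ≤ B * η := by positivity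
  refine ⟨g0.trans ?_, ?_, ?_⟩
  · have : 0 ≤ P + Q + P ^ 2 + 2 * P := by positivity
    nlinarith
  · have e : (h₁ w).comp p1 - (h₁ w').comp p1'
        = (h₁ w - h₁ w').comp p1 + (h₁ w').comp (p1 - p1') := by
      rw [ContinuousLinearMap.comp_sub, ContinuousLinearMap.sub_comp]; abel
    rw [e]
    calc _ ≤ B * (2 * η) * P + B * (2 * η) := by
          refine (norm_add_le _ _).trans (add_le_add
            ((ContinuousLinearMap.opNorm_comp_le _ _).trans ?_)
            ((ContinuousLinearMap.opNorm_comp_le _ _).trans ?_)) <;> gcongr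
      _ ≤ _ := by
          have : 0 ≤ B * η * (Q + P ^ 2 + 2 * P) := by positivity
          nlinarith
  · refine (norm_chainSnd_sub_le _ _ _ _ _ _ _ _).trans ?_
    calc _ ≤ (B * (2 * η) * Q + B * (2 * η)) + (B * (2 * η) * P ^ 2 + B * (2 * η) * (P + P)) := by
          gcongr
      _ ≤ _ := by
          have : 0 ≤ B * η * P := by positivity
          nlinarith

/-- A bounded function with bounded jet, evaluated at `(x, v, Dv)`, is a nonlinearity as in the
Picard iteration. -/
theorem BoundedJet.isTower {B : ℝ} {h : W → G} {h₁ : W → W →L[ℝ] G} {h₂ : W → W →L[ℝ] W →L[ℝ] G}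
    (hj : BoundedJet univ B h h₁ h₂) (hb : ∀ w, ‖h w‖ ≤ B) :
    IsTower (E := E) B (fun x u p => h (i₀ x + (i₁ u + i₂ p)))
      (fun x u p q => (h₁ (i₀ x + (i₁ u + i₂ p))).comp (argFst i₀ i₁ i₂ p q))
      (fun x u p q r => chainSnd (h₁ (i₀ x + (i₁ u + i₂ p))) (h₂ (i₀ x + (i₁ u + i₂ p)))
        (argFst i₀ i₁ i₂ p q) (argSnd i₁ i₂ q r)) := by
  have hB := hj.nonneg
  have c0 : Continuous h := continuous_iff_continuousAt.2 fun w => (hj.hasFDerivAt w).continuousAt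
  have c1 : Continuous h₁ := continuous_iff_continuousAt.2 fun w =>
    (hj.hasFDerivAt' w).continuousAt
  have c2 : Continuous h₂ := hj.continuous₂
  refine ⟨?_, ?_, ?_, fun v v₁ v₂ h h' x => ?_, fun v v₁ v₂ v₃ h h' h'' x => ?_,
    fun x u p => hb _, fun x u p q => ?_, fun x u p q r => ?_, hj.lip_tower h0 h1 h2⟩
  · exact c0.comp (continuous_arg continuous_fst continuous_snd.fst continuous_snd.snd)
  · exact (c1.comp (continuous_arg continuous_fst continuous_snd.fst
      continuous_snd.snd.fst)).clm_comp
      (continuous_argFst continuous_snd.snd.fst continuous_snd.snd.snd)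
  · have hJ := continuous_arg (i₀ := i₀) (i₁ := i₁) (i₂ := i₂)
      (continuous_fst (X := E) (Y := G × (E →L[ℝ] G) × (E →L[ℝ] E →L[ℝ] G) ×
        (E →L[ℝ] E →L[ℝ] E →L[ℝ] G))) continuous_snd.fst continuous_snd.snd.fst
    exact (c1.comp hJ).chainSnd (c2.comp hJ)
      (continuous_argFst continuous_snd.snd.fst continuous_snd.snd.snd.fst)
      (continuous_argSnd continuous_snd.snd.snd.fst continuous_snd.snd.snd.snd)
  · exact (hj.hasFDerivAt _).comp x (hasFDerivAt_arg (h x) (h' x))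
  · exact HasFDerivAt.chainSnd ((hj.hasFDerivAt' _).comp x (hasFDerivAt_arg (h x) (h' x)))
      (hasFDerivAt_argFst (h' x) (h'' x))
  · refine (ContinuousLinearMap.opNorm_comp_le _ _).trans ?_
    exact mul_le_mul (hj.bound₁ _ (mem_univ _)) (norm_argFst_le h0 h1 h2 p q) (norm_nonneg _) hB
  · refine (norm_chainSnd_le _ _ _ _).trans ?_
    have e1 := hj.bound₁ (i₀ x + (i₁ u + i₂ p)) (mem_univ _)
    have e2 := hj.bound₂ (i₀ x + (i₁ u + i₂ p)) (mem_univ _)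
    have e3 := norm_argFst_le h0 h1 h2 p q
    have e4 := norm_argSnd_le h1 h2 q r
    gcongr

end Norms

end TowerOfJet

section Truncation

variable {d : ℕ}

/-- On a bounded range of `u` and `p` the bounds on the derivatives of `H` up to the third order
make its jet bounded; the range is convex, so the mean value theorem applies. -/
theorem Hamiltonian.boundedJet {H : Rd d × ℝ × Rd d → ℝ} {C A : ℝ → ℝ} {γ : ℝ}
    (hH : Hamiltonian H C A γ) {R : ℝ} (hR : 0 < R) :
    BoundedJet (univ ×ˢ (Icc (-R) R ×ˢ ball (0 : Rd d) R)) (max (C R) 0) H (fderiv ℝ H)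
      (fderiv ℝ (fderiv ℝ H)) := by
  have h1 : ContDiff ℝ 2 (fderiv ℝ H) := hH.contDiff.fderiv_right (by norm_num)
  have h2 : ContDiff ℝ 1 (fderiv ℝ (fderiv ℝ H)) := h1.fderiv_right (by norm_num)
  have hs : Convex ℝ ((univ : Set (Rd d)) ×ˢ (Icc (-R) R ×ˢ ball (0 : Rd d) R)) :=
    convex_univ.prod ((convex_Icc _ _).prod (convex_ball _ _))
  have hb : ∀ w ∈ (univ : Set (Rd d)) ×ˢ (Icc (-R) R ×ˢ ball (0 : Rd d) R), ∀ j ≤ 3,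
      ‖iteratedFDeriv ℝ j H w‖ ≤ max (C R) 0 := fun w hw j hj =>
    (hH.bound R hR w.1 w.2.1 hw.2.1 w.2.2 hw.2.2 j hj).trans (le_max_left _ _)
  refine BoundedJet.mk' (fun w => (hH.contDiff.differentiable (by norm_num) w).hasFDerivAt)
    (fun w => (h1.differentiable (by norm_num) w).hasFDerivAt) hs (fun w hw => ?_)
    (fun w hw => ?_) (fun w hw w' hw' => ?_)
  · have := hb w hw 1 (by norm_num)
    rwa [← norm_iteratedFDeriv_fderiv, norm_iteratedFDeriv_zero] at this
  · have := hb w hw 2 (by norm_num)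
    rwa [← norm_iteratedFDeriv_fderiv, ← norm_iteratedFDeriv_fderiv,
      norm_iteratedFDeriv_zero] at this
  · refine hs.norm_image_sub_le_of_norm_fderiv_le
      (fun z _ => h2.differentiable one_ne_zero z) (fun z hz => ?_) hw' hw
    have := hb z hz 3 le_rfl
    rwa [← norm_iteratedFDeriv_fderiv, ← norm_iteratedFDeriv_fderiv,
      ← norm_iteratedFDeriv_fderiv, norm_iteratedFDeriv_zero] at this

/-- A smooth monotone truncation of the real line. -/
theorem exists_truncation_real {R₀ : ℝ} (h0 : 0 ≤ R₀) :
    ∃ (θ : ℝ → ℝ) (R B : ℝ) (θ₁ : ℝ → ℝ →L[ℝ] ℝ) (θ₂ : ℝ → ℝ →L[ℝ] ℝ →L[ℝ] ℝ),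
      BoundedJet univ B θ θ₁ θ₂ ∧ (∀ u, |θ u| ≤ R) ∧ (∀ u, |u| ≤ R₀ → θ u = u) ∧
      ∀ u v, u ≤ v → 0 ≤ θ v - θ u ∧ θ v - θ u ≤ v - u := by
  -- a primitive of a bump is monotone, bounded, and the identity where the bump is one
  let χ : ContDiffBump (0 : ℝ) := ⟨R₀ + 1, R₀ + 2, by linarith, by linarith⟩
  have hc : Continuous χ := χ.continuous
  have hi : Integrable χ := hc.integrable_of_hasCompactSupport χ.hasCompactSupport
  set θ : ℝ → ℝ := fun u => ∫ s in (0 : ℝ)..u, χ s with hθ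
  have hd : ∀ u, HasDerivAt θ (χ u) u := fun u =>
    intervalIntegral.integral_hasDerivAt_right (hc.intervalIntegrable _ _)
      (hc.stronglyMeasurableAtFilter _ _) hc.continuousAt
  have hderiv : deriv θ = χ := funext fun u => (hd u).deriv
  have hdiff : Differentiable ℝ θ := fun u => (hd u).differentiableAt
  have hθ3 : ContDiff ℝ 3 θ := by
    rw [show (3 : WithTop ℕ∞) = 2 + 1 by norm_num, contDiff_succ_iff_deriv]
    exact ⟨hdiff, fun h => by simp at h, hderiv ▸ χ.contDiff⟩
  have hs : HasCompactSupport (fderiv ℝ θ) := by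
    refine HasCompactSupport.intro (isCompact_closedBall (0 : ℝ) (R₀ + 2)) fun u hu => ?_
    have h1 : χ u = 0 := χ.zero_of_le_dist (by
      have : ¬ dist u 0 ≤ R₀ + 2 := hu
      exact (not_le.1 this).le)
    rw [(hd u).hasFDerivAt.fderiv, h1]
    ext; simp
  obtain ⟨B, hB⟩ := HasCompactSupport.exists_boundedJet hθ3 hs
  refine ⟨θ, ∫ s, ‖χ s‖, B, _, _, hB, fun u => ?_, fun u hu => ?_, fun u v huv => ?_⟩
  · rw [← Real.norm_eq_abs]
    exact intervalIntegral.norm_integral_le_integral_norm_uIoc.trans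
      (setIntegral_le_integral hi.norm (ae_of_all _ fun _ => norm_nonneg _))
  · have h2 : ∫ s in (0 : ℝ)..u, χ s = ∫ s in (0 : ℝ)..u, (1 : ℝ) := by
      refine intervalIntegral.integral_congr fun s hs => χ.one_of_mem_closedBall ?_
      rw [mem_closedBall, Real.dist_eq, sub_zero]
      have h3 : |s - 0| ≤ |u - 0| := abs_sub_left_of_mem_uIcc hs
      rw [sub_zero, sub_zero] at h3
      change |s| ≤ R₀ + 1
      linarith
    rw [hθ]
    simp only [h2, intervalIntegral.integral_const, sub_zero, smul_eq_mul, mul_one]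
  · have h2 : θ v - θ u = ∫ s in u..v, χ s :=
      intervalIntegral.integral_interval_sub_left (hc.intervalIntegrable _ _)
        (hc.intervalIntegrable _ _)
    rw [h2]
    refine ⟨intervalIntegral.integral_nonneg huv fun s _ => χ.nonneg, ?_⟩
    calc ∫ s in u..v, χ s ≤ ∫ s in u..v, (1 : ℝ) :=
          intervalIntegral.integral_mono_on huv (hc.intervalIntegrable _ _)
            intervalIntegrable_const fun s _ => χ.le_one
      _ = v - u := by simp

/-- A smooth truncation of the Euclidean space. -/
theorem exists_truncation_vector (d : ℕ) {R₁ : ℝ} (h0 : 0 ≤ R₁) :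
    ∃ (ϑ : Rd d → Rd d) (B : ℝ) (ϑ₁ : Rd d → Rd d →L[ℝ] Rd d)
      (ϑ₂ : Rd d → Rd d →L[ℝ] Rd d →L[ℝ] Rd d),
      BoundedJet univ B ϑ ϑ₁ ϑ₂ ∧ (∀ p, ‖ϑ p‖ < R₁ + 2) ∧ (∀ p, ‖p‖ ≤ R₁ → ϑ p = p) ∧
      ∀ p, ‖ϑ p‖ ≤ ‖p‖ := by
  let χ : ContDiffBump (0 : Rd d) := ⟨R₁ + 1, R₁ + 2, by linarith, by linarith⟩
  have hc : ContDiff ℝ 3 fun p => χ p • p := χ.contDiff.smul contDiff_id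
  have hs : HasCompactSupport fun p => χ p • p := χ.hasCompactSupport.smul_right
  obtain ⟨B, hB⟩ := HasCompactSupport.exists_boundedJet hc (hs.fderiv ℝ)
  have hle : ∀ p, ‖χ p • p‖ ≤ ‖p‖ := fun p => by
    rw [norm_smul, Real.norm_of_nonneg χ.nonneg]
    exact mul_le_of_le_one_left (norm_nonneg _) χ.le_one
  refine ⟨fun p => χ p • p, B, _, _, hB, fun p => ?_, fun p hp => ?_, hle⟩
  · by_cases hp : ‖p‖ < R₁ + 2
    · exact (hle p).trans_lt hp
    · have h1 : χ p = 0 := χ.zero_of_le_dist (by rw [dist_zero_right]; exact not_lt.1 hp)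
      change ‖χ p • p‖ < R₁ + 2
      rw [h1, zero_smul, norm_zero]; linarith
  · have h1 : χ p = 1 := χ.one_of_mem_closedBall (by
      rw [mem_closedBall, dist_zero_right]; change ‖p‖ ≤ R₁ + 1; linarith)
    simp only [h1, one_smul]

/-- The gradient that corresponds to a linear form. -/
noncomputable def gradOfDual (d : ℕ) : (Rd d →L[ℝ] ℝ) →L[ℝ] Rd d :=
  LinearMap.mkContinuous
    { toFun := (InnerProductSpace.toDual ℝ (Rd d)).symm
      map_add' := fun p q => map_add _ p q
      map_smul' := fun c p => by simp } 1 fun p => by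
      rw [one_mul]; exact ((InnerProductSpace.toDual ℝ (Rd d)).symm.norm_map p).le

theorem norm_gradOfDual (p : Rd d →L[ℝ] ℝ) : ‖gradOfDual d p‖ = ‖p‖ :=
  (InnerProductSpace.toDual ℝ (Rd d)).symm.norm_map p

theorem gradient_eq_gradOfDual (φ : Rd d → ℝ) (x : Rd d) :
    gradient φ x = gradOfDual d (fderiv ℝ φ x) := rfl

/-- The truncated Hamiltonian has a bounded jet, with a bound that depends only on the truncation
and on the constants of the Hamiltonian. -/
theorem exists_boundedJet_truncated (C : ℝ → ℝ) {θ : ℝ → ℝ} {ϑ : Rd d → Rd d} {R B B' R₁ : ℝ}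
    {θ₁ : ℝ → ℝ →L[ℝ] ℝ} {θ₂ : ℝ → ℝ →L[ℝ] ℝ →L[ℝ] ℝ} (hθ : BoundedJet univ B θ θ₁ θ₂)
    (hθR : ∀ u, |θ u| ≤ R) {ϑ₁ : Rd d → Rd d →L[ℝ] Rd d}
    {ϑ₂ : Rd d → Rd d →L[ℝ] Rd d →L[ℝ] Rd d} (hϑ : BoundedJet univ B' ϑ ϑ₁ ϑ₂)
    (hϑR : ∀ p, ‖ϑ p‖ < R₁) :
    ∃ K, ∀ (H : Rd d × ℝ × Rd d → ℝ) (A : ℝ → ℝ) (γ : ℝ), Hamiltonian H C A γ →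
      ∃ h₁ h₂, BoundedJet univ K
        (fun w : Rd d × ℝ × (Rd d →L[ℝ] ℝ) => H (w.1, θ w.2.1, ϑ (gradOfDual d w.2.2))) h₁ h₂ ∧
        ∀ w : Rd d × ℝ × (Rd d →L[ℝ] ℝ), ‖H (w.1, θ w.2.1, ϑ (gradOfDual d w.2.2))‖ ≤ K := by
  let W := Rd d × ℝ × (Rd d →L[ℝ] ℝ)
  let V := Rd d × ℝ × Rd d
  let π₀ : W →L[ℝ] Rd d := ContinuousLinearMap.fst ℝ _ _
  let π₁ : W →L[ℝ] ℝ := (ContinuousLinearMap.fst ℝ _ _).comp (ContinuousLinearMap.snd ℝ _ _)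
  let π₂ : W →L[ℝ] Rd d := (gradOfDual d).comp
    ((ContinuousLinearMap.snd ℝ _ _).comp (ContinuousLinearMap.snd ℝ _ _))
  let j₀ : Rd d →L[ℝ] V := ContinuousLinearMap.inl ℝ _ _
  let j₁ : ℝ →L[ℝ] V := (ContinuousLinearMap.inr ℝ _ _).comp (ContinuousLinearMap.inl ℝ _ _)
  let j₂ : Rd d →L[ℝ] V := (ContinuousLinearMap.inr ℝ _ _).comp (ContinuousLinearMap.inr ℝ _ _)
  -- the map `(x, u, p) ↦ (x, θ u, ϑ p)` as the sum of its three components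
  have J := (BoundedJet.clm (j₀.comp π₀)).add
    ((BoundedJet.comp (norm_nonneg _) (BoundedJet.clm j₁)
      (BoundedJet.comp hθ.nonneg hθ (BoundedJet.clm π₁) fun _ => mem_univ _)
      fun _ => mem_univ _).add
    (BoundedJet.comp (norm_nonneg _) (BoundedJet.clm j₂)
      (BoundedJet.comp hϑ.nonneg hϑ (BoundedJet.clm π₂) fun _ => mem_univ _)
      fun _ => mem_univ _))
  have hval : ∀ w : W, (j₀.comp π₀) w + (j₁ (θ (π₁ w)) + j₂ (ϑ (π₂ w)))
      = (w.1, θ w.2.1, ϑ (gradOfDual d w.2.2)) := fun w => by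
    change ((w.1, (0 : ℝ), (0 : Rd d)) : Rd d × ℝ × Rd d) + (((0 : Rd d), θ w.2.1, (0 : Rd d))
      + ((0 : Rd d), (0 : ℝ), ϑ (gradOfDual d w.2.2))) = _
    simp
  set D := ‖j₀.comp π₀‖ + (‖j₁‖ * (1 + B * (1 + ‖π₁‖) ^ 3) ^ 3
    + ‖j₂‖ * (1 + B' * (1 + ‖π₂‖) ^ 3) ^ 3) with hD
  have hD0 : 0 ≤ D := J.nonneg
  set R' := max (max R R₁) 1 with hR'
  have hR'0 : 0 < R' := lt_of_lt_of_le one_pos (le_max_right _ _)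
  have hmem : ∀ w : W, (w.1, θ w.2.1, ϑ (gradOfDual d w.2.2))
      ∈ (univ : Set (Rd d)) ×ˢ (Icc (-R') R' ×ˢ ball (0 : Rd d) R') := fun w => by
    refine ⟨mem_univ _, ?_, ?_⟩
    · exact abs_le.1 ((hθR _).trans ((le_max_left _ _).trans (le_max_left _ _)))
    · rw [mem_ball, dist_zero_right]
      exact (hϑR _).trans_le ((le_max_right _ _).trans (le_max_left _ _))
  refine ⟨max (C R') 0 * (1 + D) ^ 3, fun H A γ hH => ?_⟩
  have hj := BoundedJet.comp (le_max_right _ _) (hH.boundedJet hR'0) J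
    (fun w => by rw [hval]; exact hmem w)
  simp only [hval] at hj
  refine ⟨_, _, hj, fun w => ?_⟩
  have h1 := hH.bound R' hR'0 w.1 _ (hmem w).2.1 _ (hmem w).2.2 0 (by norm_num)
  rw [norm_iteratedFDeriv_zero] at h1
  refine (h1.trans (le_max_left _ 0)).trans (le_mul_of_one_le_right (le_max_right _ _) ?_)
  exact one_le_pow₀ (by linarith)

end Truncation

/-! ### Solutions for bounded nonlinearities -/

section RegularSolution

variable {d : ℕ} {μ : Measure (Rd d)} {Λ σ T : ℝ} {𝒦 : ℕ → ℝ → ℝ}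

theorem InitialJet.hasLipschitzDeriv {M : ℝ} {φ₀ : Rd d → ℝ} {φ₁ : Rd d → Rd d →L[ℝ] ℝ}
    {φ₂ : Rd d → Rd d →L[ℝ] Rd d →L[ℝ] ℝ} {φ₃ : Rd d → Rd d →L[ℝ] Rd d →L[ℝ] Rd d →L[ℝ] ℝ}
    (h : InitialJet M φ₀ φ₁ φ₂ φ₃) : HasLipschitzDeriv M φ₀ φ₁ :=
  ⟨h.d₀, h.b₀, h.b₁, norm_sub_le_of_hasFDerivAt h.d₁ h.b₂⟩

theorem SourceAndInitial.initialJet {f : ℝ → Rd d → ℝ} {u₀ : Rd d → ℝ} {M L M₂ M₃ : ℝ}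
    (h : SourceAndInitial T f u₀ M L M₂ M₃) :
    InitialJet M₃ u₀ (fderiv ℝ u₀) (fderiv ℝ (fderiv ℝ u₀))
      (fderiv ℝ (fderiv ℝ (fderiv ℝ u₀))) := by
  have h1 : ContDiff ℝ 2 (fderiv ℝ u₀) := h.u₀_contDiff.fderiv_right (by norm_num)
  have h2 : ContDiff ℝ 1 (fderiv ℝ (fderiv ℝ u₀)) := h1.fderiv_right (by norm_num)
  refine ⟨fun x => (h.u₀_contDiff.differentiable (by norm_num) x).hasFDerivAt,
    fun x => (h1.differentiable (by norm_num) x).hasFDerivAt,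
    fun x => (h2.differentiable one_ne_zero x).hasFDerivAt,
    h2.continuous_fderiv one_ne_zero, fun x => ?_, fun x => ?_, fun x => ?_, fun x => ?_⟩
  · have := h.u₀_deriv_bound x 0 (by norm_num)
    rwa [norm_iteratedFDeriv_zero] at this
  · have := h.u₀_deriv_bound x 1 (by norm_num)
    rwa [← norm_iteratedFDeriv_fderiv, norm_iteratedFDeriv_zero] at this
  · have := h.u₀_deriv_bound x 2 (by norm_num)
    rwa [← norm_iteratedFDeriv_fderiv, ← norm_iteratedFDeriv_fderiv,
      norm_iteratedFDeriv_zero] at this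
  · have := h.u₀_deriv_bound x 3 le_rfl
    rwa [← norm_iteratedFDeriv_fderiv, ← norm_iteratedFDeriv_fderiv,
      ← norm_iteratedFDeriv_fderiv, norm_iteratedFDeriv_zero] at this

theorem SourceAndInitial.sourceJet {f : ℝ → Rd d → ℝ} {u₀ : Rd d → ℝ} {M L M₂ M₃ : ℝ}
    (h : SourceAndInitial T f u₀ M L M₂ M₃) :
    SourceJet T M₂ f (fun t => fderiv ℝ (f t)) (fun t => fderiv ℝ (fderiv ℝ (f t))) := by
  have hI : ∀ {t}, t ∈ Ioo 0 T → t ∈ Icc 0 T := fun ht => Ioo_subset_Icc_self ht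
  have c0 : ContinuousOn (fun q : ℝ × Rd d => f q.1 q.2) (strip (Rd d) T) :=
    h.f_continuous.mono fun q hq => ⟨hI hq.1, mem_univ _⟩
  have d0 : ∀ t ∈ Ioo 0 T, ∀ x, HasFDerivAt (f t) (fderiv ℝ (f t) x) x := fun t ht x =>
    ((h.f_contDiff t (hI ht)).differentiable (by norm_num) x).hasFDerivAt
  have d1 : ∀ t ∈ Ioo 0 T, ∀ x,
      HasFDerivAt (fderiv ℝ (f t)) (fderiv ℝ (fderiv ℝ (f t)) x) x := fun t ht x =>
    (((h.f_contDiff t (hI ht)).fderiv_right (m := 1) (by norm_num)).differentiable one_ne_zero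
      x).hasFDerivAt
  have b2 : ∀ t ∈ Ioo 0 T, ∀ x, ‖fderiv ℝ (fderiv ℝ (f t)) x‖ ≤ M₂ := fun t ht x => by
    have := h.f_deriv_bound t (hI ht) x 2 le_rfl
    rwa [← norm_iteratedFDeriv_fderiv, ← norm_iteratedFDeriv_fderiv,
      norm_iteratedFDeriv_zero] at this
  have c1 : ContinuousOn (fun q : ℝ × Rd d => fderiv ℝ (f q.1) q.2) (strip (Rd d) T) :=
    continuousOn_strip_of_holder (α := 1) (K := M₂) one_pos c0 d0 fun t ht x y => by
      rw [Real.rpow_one]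
      exact norm_sub_le_of_hasFDerivAt (d1 t ht) (b2 t ht) x y
  have : SecondCountableTopology (Rd d →L[ℝ] ℝ) := by
    have : ProperSpace (Rd d →L[ℝ] ℝ) := FiniteDimensional.proper ℝ _
    infer_instance
  refine ⟨c0, c1, stronglyMeasurable_fderiv_strip (w := fun t => fderiv ℝ (f t)) c1, d0, d1,
    fun t ht x => ?_, fun t ht x => ?_, b2⟩
  · have := h.f_deriv_bound t (hI ht) x 0 (by norm_num)
    rwa [norm_iteratedFDeriv_zero] at this
  · have := h.f_deriv_bound t (hI ht) x 1 (by norm_num)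
    rwa [← norm_iteratedFDeriv_fderiv, norm_iteratedFDeriv_zero] at this

/-- The arguments `(x, u, Du)` of the nonlinearity, with the gradient as a linear form. -/
abbrev Args (d : ℕ) : Type := Rd d × ℝ × (Rd d →L[ℝ] ℝ)

/-- A solution `u` of `∂ₜu - L u + h(x, u, Du) = f` with the time derivative `ρ`, which on `(0,T)`
is the first component of the jet `U`. -/
structure IsRegularSolution (T : ℝ) (μ : Measure (Rd d)) (h : Args d → ℝ)
    (f : ℝ → Rd d → ℝ) (u₀ : Rd d → ℝ) (l R₁ R₂ R₃ R : ℝ) (U : Jet (Rd d) ℝ)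
    (u ρ : ℝ → Rd d → ℝ) : Prop where
  good : U.IsGood T l R₁ R₂ R₃
  eq_jet : ∀ t ∈ Ioo 0 T, u t = U.v₀ t
  continuousOn : ContinuousOn (fun q : ℝ × Rd d => u q.1 q.2) (Icc 0 T ×ˢ univ)
  hasDerivAt : ∀ t ∈ Ioo 0 T, ∀ x, HasDerivAt (fun s => u s x) (ρ t x) t
  continuousOn_rate : ContinuousOn (fun q : ℝ × Rd d => ρ q.1 q.2) (strip (Rd d) T)
  rate_le : ∀ t ∈ Ioo 0 T, ∀ x, |ρ t x| ≤ R
  levyOp_apply : ∀ t ∈ Ioo 0 T, ∀ x,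
    levyOp μ (u t) x = ρ t x - (f t x - h (x, u t x, U.v₁ t x))
  initial : ∀ x, u 0 x = u₀ x

/-- A mild solution for a bounded nonlinearity with bounded jet is regular. The jet of the Picard
iteration lives on `(0,T)` only; the solution is defined as `u₀ + ∫₀ᵗ ρ`, which agrees with it there
and is continuous up to the times `0` and `T`. -/
theorem exists_isRegularSolution (hK : HeatKernelBounds μ σ T 𝒦) (hμ : LevyCondition μ Λ)
    (hσ : 1 < σ) (hT : 0 < T) {M B l R₁ R₂ R₃ b : ℝ} {φ₀ : Rd d → ℝ} {φ₁ : Rd d → Rd d →L[ℝ] ℝ}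
    {φ₂ : Rd d → Rd d →L[ℝ] Rd d →L[ℝ] ℝ} {φ₃ : Rd d → Rd d →L[ℝ] Rd d →L[ℝ] Rd d →L[ℝ] ℝ}
    (hφ : InitialJet M φ₀ φ₁ φ₂ φ₃) {f₀ : ℝ → Rd d → ℝ} {f₁ : ℝ → Rd d → Rd d →L[ℝ] ℝ}
    {f₂ : ℝ → Rd d → Rd d →L[ℝ] Rd d →L[ℝ] ℝ} (hf : SourceJet T M f₀ f₁ f₂) (hM : 0 ≤ M)
    {h : Args d → ℝ} {h₁ : Args d → Args d →L[ℝ] ℝ} {h₂ : Args d → Args d →L[ℝ] Args d →L[ℝ] ℝ}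
    (hj : BoundedJet univ B h h₁ h₂) (hb : ∀ w, ‖h w‖ ≤ B) (hl : 0 ≤ l)
    (hδ : weightMass T (1 / σ) (max (max (𝒦 1 1) (𝒦 2 1)) 0) l ≤ 1 / (2 * (B + 1)))
    (e1 : R₁ = M + (M + B))
    (e2 : R₂ = 2 * (M + (M + B * (1 + R₁ * Real.exp (l * T)))))
    (e3 : R₃ = 2 * (M + (M + (B * (R₂ * Real.exp (l * T))
      + B * (1 + R₁ * Real.exp (l * T) + R₂ * Real.exp (l * T)) ^ 2))))
    (hb0 : M + B ≤ b)
    (hb1 : M + B * (1 + R₁ * Real.exp (l * T) + R₂ * Real.exp (l * T)) ≤ b)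
    (hb2 : M + (B * (R₂ * Real.exp (l * T) + R₃ * Real.exp (l * T))
      + B * (1 + R₁ * Real.exp (l * T) + R₂ * Real.exp (l * T)) ^ 2) ≤ b) :
    ∃ U u ρ, IsRegularSolution T μ h f₀ φ₀ l R₁ R₂ R₃
      (3 * M * max Λ 0 + (b + max T 0 * (3 * b * max Λ 0))) U u ρ := by
  have hk := hK.isHeatKernel hμ
  have ha0 : 0 < 1 / σ := by positivity
  have ha : 1 / σ < 1 := by rw [div_lt_one (by linarith)]; exact hσ
  have hB := hj.nonneg
  let i₀ : Rd d →L[ℝ] Args d := ContinuousLinearMap.inl ℝ _ _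
  let i₁ : ℝ →L[ℝ] Args d := (ContinuousLinearMap.inr ℝ _ _).comp (ContinuousLinearMap.inl ℝ _ _)
  let i₂ : (Rd d →L[ℝ] ℝ) →L[ℝ] Args d :=
    (ContinuousLinearMap.inr ℝ _ _).comp (ContinuousLinearMap.inr ℝ _ _)
  have n0 : ‖i₀‖ ≤ 1 := i₀.opNorm_le_bound zero_le_one fun x => by simp [i₀]
  have n1 : ‖i₁‖ ≤ 1 := i₁.opNorm_le_bound zero_le_one fun x => by simp [i₁]
  have n2 : ‖i₂‖ ≤ 1 := i₂.opNorm_le_bound zero_le_one fun x => by simp [i₂]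
  have hval : ∀ x u p, i₀ x + (i₁ u + i₂ p) = (x, u, p) := fun x u p => by
    change ((x, (0 : ℝ), (0 : Rd d →L[ℝ] ℝ)) : Rd d × ℝ × (Rd d →L[ℝ] ℝ))
      + (((0 : Rd d), u, (0 : Rd d →L[ℝ] ℝ)) + ((0 : Rd d), (0 : ℝ), p)) = _
    simp
  have hN := hj.isTower n0 n1 n2 hb
  obtain ⟨U, hU, hmild⟩ := exists_mild_solution hk ha0 ha hφ hf hN hM hB hl hδ e1 e2 e3
  have hR1 : 0 ≤ R₁ := by rw [e1]; positivity
  have hR2 : 0 ≤ R₂ := by rw [e2]; positivity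
  have hR3 : 0 ≤ R₃ := by rw [e3]; positivity
  have s0 := hU.isSource_src₀ hf hN hM hB hl hR1 hR2 hR3
  have s1 := hU.isSource_src₁ hf hN hM hB hl hR1 hR2 hR3
  have s2 := hU.isSource_src₂ hf hN hM hB hl hR1 hR2 hR3
  have g1 := hU.hasFDerivAt_src₁ hf hN hM hB hl hR1 hR2 hR3
  have hc0 := hU.continuousOn_src₀ hf hN hM hB
  set N₀ : Rd d → ℝ → (Rd d →L[ℝ] ℝ) → ℝ := fun x u p => h (i₀ x + (i₁ u + i₂ p)) with hN₀
  have hg : IsC11Source T b (U.src₀ T f₀ N₀) _ :=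
    ⟨⟨s0.stronglyMeasurable, s0.zero, fun s x => (s0.bound s x).trans hb0⟩,
      ⟨s1.stronglyMeasurable, s1.zero, fun s x => (s1.bound s x).trans hb1⟩,
      hU.hasFDerivAt_src₀ hf hN hM hB hl hR1 hR2 hR3,
      fun t => norm_sub_le_of_hasFDerivAt (g1 t) fun x => (s2.bound t x).trans hb2⟩
  have hφl := hφ.hasLipschitzDeriv
  set ρ := mildRate μ T φ₀ (U.src₀ T f₀ N₀) with hρ
  set K := 3 * M * max Λ 0 + (b + max T 0 * (3 * b * max Λ 0)) with hKdef
  have hρb : ∀ t x, |ρ t x| ≤ K := abs_mildRate_le hK hμ hφl hg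
  have hρm := stronglyMeasurable_mildRate hK hμ hφl hg
  have hρc := continuousOn_mildRate hK hμ hφl hg hc0
  have hρx : ∀ x, StronglyMeasurable fun r => ρ r x := fun x =>
    hρm.comp_measurable (g := fun r : ℝ => (r, x)) (by fun_prop)
  have hρi : ∀ x s t, IntervalIntegrable (fun r => ρ r x) volume s t := fun x s t =>
    (intervalIntegrable_const (c := K)).mono_fun' (hρx x).aestronglyMeasurable
      (ae_of_all _ fun r => hρb r x)
  set u : ℝ → Rd d → ℝ := fun t x => φ₀ x + ∫ r in (0 : ℝ)..t, ρ r x with hu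
  have hK0 : 0 ≤ K := (abs_nonneg _).trans (hρb 0 0)
  have hut : ∀ x s t, |u t x - u s x| ≤ K * |t - s| := fun x s t => by
    have h3 : u t x - u s x = ∫ r in s..t, ρ r x := by
      rw [hu]
      simp only [add_sub_add_left_eq_sub]
      exact intervalIntegral.integral_interval_sub_left (hρi x _ _) (hρi x _ _)
    rw [h3, ← Real.norm_eq_abs]
    exact intervalIntegral.norm_integral_le_of_norm_le_const fun r _ => hρb r x
  have hueq : ∀ t ∈ Ioo 0 T, u t = U.v₀ t := fun t ht => by
    ext x
    rw [hmild t ht x, mild_eq_integral hK hμ hφl hg ht]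
  have huc : ∀ x, Continuous fun t => u t x := fun x =>
    (LipschitzWith.of_dist_le_mul (K := K.toNNReal) fun t s => by
      rw [Real.dist_eq, Real.dist_eq, Real.coe_toNNReal _ hK0]
      exact hut x s t).continuous
  have hux : ∀ t ∈ Icc 0 T, ∀ x y, |u t x - u t y| ≤ R₁ * Real.exp (l * T) * ‖x - y‖ := by
    intro t ht x y
    have hcl : IsClosed {t : ℝ | |u t x - u t y| ≤ R₁ * Real.exp (l * T) * ‖x - y‖} :=
      isClosed_le ((huc x).sub (huc y)).abs continuous_const
    have hsub : Ioo 0 T ⊆ {t : ℝ | |u t x - u t y| ≤ R₁ * Real.exp (l * T) * ‖x - y‖} := by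
      intro s hs
      change |u s x - u s y| ≤ _
      rw [hueq s hs]
      exact norm_sub_le_of_hasFDerivAt (hU.d₀ s hs) (fun z => (hU.b₁ s hs z).trans
        (mul_exp_le_mul_exp hR1 hl hs)) x y
    have := closure_minimal hsub hcl
    rw [closure_Ioo hT.ne] at this
    exact this ht
  refine ⟨U, u, ρ, hU, hueq, ?_, fun t ht x => ?_, hρc, fun t _ x => hρb t x,
    fun t ht x => ?_, fun x => ?_⟩
  · have hL : 0 ≤ R₁ * Real.exp (l * T) := by positivity
    refine (LipschitzOnWith.of_dist_le_mul (K := (K + R₁ * Real.exp (l * T)).toNNReal)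
      fun q hq q' hq' => ?_).continuousOn
    rw [Real.coe_toNNReal _ (by positivity), Real.dist_eq, add_mul]
    refine (abs_sub_le _ (u q'.1 q.2) _).trans (add_le_add ?_ ?_)
    · refine (hut _ _ _).trans ?_
      gcongr
      rw [← Real.dist_eq]
      exact le_max_left _ _
    · refine (hux _ hq'.1 _ _).trans ?_
      gcongr
      rw [← dist_eq_norm]
      exact le_max_right _ _
  · have h4 : ContinuousAt (fun r => ρ r x) t := by
      have h5 := hρc.continuousAt ((isOpen_strip T).mem_nhds
        (show (t, x) ∈ strip (Rd d) T from ⟨ht, mem_univ _⟩))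
      exact ContinuousAt.comp (f := fun r : ℝ => (r, x))
        (g := fun q : ℝ × Rd d => ρ q.1 q.2) h5 (by fun_prop)
    exact (intervalIntegral.integral_hasDerivAt_right (hρi x 0 t)
      ((hρx x).aestronglyMeasurable.stronglyMeasurableAtFilter) h4).const_add (φ₀ x)
  · have h6 : u t = fun x => heatOp (heatKer μ T) t φ₀ x
        + duhamel (heatKer μ T) (U.src₀ T f₀ N₀) t x := by
      rw [hueq t ht]; ext x; exact hmild t ht x
    have h7 := levyOp_mild hK hμ hφl hg t x
    rw [← h6] at h7
    have h8 : U.src₀ T f₀ N₀ t x = f₀ t x - h (x, U.v₀ t x, U.v₁ t x) := by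
      rw [Jet.src₀, cutTime_of_mem ht]
      simp only [hN₀, hval]
    rw [h7, h8, hueq t ht]
  · simp [hu]

end RegularSolution

/-! ### A priori bounds and uniqueness -/

section APriori

variable {d : ℕ} {μ : Measure (Rd d)} {Λ T : ℝ}

theorem le_on_Icc_of_le_on_Ioo (hT : 0 < T) {w : ℝ → Rd d → ℝ} {b : ℝ}
    (hc : ContinuousOn (fun q : ℝ × Rd d => w q.1 q.2) (Icc 0 T ×ˢ univ))
    (h : ∀ t ∈ Ioo 0 T, ∀ x, w t x ≤ b) : ∀ t ∈ Icc 0 T, ∀ x, w t x ≤ b := by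
  intro t ht x
  have hx : ContinuousOn (fun s => w s x) (closure (Ioo 0 T)) := by
    rw [closure_Ioo hT.ne]
    exact hc.comp (f := fun s : ℝ => (s, x)) (by fun_prop) fun s hs => ⟨hs, mem_univ _⟩
  refine le_on_closure (fun s hs => h s hs x) hx continuousOn_const ?_
  rwa [closure_Ioo hT.ne]

/-- The maximum principle for functions that solve the inequality on the open time interval. -/
theorem LevyCondition.max_principle_Ioo (h : LevyCondition μ Λ) (hT : 0 < T) {l m B : ℝ}
    {w : ℝ → Rd d → ℝ}
    (hc : ContinuousOn (fun q : ℝ × Rd d => w q.1 q.2) (Icc 0 T ×ˢ univ))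
    (hB : ∀ t ∈ Ioo 0 T, ∀ x, |w t x| ≤ B)
    (hd : ∀ t ∈ Ioo 0 T, ∀ x, DifferentiableAt ℝ (fun s => w s x) t)
    (h2 : ∀ t ∈ Ioo 0 T, ContDiff ℝ 2 (w t)) (h0 : ∀ x, w 0 x ≤ m)
    (key : ∀ ε > 0, ∃ δ > 0, ∀ t ∈ Ioo 0 T, ∀ x, m + ε ≤ Real.exp (-(l * t)) * w t x →
      ‖fderiv ℝ (w t) x‖ ≤ δ → levyOp μ (w t) x ≤ δ →
      deriv (fun s => w s x) t - l * w t x ≤ -δ) :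
    ∀ t ∈ Icc 0 T, ∀ x, Real.exp (-(l * t)) * w t x ≤ m := by
  have hB' : ∀ t ∈ Icc 0 T, ∀ x, |w t x| ≤ B :=
    le_on_Icc_of_le_on_Ioo hT (w := fun t x => |w t x|) hc.abs hB
  refine le_on_Icc_of_le_on_Ioo hT (w := fun t x => Real.exp (-(l * t)) * w t x)
    (ContinuousOn.mul (by fun_prop) hc) fun t ht x => ?_
  have hsub : ∀ s ∈ Ioc 0 t, s ∈ Ioo 0 T := fun s hs => ⟨hs.1, hs.2.trans_lt ht.2⟩
  have hsub' : ∀ s ∈ Icc 0 t, s ∈ Icc 0 T := fun s hs => ⟨hs.1, hs.2.trans ht.2.le⟩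
  refine h.max_principle (hc.mono fun q hq => ⟨hsub' _ hq.1, hq.2⟩)
    (fun s hs => hB' s (hsub' s hs)) (fun s hs => hd s (hsub s hs))
    (fun s hs => h2 s (hsub s hs)) h0 (fun ε hε => ?_) t (right_mem_Icc.2 ht.1.le) x
  obtain ⟨δ, hδ, hk⟩ := key ε hε
  exact ⟨δ, hδ, fun s hs => hk s (hsub s hs)⟩

theorem exp_neg_mul_le_iff {l t w m : ℝ} :
    Real.exp (-(l * t)) * w ≤ m ↔ w ≤ m * Real.exp (l * t) := by
  rw [Real.exp_neg, inv_mul_le_iff₀ (Real.exp_pos _), mul_comm]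

theorem le_exp_neg_mul_iff {l t w m : ℝ} :
    m ≤ Real.exp (-(l * t)) * w ↔ m * Real.exp (l * t) ≤ w := by
  rw [Real.exp_neg, le_inv_mul_iff₀ (Real.exp_pos _), mul_comm]

theorem levyOp_zero (x : Rd d) : levyOp μ (fun _ => (0 : ℝ)) x = 0 := by
  simp [levyOp]

theorem levyOp_comp_add (φ : Rd d → ℝ) (x e : Rd d) :
    levyOp μ (fun y => φ (y + e)) x = levyOp μ φ (x + e) := by
  simp only [levyOp, fderiv_comp_add_right, add_right_comm x _ e]

theorem Jet.IsGood.contDiff {U : Jet (Rd d) ℝ} {l R₁ R₂ R₃ : ℝ} (h : U.IsGood T l R₁ R₂ R₃)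
    {t : ℝ} (ht : t ∈ Ioo 0 T) : ContDiff ℝ 3 (U.v₀ t) := by
  have c3 : Continuous (U.v₃ t) := by
    rw [← continuousOn_univ]
    exact h.c₃.comp (f := fun x : Rd d => (t, x)) (by fun_prop) fun x _ => ⟨ht, mem_univ _⟩
  have s2 : ContDiff ℝ 1 (U.v₂ t) := contDiff_one_iff_hasFDerivAt.2 ⟨U.v₃ t, c3, h.d₂ t ht⟩
  have s1 : ContDiff ℝ 2 (U.v₁ t) :=
    (contDiff_succ_iff_hasFDerivAt (n := 1)).2 ⟨U.v₂ t, s2, h.d₁ t ht⟩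
  exact (contDiff_succ_iff_hasFDerivAt (n := 2)).2 ⟨U.v₁ t, s1, h.d₀ t ht⟩

section

variable {H : Rd d × ℝ × Rd d → ℝ} {C A : ℝ → ℝ} {γ : ℝ}

theorem Hamiltonian.abs_le (hH : Hamiltonian H C A γ) (x : Rd d) {p : Rd d} (hp : ‖p‖ < 1) :
    |H (x, 0, p)| ≤ |C 1| := by
  have h := hH.bound 1 one_pos x 0 (by simp) p (by simpa using hp) 0 (by norm_num)
  rw [norm_iteratedFDeriv_zero] at h
  exact h.trans (le_abs_self _)

theorem Hamiltonian.le_sub_of_monotone (hH : Hamiltonian H C A γ) {θ : ℝ → ℝ}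
    (hθ : ∀ u v, u ≤ v → 0 ≤ θ v - θ u ∧ θ v - θ u ≤ v - u) (x p : Rd d) {u v : ℝ}
    (h : u ≤ v) : -(|γ| * (v - u)) ≤ H (x, θ v, p) - H (x, θ u, p) := by
  obtain ⟨h1, h2⟩ := hθ u v h
  have h3 := hH.monotone x (θ u) (θ v) p (by linarith)
  have h4 : -(|γ| * (v - u)) ≤ -(|γ| * (θ v - θ u)) := by gcongr
  have h5 : -(|γ| * (θ v - θ u)) ≤ γ * (θ v - θ u) := by
    rw [← neg_mul]; exact mul_le_mul_of_nonneg_right (neg_abs_le γ) h1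
  linarith

theorem Hamiltonian.abs_sub_le (hH : Hamiltonian H C A γ) {R : ℝ} (hR : 0 < R) (x : Rd d) {u : ℝ}
    (hu : u ∈ Icc (-R) R) {p q : Rd d} (hp : ‖p‖ < R) (hq : ‖q‖ < R) :
    |H (x, u, p) - H (x, u, q)| ≤ max (C R) 0 * ‖p - q‖ := by
  have hj := hH.boundedJet hR
  have hs : Convex ℝ ((univ : Set (Rd d)) ×ˢ (Icc (-R) R ×ˢ ball (0 : Rd d) R)) :=
    convex_univ.prod ((convex_Icc _ _).prod (convex_ball _ _))
  have h := hs.norm_image_sub_le_of_norm_hasFDerivWithin_le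
    (fun z _ => (hj.hasFDerivAt z).hasFDerivWithinAt) hj.bound₁
    (x := (x, u, q)) (y := (x, u, p)) ⟨mem_univ _, hu, by simpa using hq⟩
    ⟨mem_univ _, hu, by simpa using hp⟩
  have e : ‖((x, u, p) : Rd d × ℝ × Rd d) - (x, u, q)‖ = ‖p - q‖ := by simp
  rwa [e] at h

end

/-- Comparison of two classical solutions. At a point where the difference is nearly maximal the
gradients nearly coincide, so it suffices that they are bounded there. -/
theorem IsClassicalSolution.le {H : Rd d × ℝ × Rd d → ℝ} {C A : ℝ → ℝ} {γ R₁ : ℝ}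
    {f : ℝ → Rd d → ℝ} {u₀ : Rd d → ℝ} {u v : ℝ → Rd d → ℝ} (hμ : LevyCondition μ Λ)
    (hT : 0 < T) (hH : Hamiltonian H C A γ) (hu : IsClassicalSolution T μ H f u₀ u)
    (hv : IsClassicalSolution T μ H f u₀ v)
    (hR₁ : ∀ t ∈ Ioo 0 T, ∀ x, ‖gradient (v t) x - gradient (u t) x‖ ≤ 1 →
      ‖gradient (v t) x‖ ≤ R₁ ∧ ‖gradient (u t) x‖ ≤ R₁) :
    ∀ t ∈ Icc 0 T, ∀ x, v t x ≤ u t x := by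
  obtain ⟨B, hB⟩ := hu.bounded
  obtain ⟨B', hB'⟩ := hv.bounded
  have hI : ∀ {t}, t ∈ Ioo 0 T → t ∈ Icc 0 T := fun ht => Ioo_subset_Icc_self ht
  -- a range of `u` and `p` that contains both solutions at the points of interest, and on which the
  -- Hamiltonian is Lipschitz in `p`
  set R : ℝ := max |B| |R₁| + 1 with hR
  have hR0 : 0 < R := by positivity
  set K : ℝ := max (C R) 0 with hK
  have hK0 : 0 ≤ K := le_max_right _ _
  have hw : ∀ t, (fun y => v t y - u t y) = fun y => v t y + (-1) * u t y := fun t => by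
    ext y; ring
  suffices h : ∀ t ∈ Icc 0 T, ∀ x, Real.exp (-((|γ| + 1) * t)) * (v t x - u t x) ≤ 0 by
    intro t ht x
    have := exp_neg_mul_le_iff.1 (h t ht x)
    linarith
  refine hμ.max_principle_Ioo hT (w := fun t x => v t x - u t x) (B := B' + B)
    (hv.continuousOn.sub hu.continuousOn)
    (fun t ht x => (abs_sub _ _).trans (add_le_add (hB' t (hI ht) x) (hB t (hI ht) x)))
    (fun t ht x => (hv.differentiable_time t ht x).sub (hu.differentiable_time t ht x))
    (fun t ht => (hv.contDiff_space t ht).sub (hu.contDiff_space t ht))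
    (fun x => by rw [hv.initial, hu.initial, sub_self]) fun ε hε => ?_
  refine ⟨min 1 (ε / (2 + K)), by positivity, fun t ht x hx hD hL => ?_⟩
  set δ := min 1 (ε / (2 + K)) with hδ
  have hδε : (2 + K) * δ ≤ ε := by
    rw [← le_div_iff₀' (by positivity)]; exact min_le_right _ _
  have hdv := ((hv.contDiff_space t ht).differentiable two_ne_zero) x
  have hdu := ((hu.contDiff_space t ht).differentiable two_ne_zero) x
  have hD' : ‖gradient (v t) x - gradient (u t) x‖ ≤ δ := by
    rw [gradient_eq_gradOfDual, gradient_eq_gradOfDual, ← map_sub, norm_gradOfDual,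
      ← fderiv_fun_sub hdv hdu]
    exact hD
  obtain ⟨n1, n2⟩ := hR₁ t ht x (hD'.trans (min_le_left _ _))
  have hw0 : ε ≤ v t x - u t x := by
    rw [zero_add, le_exp_neg_mul_iff] at hx
    refine le_trans ?_ hx
    exact le_mul_of_one_le_right hε.le (Real.one_le_exp (by have := ht.1; positivity))
  have hdt : deriv (fun s => v s x - u s x) t = timeDeriv v (t, x) - timeDeriv u (t, x) :=
    deriv_fun_sub (hv.differentiable_time t ht x) (hu.differentiable_time t ht x)
  have hLe : levyOp μ (fun y => v t y - u t y) x = levyOp μ (v t) x - levyOp μ (u t) x := by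
    rw [hw, hμ.levyOp_add_smul (hv.contDiff_space t ht) (hu.contDiff_space t ht)
      (hB' t (hI ht)) (hB t (hI ht))]
    ring
  have hLe' : levyOp μ (v t) x - levyOp μ (u t) x ≤ δ := hLe ▸ hL
  have q1 := hv.equation t ht x
  have q2 := hu.equation t ht x
  have q3 := hH.le_sub_of_monotone (θ := id) (fun u v h => ⟨by simpa using h, le_rfl⟩) x
    (gradient (v t) x) (u := u t x) (v := v t x) (by linarith)
  simp only [id] at q3
  have hlt : ∀ {p : Rd d}, ‖p‖ ≤ R₁ → ‖p‖ < R := fun hp => by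
    rw [hR]
    exact (hp.trans ((le_abs_self _).trans (le_max_right _ _))).trans_lt (lt_add_one _)
  have hur : u t x ∈ Icc (-R) R := by
    refine _root_.abs_le.1 ?_
    exact (hB t (hI ht) x).trans ((le_abs_self _).trans ((le_max_left _ _).trans
      (le_add_of_nonneg_right zero_le_one)))
  have q4 := hH.abs_sub_le hR0 x hur (hlt n1) (hlt n2)
  have q5 : -(K * δ) ≤ H (x, u t x, gradient (v t) x) - H (x, u t x, gradient (u t) x) :=
    (neg_le_neg (mul_le_mul_of_nonneg_left hD' hK0)).trans (neg_le_of_abs_le q4)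
  rw [hdt]
  linarith

section Truncated

variable {σ : ℝ} {H : Rd d × ℝ × Rd d → ℝ} {C A : ℝ → ℝ} {γ : ℝ} {f : ℝ → Rd d → ℝ}
  {u₀ : Rd d → ℝ} {M L M₂ M₃ l R₁ R₂ R₃ R : ℝ} {θ : ℝ → ℝ} {ϑ : Rd d → Rd d}
  {U : Jet (Rd d) ℝ} {u ρ : ℝ → Rd d → ℝ}

theorem IsRegularSolution.abs_le_Ioo {h : Args d → ℝ}
    (hr : IsRegularSolution T μ h f u₀ l R₁ R₂ R₃ R U u ρ) (hl : 0 ≤ l) {t : ℝ}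
    (ht : t ∈ Ioo 0 T) (x : Rd d) : |u t x| ≤ |R₁| * Real.exp (l * T) := by
  rw [hr.eq_jet t ht]
  refine (hr.good.b₀ t ht x).trans (le_trans ?_ (mul_exp_le_mul_exp (abs_nonneg R₁) hl ht))
  gcongr
  exact le_abs_self _

theorem IsRegularSolution.hasFDerivAt {h : Args d → ℝ}
    (hr : IsRegularSolution T μ h f u₀ l R₁ R₂ R₃ R U u ρ) {t : ℝ}
    (ht : t ∈ Ioo 0 T) (x : Rd d) : HasFDerivAt (u t) (U.v₁ t x) x := by
  rw [hr.eq_jet t ht]; exact hr.good.d₀ t ht x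

theorem IsRegularSolution.contDiff {h : Args d → ℝ}
    (hr : IsRegularSolution T μ h f u₀ l R₁ R₂ R₃ R U u ρ) {t : ℝ}
    (ht : t ∈ Ioo 0 T) : ContDiff ℝ 3 (u t) := by
  rw [hr.eq_jet t ht]; exact hr.good.contDiff ht

/-- The maximum principle for `u` and for `-u`; the bound does not depend on the truncation. -/
theorem IsRegularSolution.abs_le (hr : IsRegularSolution T μ
      (fun w => H (w.1, θ w.2.1, ϑ (gradOfDual d w.2.2))) f u₀ l R₁ R₂ R₃ R U u ρ)
    (hμ : LevyCondition μ Λ) (hT : 0 < T) (hH : Hamiltonian H C A γ)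
    (hS : SourceAndInitial T f u₀ M L M₂ M₃) (hl : 0 ≤ l) (hθ0 : θ 0 = 0)
    (hθ : ∀ u v, u ≤ v → 0 ≤ θ v - θ u ∧ θ v - θ u ≤ v - u) (hϑ : ∀ p, ‖ϑ p‖ ≤ ‖p‖) :
    ∀ t ∈ Icc 0 T, ∀ x, |u t x| ≤ (max M 0 + |C 1|) * Real.exp ((|γ| + 1) * T) := by
  have hI : ∀ {t}, t ∈ Ioo 0 T → t ∈ Icc 0 T := fun ht => Ioo_subset_Icc_self ht
  set m := max M 0 + |C 1| with hm
  have hm0 : 0 ≤ m := by positivity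
  have key : ∀ s : ℝ, |s| = 1 → ∀ t ∈ Icc 0 T, ∀ x,
      Real.exp (-((|γ| + 1) * t)) * (s * u t x) ≤ m := by
    intro s hs
    refine hμ.max_principle_Ioo hT (w := fun t x => s * u t x)
      (B := |R₁| * Real.exp (l * T)) (hr.continuousOn.const_mul s)
      (fun t ht x => ?_) (fun t ht x => ((hr.hasDerivAt t ht x).const_mul s).differentiableAt)
      (fun t ht => contDiff_const.mul ((hr.contDiff ht).of_le (by norm_num)))
      (fun x => ?_) fun ε hε => ?_
    · rw [abs_mul, hs, one_mul]; exact hr.abs_le_Ioo hl ht x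
    · rw [hr.initial]
      refine (le_abs_self _).trans ?_
      rw [abs_mul, hs, one_mul]
      exact (hS.u₀_bound x).trans ((le_max_left _ _).trans (le_add_of_nonneg_right (abs_nonneg _)))
    -- the gradient is smaller than `1`, so that `C 1` bounds `H(x, 0, p)`
    refine ⟨min (1 / 2) (ε / 2), by positivity, fun t ht x hx hD hL => ?_⟩
    set δ := min (1 / 2) (ε / 2) with hδ
    have hδ1 : δ < 1 := (min_le_left _ _).trans_lt (by norm_num)
    have hδ2 : δ ≤ ε / 2 := min_le_right _ _
    have hp : ‖ϑ (gradOfDual d (U.v₁ t x))‖ < 1 := by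
      refine (hϑ _).trans_lt ?_
      rw [norm_gradOfDual]
      rw [((hr.hasFDerivAt ht x).const_mul s).fderiv, norm_smul, Real.norm_eq_abs, hs,
        one_mul] at hD
      exact hD.trans_lt hδ1
    set p := ϑ (gradOfDual d (U.v₁ t x)) with hpdef
    have hw : m + ε ≤ s * u t x := by
      rw [le_exp_neg_mul_iff] at hx
      refine le_trans ?_ hx
      exact le_mul_of_one_le_right (by positivity)
        (Real.one_le_exp (by have := ht.1; positivity))
    have hLe : levyOp μ (fun y => s * u t y) x = s * levyOp μ (u t) x := by
      have e : (fun y => s * u t y) = fun y => (fun _ : Rd d => (0 : ℝ)) y + s * u t y := by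
        ext y; simp
      rw [e, hμ.levyOp_add_smul contDiff_const ((hr.contDiff ht).of_le (by norm_num))
        (b := 0) (fun y => by simp) (hr.abs_le_Ioo hl ht), levyOp_zero, zero_add]
    have hL' : s * levyOp μ (u t) x ≤ δ := hLe ▸ hL
    rw [hr.levyOp_apply t ht x] at hL'
    rw [((hr.hasDerivAt t ht x).const_mul s).deriv]
    have hH0 := hH.abs_le x hp
    have hf : s * f t x ≤ max M 0 := by
      refine (le_abs_self _).trans ?_
      rw [abs_mul, hs, one_mul]
      exact (hS.f_bound t (hI ht) x).trans (le_max_left _ _)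
    have hh : -(s * H (x, θ (u t x), p)) ≤ |C 1| + |γ| * (s * u t x) := by
      rw [_root_.abs_le] at hH0
      rcases eq_or_eq_neg_of_abs_eq hs with rfl | rfl
      · have q := hH.le_sub_of_monotone hθ x p (u := 0) (v := u t x) (by linarith)
        rw [hθ0] at q
        linarith
      · have q := hH.le_sub_of_monotone hθ x p (u := u t x) (v := 0) (by linarith)
        rw [hθ0] at q
        linarith
    nlinarith
  intro t ht x
  have e : m * Real.exp ((|γ| + 1) * t) ≤ m * Real.exp ((|γ| + 1) * T) := by
    gcongr; exact ht.2
  rw [_root_.abs_le]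
  have h1 := exp_neg_mul_le_iff.1 (key 1 (by simp) t ht x)
  have h2 := exp_neg_mul_le_iff.1 (key (-1) (by simp) t ht x)
  constructor <;> linarith

/-- The maximum principle for the differences `u(t, x + e) - u(t, x)`. The bound on the gradient
depends on the truncation in `u`, but not on the truncation in the gradient. -/
theorem IsRegularSolution.norm_fderiv_le {K Rθ : ℝ} (hr : IsRegularSolution T μ
      (fun w => H (w.1, θ w.2.1, ϑ (gradOfDual d w.2.2))) f u₀ l R₁ R₂ R₃ R U u ρ)
    (hμ : LevyCondition μ Λ) (hT : 0 < T) (hH : Hamiltonian H C A γ)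
    (hS : SourceAndInitial T f u₀ M L M₂ M₃) (hl : 0 ≤ l)
    (hθ : ∀ u v, u ≤ v → 0 ≤ θ v - θ u ∧ θ v - θ u ≤ v - u) (hϑ : ∀ p, ‖ϑ p‖ ≤ ‖p‖)
    (hRθ : 0 < Rθ) (hθR : ∀ u, |θ u| ≤ Rθ)
    (hK : ∀ x u p q, |H (x, θ u, ϑ p) - H (x, θ u, ϑ q)| ≤ K * ‖p - q‖) :
    ∀ t ∈ Ioo 0 T, ∀ x,
      ‖U.v₁ t x‖ ≤ (|L| + 1) * Real.exp ((|γ| + 2 * |A Rθ| + 2) * T) := by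
  have hI : ∀ {t}, t ∈ Ioo 0 T → t ∈ Icc 0 T := fun ht => Ioo_subset_Icc_self ht
  set a := |A Rθ| with ha
  have ha0 : 0 ≤ a := abs_nonneg _
  -- the term `|γ|` compensates the lack of monotonicity of `H`. The excess `2 * a + 2` makes the
  -- weighted norm `N` of the gradient satisfy `N ≤ max |L| ((a * N + a + |L|) / (2 * a + 2))`,
  -- where `N` enters the right-hand side with a factor below `1 / 2`; hence `N ≤ |L| + 1`
  set k := |γ| + 2 * a + 2 with hk
  have hk0 : 0 ≤ k := by positivity
  set S : Ioo 0 T × Rd d → ℝ := fun q => Real.exp (-(k * q.1)) * ‖U.v₁ q.1 q.2‖ with hSdef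
  have hbdd : BddAbove (range S) := by
    refine ⟨|R₁| * Real.exp (l * T), ?_⟩
    rintro _ ⟨⟨⟨t, ht⟩, x⟩, rfl⟩
    have h1 : Real.exp (-(k * t)) ≤ 1 := Real.exp_le_one_iff.2 (by have := ht.1; nlinarith)
    refine (mul_le_of_le_one_left (norm_nonneg _) h1).trans ((hr.good.b₁ t ht x).trans
      (le_trans ?_ (mul_exp_le_mul_exp (abs_nonneg R₁) hl ht)))
    gcongr
    exact le_abs_self _
  have hne : Nonempty (Ioo 0 T × Rd d) := ⟨⟨⟨T / 2, by constructor <;> linarith⟩, 0⟩⟩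
  set N := ⨆ q, S q with hN
  have hNle : ∀ t ∈ Ioo 0 T, ∀ x, ‖U.v₁ t x‖ ≤ N * Real.exp (k * t) := fun t ht x =>
    exp_neg_mul_le_iff.1 (le_ciSup hbdd (⟨t, ht⟩, x))
  have hN0 : 0 ≤ N := (by positivity : 0 ≤ S hne.some).trans (le_ciSup hbdd hne.some)
  set m := max |L| ((a * N + a + |L|) / (2 * a + 2)) with hm
  have hm0 : 0 ≤ m := (abs_nonneg L).trans (le_max_left _ _)
  have hm2 : a * N + a + |L| ≤ (2 * a + 2) * m := by
    rw [← div_le_iff₀' (by positivity)]; exact le_max_right _ _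
  have hK0 : 0 ≤ |K| := abs_nonneg _
  have key : ∀ e : Rd d, ∀ t ∈ Icc 0 T, ∀ x,
      Real.exp (-(k * t)) * (u t (x + e) - u t x) ≤ ‖e‖ * m := by
    intro e
    have hshift : ContinuousOn (fun q : ℝ × Rd d => u q.1 (q.2 + e)) (Icc 0 T ×ˢ univ) :=
      hr.continuousOn.comp (f := fun q : ℝ × Rd d => (q.1, q.2 + e)) (by fun_prop)
        fun q hq => ⟨hq.1, mem_univ _⟩
    have h2 : ∀ t ∈ Ioo 0 T, ContDiff ℝ 2 (u t) := fun t ht => (hr.contDiff ht).of_le (by norm_num)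
    have h2e : ∀ t ∈ Ioo 0 T, ContDiff ℝ 2 fun x => u t (x + e) := fun t ht =>
      (h2 t ht).comp (contDiff_id.add contDiff_const)
    refine hμ.max_principle_Ioo hT (w := fun t x => u t (x + e) - u t x)
      (B := |R₁| * Real.exp (l * T) + |R₁| * Real.exp (l * T)) (hshift.sub hr.continuousOn)
      (fun t ht x => (abs_sub _ _).trans
        (add_le_add (hr.abs_le_Ioo hl ht _) (hr.abs_le_Ioo hl ht _)))
      (fun t ht x => ((hr.hasDerivAt t ht (x + e)).sub (hr.hasDerivAt t ht x)).differentiableAt)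
      (fun t ht => (h2e t ht).sub (h2 t ht)) (fun x => ?_) fun ε hε => ?_
    · rw [hr.initial, hr.initial]
      have h3 := hS.lipschitz 0 (left_mem_Icc.2 hT.le) (x + e) x
      rw [add_sub_cancel_left] at h3
      calc u₀ (x + e) - u₀ x ≤ |u₀ (x + e) - u₀ x| := le_abs_self _
        _ ≤ L * ‖e‖ := by linarith [abs_nonneg (f 0 (x + e) - f 0 x)]
        _ ≤ m * ‖e‖ := by gcongr; exact (le_abs_self L).trans (le_max_left _ _)
        _ = ‖e‖ * m := mul_comm _ _
    refine ⟨ε / (2 + |K|), by positivity, fun t ht x hx hD hL => ?_⟩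
    set δ := ε / (2 + |K|) with hδ
    have hδε : (2 + |K|) * δ = ε := by rw [hδ]; field_simp
    have hE : 1 ≤ Real.exp (k * t) := Real.one_le_exp (by have := ht.1; positivity)
    have hD' : ‖U.v₁ t (x + e) - U.v₁ t x‖ ≤ δ := by
      have h4 : HasFDerivAt (fun y => u t (y + e)) (U.v₁ t (x + e)) x :=
        (hasFDerivAt_comp_add_right e).2 (hr.hasFDerivAt ht (x + e))
      rwa [(h4.fun_sub (hr.hasFDerivAt ht x)).fderiv] at hD
    have hLe : levyOp μ (fun y => u t (y + e) - u t y) x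
        = levyOp μ (u t) (x + e) - levyOp μ (u t) x := by
      have h5 : (fun y => u t (y + e) - u t y) = fun y => u t (y + e) + (-1) * u t y := by
        ext y; ring
      rw [h5, hμ.levyOp_add_smul (h2e t ht) (h2 t ht) (fun y => hr.abs_le_Ioo hl ht (y + e))
        (hr.abs_le_Ioo hl ht), levyOp_comp_add]
      ring
    have hL' : levyOp μ (u t) (x + e) - levyOp μ (u t) x ≤ δ := hLe ▸ hL
    rw [hr.levyOp_apply t ht, hr.levyOp_apply t ht] at hL'
    rw [((hr.hasDerivAt t ht (x + e)).fun_sub (hr.hasDerivAt t ht x)).deriv]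
    rw [le_exp_neg_mul_iff] at hx
    have hw0 : 0 ≤ u t (x + e) - u t x := le_trans (by positivity) hx
    set p := gradOfDual d (U.v₁ t (x + e)) with hp
    set q := gradOfDual d (U.v₁ t x) with hq
    have q1 : -(a * (N * Real.exp (k * t) + 1) * ‖e‖)
        ≤ H (x + e, θ (u t (x + e)), ϑ p) - H (x, θ (u t (x + e)), ϑ p) := by
      refine le_trans (neg_le_neg ?_) (neg_le_of_abs_le
        (hH.lipschitz Rθ hRθ (x + e) x _ (_root_.abs_le.1 (hθR (u t (x + e)))) (ϑ p)))
      rw [add_sub_cancel_left]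
      gcongr
      · exact le_abs_self _
      · refine (hϑ p).trans ?_
        rw [hp, norm_gradOfDual]
        exact hNle t ht _
    have q2 := hH.le_sub_of_monotone hθ x (ϑ p) (u := u t x) (v := u t (x + e)) (by linarith)
    have q3 : -(|K| * δ) ≤ H (x, θ (u t x), ϑ p) - H (x, θ (u t x), ϑ q) := by
      refine le_trans (neg_le_neg ?_) (neg_le_of_abs_le (hK x (u t x) p q))
      rw [hp, hq, ← map_sub, norm_gradOfDual]
      exact mul_le_mul (le_abs_self _) hD' (norm_nonneg _) (abs_nonneg _)
    have q4 : f t (x + e) - f t x ≤ |L| * ‖e‖ := by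
      have h6 := hS.lipschitz t (hI ht) (x + e) x
      rw [add_sub_cancel_left] at h6
      have h7 : L * ‖e‖ ≤ |L| * ‖e‖ := by gcongr; exact le_abs_self _
      linarith [abs_nonneg (u₀ (x + e) - u₀ x), le_abs_self (f t (x + e) - f t x)]
    -- the lower bound on the difference beats the terms of order `‖e‖`
    have q5 : (a * (N * Real.exp (k * t) + 1) + |L|) * ‖e‖ + 2 * ε
        ≤ (2 * a + 2) * (u t (x + e) - u t x) := by
      have h8 : a * (N * Real.exp (k * t) + 1) + |L| ≤ (2 * a + 2) * m * Real.exp (k * t) := by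
        refine le_trans ?_ (mul_le_mul_of_nonneg_right hm2 (Real.exp_pos _).le)
        nlinarith [mul_nonneg (add_nonneg ha0 (abs_nonneg L)) (sub_nonneg.2 hE)]
      have h9 : 2 * ε ≤ (2 * a + 2) * (ε * Real.exp (k * t)) := by
        have : ε ≤ ε * Real.exp (k * t) := le_mul_of_one_le_right hε.le hE
        nlinarith [mul_nonneg ha0 (hε.le.trans this)]
      calc _ ≤ (2 * a + 2) * m * Real.exp (k * t) * ‖e‖ + (2 * a + 2) * (ε * Real.exp (k * t)) := by
            gcongr
        _ = (2 * a + 2) * ((‖e‖ * m + ε) * Real.exp (k * t)) := by ring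
        _ ≤ _ := by gcongr
    have q6 : k * (u t (x + e) - u t x)
        = |γ| * (u t (x + e) - u t x) + (2 * a + 2) * (u t (x + e) - u t x) := by rw [hk]; ring
    rw [q6]
    dsimp only at hL' ⊢
    linarith
  have hfd : ∀ t ∈ Ioo 0 T, ∀ x, ‖U.v₁ t x‖ ≤ m * Real.exp (k * t) := by
    intro t ht x
    refine (hr.hasFDerivAt ht x).le_of_lip' (by positivity) (Eventually.of_forall fun y => ?_)
    have h1 := exp_neg_mul_le_iff.1 (key (y - x) t (hI ht) x)
    have h2 := exp_neg_mul_le_iff.1 (key (x - y) t (hI ht) y)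
    rw [add_sub_cancel] at h1 h2
    rw [norm_sub_rev] at h2
    rw [Real.norm_eq_abs, _root_.abs_le]
    constructor <;> linarith
  have hNm : N ≤ m := ciSup_le fun q => exp_neg_mul_le_iff.2 (hfd q.1 q.1.2 q.2)
  have hNL : N ≤ |L| + 1 := by
    rcases le_max_iff.1 hNm with h | h
    · linarith
    · rw [le_div_iff₀ (by positivity)] at h
      nlinarith [abs_nonneg L]
  intro t ht x
  refine (hNle t ht x).trans (le_trans ?_ (mul_exp_le_mul_exp (by positivity) hk0 ht))
  gcongr

end Truncated

end APriori

/-! ### Classical solutions -/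

section Classical

section SpaceDerivatives

variable {E F : Type*} [NormedAddCommGroup E] [NormedSpace ℝ E] [NormedAddCommGroup F]
  [NormedSpace ℝ F] {T : ℝ}

theorem continuousOn_iteratedFDeriv_zero {w : ℝ → E → F}
    (h : ContinuousOn (fun q : ℝ × E => w q.1 q.2) (strip E T)) :
    ContinuousOn (fun q : ℝ × E => iteratedFDeriv ℝ 0 (w q.1) q.2) (strip E T) := by
  simp only [iteratedFDeriv_zero_eq_comp, Function.comp_apply]
  exact (LinearIsometryEquiv.continuous _).comp_continuousOn h

/-- Iterated derivatives are reduced to the components of a jet, by peeling off the innermost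
derivative. -/
theorem continuousOn_iteratedFDeriv_succ {w : ℝ → E → F} {w' : ℝ → E → E →L[ℝ] F}
    (hd : ∀ t ∈ Ioo 0 T, ∀ x, HasFDerivAt (w t) (w' t x) x) {k : ℕ}
    (h : ContinuousOn (fun q : ℝ × E => iteratedFDeriv ℝ k (w' q.1) q.2) (strip E T)) :
    ContinuousOn (fun q : ℝ × E => iteratedFDeriv ℝ (k + 1) (w q.1) q.2) (strip E T) := by
  refine ContinuousOn.congr (f := fun q : ℝ × E =>
    (continuousMultilinearCurryRightEquiv' ℝ k E F).symm (iteratedFDeriv ℝ k (w' q.1) q.2))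
    ((LinearIsometryEquiv.continuous _).comp_continuousOn h) fun q hq => ?_
  rw [iteratedFDeriv_succ_eq_comp_right, Function.comp_apply,
    show fderiv ℝ (w q.1) = w' q.1 from funext fun x => (hd q.1 hq.1 x).fderiv]

theorem norm_iteratedFDeriv_succ_of_hasFDerivAt {φ : E → F} {φ' : E → E →L[ℝ] F}
    (hd : ∀ x, HasFDerivAt φ (φ' x) x) (k : ℕ) (x : E) :
    ‖iteratedFDeriv ℝ (k + 1) φ x‖ = ‖iteratedFDeriv ℝ k φ' x‖ := by
  rw [← norm_iteratedFDeriv_fderiv, show fderiv ℝ φ = φ' from funext fun x => (hd x).fderiv]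

end SpaceDerivatives

theorem supNorm_le {α F : Type*} [NormedAddCommGroup F] {Q : Set α} {g : α → F} {c : ℝ}
    (h : ∀ q ∈ Q, ‖g q‖ ≤ c) : supNorm Q g ≤ ENNReal.ofReal c :=
  iSup₂_le fun q hq => by
    rw [← ofReal_norm]; exact ENNReal.ofReal_le_ofReal (h q hq)

theorem InitialJet.mono {E G : Type*} [NormedAddCommGroup E] [NormedSpace ℝ E]
    [NormedAddCommGroup G] [NormedSpace ℝ G] {M M' : ℝ} {φ₀ : E → G} {φ₁ : E → E →L[ℝ] G}
    {φ₂ : E → E →L[ℝ] E →L[ℝ] G} {φ₃ : E → E →L[ℝ] E →L[ℝ] E →L[ℝ] G}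
    (h : InitialJet M φ₀ φ₁ φ₂ φ₃) (hM : M ≤ M') : InitialJet M' φ₀ φ₁ φ₂ φ₃ :=
  { h with
    b₀ := fun x => (h.b₀ x).trans hM
    b₁ := fun x => (h.b₁ x).trans hM
    b₂ := fun x => (h.b₂ x).trans hM
    b₃ := fun x => (h.b₃ x).trans hM }

theorem SourceJet.mono {E G : Type*} [NormedAddCommGroup E] [NormedSpace ℝ E]
    [FiniteDimensional ℝ E] [MeasureSpace E] [BorelSpace E]
    [(volume : Measure E).IsAddHaarMeasure]
    [NormedAddCommGroup G] [NormedSpace ℝ G] [CompleteSpace G] {T M M' : ℝ} {f₀ : ℝ → E → G}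
    {f₁ : ℝ → E → E →L[ℝ] G} {f₂ : ℝ → E → E →L[ℝ] E →L[ℝ] G} (h : SourceJet T M f₀ f₁ f₂)
    (hM : M ≤ M') : SourceJet T M' f₀ f₁ f₂ :=
  { h with
    b₀ := fun t ht x => (h.b₀ t ht x).trans hM
    b₁ := fun t ht x => (h.b₁ t ht x).trans hM
    b₂ := fun t ht x => (h.b₂ t ht x).trans hM }

variable {d : ℕ} {μ : Measure (Rd d)} {T : ℝ} {h : Args d → ℝ} {H : Rd d × ℝ × Rd d → ℝ}
  {f : ℝ → Rd d → ℝ} {u₀ : Rd d → ℝ} {l R₁ R₂ R₃ R : ℝ} {U : Jet (Rd d) ℝ}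
  {u ρ : ℝ → Rd d → ℝ}

namespace IsRegularSolution

variable (hr : IsRegularSolution T μ h f u₀ l R₁ R₂ R₃ R U u ρ)
include hr

theorem continuousOn_spaceDeriv_and_norm_le :
    (∀ k ≤ 3, ContinuousOn (spaceDeriv k u) (spaceTime d T)) ∧
    ∀ q ∈ spaceTime d T, ‖spaceDeriv 0 u q‖ ≤ R₁ * Real.exp (l * q.1) ∧
      ‖spaceDeriv 1 u q‖ ≤ R₁ * Real.exp (l * q.1) ∧
      ‖spaceDeriv 2 u q‖ ≤ R₂ * Real.exp (l * q.1) ∧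
      ‖spaceDeriv 3 u q‖ ≤ R₃ * Real.exp (l * q.1) := by
  have hg := hr.good
  have hcongr : ∀ k, ContinuousOn (fun q : ℝ × Rd d => iteratedFDeriv ℝ k (U.v₀ q.1) q.2)
      (strip (Rd d) T) → ContinuousOn (spaceDeriv k u) (spaceTime d T) := fun k hk =>
    hk.congr fun q hq => by rw [spaceDeriv, hr.eq_jet q.1 hq.1]
  constructor
  · intro k hk
    apply hcongr
    interval_cases k
    · exact continuousOn_iteratedFDeriv_zero hg.c₀
    · exact continuousOn_iteratedFDeriv_succ hg.d₀ (continuousOn_iteratedFDeriv_zero hg.c₁)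
    · exact continuousOn_iteratedFDeriv_succ hg.d₀ (continuousOn_iteratedFDeriv_succ hg.d₁
        (continuousOn_iteratedFDeriv_zero hg.c₂))
    · exact continuousOn_iteratedFDeriv_succ hg.d₀ (continuousOn_iteratedFDeriv_succ hg.d₁
        (continuousOn_iteratedFDeriv_succ hg.d₂ (continuousOn_iteratedFDeriv_zero hg.c₃)))
  · rintro ⟨t, x⟩ ⟨ht, -⟩
    change t ∈ Ioo 0 T at ht
    simp only [spaceDeriv, hr.eq_jet t ht]
    rw [norm_iteratedFDeriv_succ_of_hasFDerivAt (hg.d₀ t ht) 2,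
      norm_iteratedFDeriv_succ_of_hasFDerivAt (hg.d₁ t ht) 1,
      norm_iteratedFDeriv_succ_of_hasFDerivAt (hg.d₂ t ht) 0,
      norm_iteratedFDeriv_succ_of_hasFDerivAt (hg.d₀ t ht) 1,
      norm_iteratedFDeriv_succ_of_hasFDerivAt (hg.d₁ t ht) 0,
      norm_iteratedFDeriv_succ_of_hasFDerivAt (hg.d₀ t ht) 0]
    simp only [norm_iteratedFDeriv_zero]
    exact ⟨hg.b₀ t ht x, hg.b₁ t ht x, hg.b₂ t ht x, hg.b₃ t ht x⟩

theorem timeDeriv_eq {q : ℝ × Rd d} (hq : q ∈ spaceTime d T) : timeDeriv u q = ρ q.1 q.2 :=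
  (hr.hasDerivAt q.1 hq.1 q.2).deriv

theorem supNorm_add_sum_le (hl : 0 ≤ l) (hR : 0 ≤ R) (hR₁ : 0 ≤ R₁) (hR₂ : 0 ≤ R₂)
    (hR₃ : 0 ≤ R₃) : supNorm (spaceTime d T) (timeDeriv u)
      + ∑ k ∈ Finset.range 4, supNorm (spaceTime d T) (spaceDeriv k u)
        ≤ ENNReal.ofReal (R + (R₁ + R₁ + R₂ + R₃) * Real.exp (l * T)) := by
  have hnorm := hr.continuousOn_spaceDeriv_and_norm_le.2
  have hexp : ∀ q ∈ spaceTime d T, ∀ {c r : ℝ}, 0 ≤ c → r ≤ c * Real.exp (l * q.1) →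
      r ≤ c * Real.exp (l * T) := fun q hq c r hc hrc =>
    hrc.trans (mul_exp_le_mul_exp hc hl hq.1)
  have s := supNorm_le (Q := spaceTime d T) (g := timeDeriv u) (c := R) fun q hq => by
    rw [hr.timeDeriv_eq hq]; exact hr.rate_le q.1 hq.1 q.2
  have s0 := supNorm_le (Q := spaceTime d T) (g := spaceDeriv 0 u)
    fun q hq => hexp q hq hR₁ (hnorm q hq).1
  have s1 := supNorm_le (Q := spaceTime d T) (g := spaceDeriv 1 u)
    fun q hq => hexp q hq hR₁ (hnorm q hq).2.1
  have s2 := supNorm_le (Q := spaceTime d T) (g := spaceDeriv 2 u)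
    fun q hq => hexp q hq hR₂ (hnorm q hq).2.2.1
  have s3 := supNorm_le (Q := spaceTime d T) (g := spaceDeriv 3 u)
    fun q hq => hexp q hq hR₃ (hnorm q hq).2.2.2
  simp only [Finset.sum_range_succ, Finset.sum_range_zero, zero_add]
  refine (add_le_add s (add_le_add (add_le_add (add_le_add s0 s1) s2) s3)).trans ?_
  rw [← ENNReal.ofReal_add (by positivity) (by positivity),
    ← ENNReal.ofReal_add (by positivity) (by positivity),
    ← ENNReal.ofReal_add (by positivity) (by positivity),
    ← ENNReal.ofReal_add (by positivity) (by positivity)]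
  exact ENNReal.ofReal_le_ofReal (le_of_eq (by ring))

theorem isClassicalSolution {b : ℝ} (hb : ∀ t ∈ Icc 0 T, ∀ x, |u t x| ≤ b)
    (hf : ContinuousOn (fun q : ℝ × Rd d => f q.1 q.2) (Icc 0 T ×ˢ univ)) (hH : Continuous H)
    (hh : ∀ t ∈ Ioo 0 T, ∀ x, h (x, u t x, U.v₁ t x) = H (x, u t x, gradient (u t) x)) :
    IsClassicalSolution T μ H f u₀ u := by
  have hsub : spaceTime d T ⊆ Icc 0 T ×ˢ univ := fun q hq => ⟨Ioo_subset_Icc_self hq.1, hq.2⟩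
  have hgr : ∀ t ∈ Ioo 0 T, ∀ x, gradient (u t) x = gradOfDual d (U.v₁ t x) := fun t ht x => by
    rw [gradient_eq_gradOfDual, (hr.hasFDerivAt ht x).fderiv]
  refine ⟨⟨b, hb⟩, hr.continuousOn, fun t ht x => (hr.hasDerivAt t ht x).differentiableAt,
    fun t ht => (hr.contDiff ht).of_le (by norm_num),
    hr.continuousOn_rate.congr fun q hq => hr.timeDeriv_eq hq,
    fun k hk => hr.continuousOn_spaceDeriv_and_norm_le.1 k (by omega), ?_, fun t ht x => ?_,
    hr.initial⟩
  · have hHc : ContinuousOn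
        (fun q : ℝ × Rd d => H (q.2, u q.1 q.2, gradOfDual d (U.v₁ q.1 q.2))) (spaceTime d T) :=
      hH.comp_continuousOn (continuousOn_snd.prodMk ((hr.continuousOn.mono hsub).prodMk
        ((gradOfDual d).continuous.comp_continuousOn hr.good.c₁)))
    refine (hr.continuousOn_rate.sub ((hf.mono hsub).sub hHc)).congr fun q hq => ?_
    rw [hr.levyOp_apply q.1 hq.1, hh q.1 hq.1, hgr q.1 hq.1]
    rfl
  · rw [hr.timeDeriv_eq (q := (t, x)) ⟨ht, mem_univ _⟩, hr.levyOp_apply t ht x, hh t ht x]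
    ring

end IsRegularSolution

end Classical

theorem theorem5p4 (d : ℕ) (σ T : ℝ) (hσ : σ ∈ Set.Ioo (1 : ℝ) 2) (hT : 0 < T)
    (Λ cμ : ℝ) (𝒦 : ℕ → ℝ → ℝ) (C A : ℝ → ℝ) (γ M L M₂ M₃ : ℝ) :
    ∃ c : ℝ, ∀ (μ : Measure (Rd d)) (H : Rd d × ℝ × Rd d → ℝ)
      (f : ℝ → Rd d → ℝ) (u₀ : Rd d → ℝ),
      LevyCondition μ Λ → Elliptic μ σ T cμ 𝒦 → Hamiltonian H C A γ →
      SourceAndInitial T f u₀ M L M₂ M₃ →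
      ∃ u : ℝ → Rd d → ℝ,
        IsClassicalSolution T μ H f u₀ u ∧
        (∀ t ∈ Set.Ioo 0 T, ContDiff ℝ 3 (u t)) ∧
        ContinuousOn (spaceDeriv 3 u) (spaceTime d T) ∧
        supNorm (spaceTime d T) (timeDeriv u)
          + ∑ k ∈ Finset.range 4, supNorm (spaceTime d T) (spaceDeriv k u) ≤ ENNReal.ofReal c ∧
        ∀ v : ℝ → Rd d → ℝ, IsClassicalSolution T μ H f u₀ v →
          ∀ t ∈ Set.Icc 0 T, ∀ x, v t x = u t x := by
  have ha : 1 / σ < 1 := by rw [div_lt_one (by linarith [hσ.1])]; exact hσ.1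
  -- the truncation of `u` is inactive below the a priori bound for `u`, the truncation of the
  -- gradient below the a priori bound for the gradient, which depends on the former
  set b₀ : ℝ := (max M 0 + |C 1|) * Real.exp ((|γ| + 1) * T) with hb₀
  have hb₀0 : 0 ≤ b₀ := by positivity
  obtain ⟨θ, Rθ, Bθ, θ₁, θ₂, hθj, hθR, hθid, hθm⟩ := exists_truncation_real hb₀0
  set b₁ : ℝ := (|L| + 1) * Real.exp ((|γ| + 2 * |A (|Rθ| + 1)| + 2) * T) with hb₁
  have hb₁0 : 0 ≤ b₁ := by positivity
  obtain ⟨ϑ, Bϑ, ϑ₁, ϑ₂, hϑj, hϑR, hϑid, hϑle⟩ := exists_truncation_vector d hb₁0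
  obtain ⟨K, hK⟩ := exists_boundedJet_truncated C hθj hθR hϑj hϑR
  set B : ℝ := max K 0 with hB
  have hB0 : 0 ≤ B := le_max_right _ _
  obtain ⟨l, hl, hδ⟩ := exists_weightMass_le (T := T) (C := max (max (𝒦 1 1) (𝒦 2 1)) 0) ha
    (δ := 1 / (2 * (B + 1))) (by positivity)
  set m : ℝ := max (max M₂ M₃) 0 with hm
  have hm0 : 0 ≤ m := le_max_right _ _
  set R₁ : ℝ := m + (m + B) with hR₁
  set R₂ : ℝ := 2 * (m + (m + B * (1 + R₁ * Real.exp (l * T)))) with hR₂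
  set R₃ : ℝ := 2 * (m + (m + (B * (R₂ * Real.exp (l * T))
      + B * (1 + R₁ * Real.exp (l * T) + R₂ * Real.exp (l * T)) ^ 2))) with hR₃
  have hR₁0 : 0 ≤ R₁ := by positivity
  have hR₂0 : 0 ≤ R₂ := by positivity
  have hR₃0 : 0 ≤ R₃ := by positivity
  set b : ℝ := max (m + B) (max (m + B * (1 + R₁ * Real.exp (l * T) + R₂ * Real.exp (l * T)))
    (m + (B * (R₂ * Real.exp (l * T) + R₃ * Real.exp (l * T))
      + B * (1 + R₁ * Real.exp (l * T) + R₂ * Real.exp (l * T)) ^ 2))) with hb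
  have hb0 : 0 ≤ b := le_trans (by positivity) (le_max_left _ _)
  set R : ℝ := 3 * m * max Λ 0 + (b + max T 0 * (3 * b * max Λ 0)) with hR
  have hR0 : 0 ≤ R := by positivity
  refine ⟨R + (R₁ + R₁ + R₂ + R₃) * Real.exp (l * T), fun μ H f u₀ hμ hell hH hS => ?_⟩
  obtain ⟨h₁, h₂, hj, hhK⟩ := hK H A γ hH
  have hKB : K ≤ B := le_max_left _ _
  obtain ⟨U, u, ρ, hr⟩ := exists_isRegularSolution hell.kernel hμ hσ.1 hT
    (hS.initialJet.mono ((le_max_right M₂ M₃).trans (le_max_left _ _)))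
    (hS.sourceJet.mono ((le_max_left M₂ M₃).trans (le_max_left _ _))) hm0
    (hj.mono hKB) (fun w => (hhK w).trans hKB) hl hδ hR₁ hR₂ hR₃
    (le_max_left _ _) ((le_max_left _ _).trans (le_max_right _ _))
    ((le_max_right _ _).trans (le_max_right _ _))
  have hθ0 : θ 0 = 0 := hθid 0 (by simpa using hb₀0)
  have hub := hr.abs_le hμ hT hH hS hl hθ0 hθm hϑle
  have hlip : ∀ x u p q, |H (x, θ u, ϑ p) - H (x, θ u, ϑ q)| ≤ K * ‖p - q‖ := by
    intro x u p q
    set J := InnerProductSpace.toDual ℝ (Rd d) with hJ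
    have hGJ : ∀ p, gradOfDual d (J p) = p := fun p => J.symm_apply_apply p
    have h3 := norm_sub_le_of_hasFDerivAt hj.hasFDerivAt (fun w => hj.bound₁ w (mem_univ w))
      (x, u, J p) (x, u, J q)
    have e : ‖((x, u, J p) : Rd d × ℝ × (Rd d →L[ℝ] ℝ)) - (x, u, J q)‖ = ‖p - q‖ := by
      simp only [Prod.mk_sub_mk, sub_self, Prod.norm_mk, norm_zero]
      rw [← map_sub, J.norm_map]
      simp
    rw [e] at h3
    simpa only [hGJ, Real.norm_eq_abs] using h3
  have hgb : ∀ t ∈ Ioo 0 T, ∀ x, ‖U.v₁ t x‖ ≤ b₁ :=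
    hr.norm_fderiv_le hμ hT hH hS hl hθm hϑle (by positivity)
      (fun u => (hθR u).trans ((le_abs_self _).trans (le_add_of_nonneg_right zero_le_one))) hlip
  have hgr : ∀ t ∈ Ioo 0 T, ∀ x, gradient (u t) x = gradOfDual d (U.v₁ t x) := fun t ht x => by
    rw [gradient_eq_gradOfDual, (hr.hasFDerivAt ht x).fderiv]
  have hcl : IsClassicalSolution T μ H f u₀ u :=
    hr.isClassicalSolution hub hS.f_continuous hH.contDiff.continuous fun t ht x => by
      dsimp only
      rw [hθid _ (hub t (Ioo_subset_Icc_self ht) x), hgr t ht,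
        hϑid _ (by rw [norm_gradOfDual]; exact hgb t ht x)]
  have hcont := hr.continuousOn_spaceDeriv_and_norm_le.1
  refine ⟨u, hcl, fun t ht => hr.contDiff ht, hcont 3 le_rfl, ?_, fun v hv t ht x => ?_⟩
  · exact hr.supNorm_add_sum_le hl hR0 hR₁0 hR₂0 hR₃0
  -- only the gradient of `u` is bounded beforehand; that of `v` is needed where they are close
  · have hnear : ∀ t ∈ Ioo 0 T, ∀ x, ‖gradient (u t) x‖ ≤ b₁ := fun t ht x => by
      rw [hgr t ht, norm_gradOfDual]; exact hgb t ht x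
    refine le_antisymm (hcl.le hμ hT hH hv (R₁ := b₁ + 1) (fun t ht x h => ?_) t ht x)
      (hv.le hμ hT hH hcl (R₁ := b₁ + 1) (fun t ht x h => ?_) t ht x)
    · have := hnear t ht x
      exact ⟨by linarith [norm_le_norm_add_norm_sub' (gradient (v t) x) (gradient (u t) x)],
        by linarith⟩
    · have := hnear t ht x
      rw [norm_sub_rev] at h
      exact ⟨by linarith,
        by linarith [norm_le_norm_add_norm_sub' (gradient (v t) x) (gradient (u t) x)]⟩
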